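/- Let $d,k\ge 2$ be fixed integers. A $(d,\le k)$-CSP formula over $n$ variables $x_1,\dots,x_n$ with values in $\{1,\dots,d\}$ is a finite set (conjunction) of constraints, each constraint being a set (disjunction) of at most $k$ literals of the form $(x_i\neq c)$ with $c\in\{1,\dots,d\}$; it is satisfied by an assignment $\alpha:\{x_1,\dots,x_n\}\to\{1,\dots,d\}$ if every constraint contains a literal $(x_i\ne c)$ with $\alpha(x_i)\neq c$. The problem $(d,\le k)$-CSP is to decide whether a given $(d,\le k)$-CSP formula has a satisfying assignment. For every $\varepsilon>0$ there is a deterministic algorithm (a deterministic multi-stack Turing machine) that solves $(d,\le k)$-CSP in time $$O^*\left(\left(\frac{d(k-1)}{k}+\varepsilon\right)^n\right),$$ that is, for some polynomial $p$ (depending on $d$, $k$ and $\varepsilon$ only) it decides every $(d,\le k)$-CSP formula over $n$ variables in at most $p(n)\left(\frac{d(k-1)}{k}+\varepsilon\right)^n$ steps, for every $n$. -/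

import Mathlib

namespace CSP

/-- A literal `x_i ≠ c`, stored as the pair `(i, c)`, over the variables `x_i`, `i : Fin n`,
with values in a domain `Fin d` of size `d`. -/
abbrev Literal (d n : ℕ) : Type := Fin n × Fin d

/-- A `(d, ≤ k)`-CSP formula over `n` variables: a finite set (conjunction) of constraints, each
of which is a finite set (disjunction) of at most `k` literals. -/
structure Formula (d k n : ℕ) where
  constraints : Finset (Finset (Literal d n))
  card_le : ∀ C ∈ constraints, C.card ≤ k

/-- An assignment `α` of values to the variables satisfies the formula `F` if every constraint
of `F` contains a literal `x_i ≠ c` with `α i ≠ c`. -/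
def Formula.SatisfiedBy {d k n : ℕ} (F : Formula d k n) (α : Fin n → Fin d) : Prop :=
  ∀ C ∈ F.constraints, ∃ u ∈ C, α u.1 ≠ u.2

/-- A formula is satisfiable if some assignment satisfies it. -/
def Formula.Satisfiable {d k n : ℕ} (F : Formula d k n) : Prop :=
  ∃ α : Fin n → Fin d, F.SatisfiedBy α

instance {d k n : ℕ} (F : Formula d k n) (α : Fin n → Fin d) : Decidable (F.SatisfiedBy α) := by
  unfold Formula.SatisfiedBy
  infer_instance

instance {d k n : ℕ} (F : Formula d k n) : Decidable F.Satisfiable := by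
  unfold Formula.Satisfiable
  infer_instance

/-- `L` writes down the formula `F`: it lists the constraints of `F` and the literals of each
constraint, in some arbitrary order and without repetitions. -/
def Formula.ListedBy {d k n : ℕ} (F : Formula d k n) (L : List (List (Literal d n))) : Prop :=
  (∀ C ∈ L, C.Nodup) ∧ (L.map List.toFinset).Nodup ∧ (L.map List.toFinset).toFinset = F.constraints

/-- The input alphabet: `one` is the unary digit, `sep` ends a number, `close` ends a
constraint. -/
inductive Symbol : Type
  | one
  | sep
  | close
  deriving DecidableEq

instance : Fintype Symbol where
  elems := {Symbol.one, Symbol.sep, Symbol.close}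
  complete := by intro s; cases s <;> simp

/-- Unary notation of a natural number. -/
def encodeNat (m : ℕ) : List Symbol := List.replicate m Symbol.one ++ [Symbol.sep]

/-- The word of the literal `x_i ≠ c`: the numbers `i` and `c`. -/
def encodeLiteral {d n : ℕ} (u : Literal d n) : List Symbol :=
  encodeNat u.1 ++ encodeNat u.2

/-- The word of a constraint: its literals one after the other, and an end marker. -/
def encodeConstraint {d n : ℕ} (C : List (Literal d n)) : List Symbol :=
  C.flatMap encodeLiteral ++ [Symbol.close]

/-- The word of a listed formula: the number `n` of variables, then the constraints. -/
def encodeList {d n : ℕ} (L : List (List (Literal d n))) : List Symbol :=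
  encodeNat n ++ L.flatMap encodeConstraint

/-- The deterministic multi-stack Turing machine `M` solves `(d, ≤ k)-CSP` in time `t`: started on
any word for any `(d, ≤ k)`-CSP formula `F` over `n` variables, it halts after at most `t n` steps
with output `true` if `F` is satisfiable and `false` otherwise. -/
def SolvesInTime (M : Turing.TM2ComputableAux Symbol Bool) (d k : ℕ) (t : ℕ → ℕ) : Prop :=
  ∀ (n : ℕ) (F : Formula d k n) (L : List (List (Literal d n))), F.ListedBy L →
    Nonempty (Turing.TM2OutputsInTime M.tm
      ((encodeList L).map M.inputAlphabet.symm)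
      (some ([decide F.Satisfiable].map M.outputAlphabet.symm))
      (t n))

/-- `t n = O*(g n)`: a bound up to a factor that is polynomial in `n`. -/
def IsOStar (t : ℕ → ℕ) (g : ℕ → ℝ) : Prop :=
  ∃ p : Polynomial ℕ, ∀ n : ℕ, (t n : ℝ) ≤ ((p.eval n : ℕ) : ℝ) * g n

end CSP

/-! The proof derandomizes a random walk in the manner of Schöning, using covering codes. Put e = d
- 1 and κ = k - 1. Cut the variables into blocks of a constant length b. For each block guess a
start word from a covering code of some radius c₀, and let a local search pay a factor s for each
unit of distance from a satisfying assignment α. A block then costs about (d / (1 + e/s))^b,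
whatever c₀ is, because the weight s^(-c₀) in the size of the code cancels the s^c₀ choices of the
search. For s = κe the base is dκ/(κ+1), which is the claim. Guessing a wrong variable of a
falsified constraint and its value directly would only give s = (κ+1)e.

To bring s close to κe, collect greedily up to a constant number t of falsified constraints whose
free variables are disjoint. Suppose t are found. The right choices, a variable and a new value for
each constraint, form a word of length t. Instead of this word, guess one at a prescribed distance c
from it out of a covering code. A letter of the word counts 0 if it is right, 1 if only the new
value is wrong, and 2 if the variable is another one. The Hamming distance to α then drops by at
least m = t - c (`distance_flip`), and for every s > κe some such code has at most s^m words
(`exists_step_code`).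

If fewer than t are found, guess the values of α on the boundedly many marked variables and fix
them. By maximality, every constraint falsified from then on contains a fixed variable, so it offers
at most κ variables and plain branching costs κe per unit of distance (`opStep_branch_second`).

The codes come from `exists_code`: the generating function of distances is a t-th power, the
pigeonhole principle selects a distance, and greedy covering turns the size of the corresponding
sphere into a code.

All guesses are packed into an advice word with one letter per block. A letter contains a start
word, the values to be fixed, and enough search choices for one covering radius. For a large
constant b the alphabet has at most (dκ/(κ+1) + ε)^b letters (`exists_localSearch`), and some advice
word is accepted if and only if the formula is satisfiable (`exists_answer_iff`). The codes are
constants of the finite control, so nothing has to be constructed at run time. The machine tries all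
advice words of length n/b + 1, each in polynomial time (`does_searchProg`,
`Procedure.isOStar_totalCost`). -/

set_option linter.unusedSectionVars false

/-! ### Structured programs and their compilation to multi-stack machines -/

namespace CSP

/-- Structured programs over a family of stacks with alphabets `Γ` and a register of type `σ`. -/
inductive Prog {K : Type} (Γ : K → Type) (σ : Type) : Type
  | load (f : σ → σ) : Prog Γ σ
  | push (k : K) (f : σ → Γ k) : Prog Γ σ
  | peek (k : K) (f : σ → Option (Γ k) → σ) : Prog Γ σ
  | pop (k : K) (f : σ → Option (Γ k) → σ) : Prog Γ σ
  | seq (p q : Prog Γ σ) : Prog Γ σ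
  | ite (b : σ → Bool) (p q : Prog Γ σ) : Prog Γ σ
  | loop (b : σ → Bool) (p : Prog Γ σ) : Prog Γ σ

namespace Prog

open Turing.TM2

variable {K : Type} {Γ : K → Type} {σ : Type}

scoped infixr:60 " ;; " => Prog.seq

/-- The program points of a program. -/
def Label : Prog Γ σ → Type
  | load _ => Unit
  | push _ _ => Unit
  | peek _ _ => Unit
  | pop _ _ => Unit
  | seq p q => p.Label ⊕ q.Label
  | ite _ p q => Option (p.Label ⊕ q.Label)
  | loop _ p => Option p.Label

noncomputable instance Label.fintype : ∀ p : Prog Γ σ, Fintype p.Label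
  | load _ => inferInstanceAs (Fintype Unit)
  | push _ _ => inferInstanceAs (Fintype Unit)
  | peek _ _ => inferInstanceAs (Fintype Unit)
  | pop _ _ => inferInstanceAs (Fintype Unit)
  | seq p q =>
    haveI := Label.fintype p
    haveI := Label.fintype q
    inferInstanceAs (Fintype (p.Label ⊕ q.Label))
  | ite _ p q =>
    haveI := Label.fintype p
    haveI := Label.fintype q
    inferInstanceAs (Fintype (Option (p.Label ⊕ q.Label)))
  | loop _ p =>
    haveI := Label.fintype p
    inferInstanceAs (Fintype (Option p.Label))

/-- The point at which a program starts. -/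
def entry : ∀ p : Prog Γ σ, p.Label
  | load _ => ()
  | push _ _ => ()
  | peek _ _ => ()
  | pop _ _ => ()
  | seq p _ => Sum.inl p.entry
  | ite _ _ _ => none
  | loop _ _ => none

/-- The statement at a program point, in a machine in which the program points are named by `i`
and the program is left at the label `e`. -/
def code {Λ : Type} : ∀ p : Prog Γ σ, (p.Label → Λ) → Λ → p.Label → Stmt Γ Λ σ
  | load f, _, e, _ => .load f (.goto fun _ => e)
  | push k f, _, e, _ => .push k f (.goto fun _ => e)
  | peek k f, _, e, _ => .peek k f (.goto fun _ => e)
  | pop k f, _, e, _ => .pop k f (.goto fun _ => e)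
  | seq p q, i, _, Sum.inl l => p.code (fun l => i (Sum.inl l)) (i (Sum.inr q.entry)) l
  | seq _ q, i, e, Sum.inr l => q.code (fun l => i (Sum.inr l)) e l
  | ite b p q, i, _, none =>
    .branch b (.goto fun _ => i (some (Sum.inl p.entry))) (.goto fun _ => i (some (Sum.inr q.entry)))
  | ite _ p _, i, e, some (Sum.inl l) => p.code (fun l => i (some (Sum.inl l))) e l
  | ite _ _ q, i, e, some (Sum.inr l) => q.code (fun l => i (some (Sum.inr l))) e l
  | loop b p, i, e, none => .branch b (.goto fun _ => i (some p.entry)) (.goto fun _ => e)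
  | loop _ p, i, _, some l => p.code (fun l => i (some l)) (i none) l

variable [DecidableEq K]

/-- `Runs p v S v' S' c`: started in the register `v` with stacks `S`, the program `p` ends in `v'`
with stacks `S'` after at most `c` steps. -/
inductive Runs : Prog Γ σ → σ → (∀ k, List (Γ k)) → σ → (∀ k, List (Γ k)) → ℕ → Prop
  | load (f : σ → σ) (v S) : Runs (load f) v S (f v) S 1
  | push (k f v S) : Runs (push k f) v S v (Function.update S k (f v :: S k)) 1
  | peek (k f v S) : Runs (peek k f) v S (f v (S k).head?) S 1
  | pop (k f v S) : Runs (pop k f) v S (f v (S k).head?) (Function.update S k (S k).tail) 1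
  | seq {p q v S v' S' v'' S'' c c'} : Runs p v S v' S' c → Runs q v' S' v'' S'' c' →
      Runs (seq p q) v S v'' S'' (c + c')
  | ite_true {b p q v S v' S' c} : b v = true → Runs p v S v' S' c →
      Runs (ite b p q) v S v' S' (c + 1)
  | ite_false {b p q v S v' S' c} : b v = false → Runs q v S v' S' c →
      Runs (ite b p q) v S v' S' (c + 1)
  | loop_false {b p v S} : b v = false → Runs (loop b p) v S v S 1
  | loop_true {b p v S v' S' v'' S'' c c'} : b v = true → Runs p v S v' S' c →
      Runs (loop b p) v' S' v'' S'' c' → Runs (loop b p) v S v'' S'' (c + c' + 1)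
  | mono {p v S v' S' c c'} : Runs p v S v' S' c → c ≤ c' → Runs p v S v' S' c'

/-- `n` steps of a machine. -/
def steps {Λ : Type} (M : Λ → Stmt Γ Λ σ) (n : ℕ) (c : Cfg Γ Λ σ) : Option (Cfg Γ Λ σ) :=
  (flip bind (step M))^[n] (some c)

theorem steps_add {Λ : Type} {M : Λ → Stmt Γ Λ σ} {m n : ℕ} {a b c : Cfg Γ Λ σ}
    (h₁ : steps M m a = some b) (h₂ : steps M n b = some c) : steps M (m + n) a = some c := by
  unfold steps at *
  rw [Nat.add_comm, Function.iterate_add_apply, h₁, h₂]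

theorem steps_one {Λ : Type} {M : Λ → Stmt Γ Λ σ} {l : Λ} {q : Stmt Γ Λ σ} (h : M l = q) (v : σ)
    (S : ∀ k, List (Γ k)) : steps M 1 ⟨some l, v, S⟩ = some (stepAux q v S) := by
  simp [steps, flip, h]

/-- A machine that contains the code of a program simulates its runs. -/
theorem Runs.steps {p : Prog Γ σ} {v v' : σ} {S S' : ∀ k, List (Γ k)} {c : ℕ}
    (h : Runs p v S v' S' c) {Λ : Type} (M : Λ → Stmt Γ Λ σ) :
    ∀ (i : p.Label → Λ) (e : Λ), (∀ l, M (i l) = p.code i e l) →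
      ∃ n ≤ c, Prog.steps M n ⟨some (i p.entry), v, S⟩ = some ⟨some e, v', S'⟩ := by
  induction h with
  | load f v S => exact fun i e hM => ⟨1, le_rfl, steps_one (hM ()) v S⟩
  | push k f v S => exact fun i e hM => ⟨1, le_rfl, steps_one (hM ()) v S⟩
  | peek k f v S => exact fun i e hM => ⟨1, le_rfl, steps_one (hM ()) v S⟩
  | pop k f v S => exact fun i e hM => ⟨1, le_rfl, steps_one (hM ()) v S⟩
  | @seq p q _ _ _ _ _ _ _ _ _ _ ih₁ ih₂ =>
    intro i e hM
    obtain ⟨n, hn, h₁⟩ := ih₁ (fun l => i (Sum.inl l)) (i (Sum.inr q.entry))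
      (fun l => hM (Sum.inl l))
    obtain ⟨m, hm, h₂⟩ := ih₂ (fun l => i (Sum.inr l)) e (fun l => hM (Sum.inr l))
    exact ⟨n + m, by omega, steps_add h₁ h₂⟩
  | @ite_true b p q v S _ _ _ hb _ ih =>
    intro i e hM
    obtain ⟨n, hn, h₁⟩ := ih (fun l => i (some (Sum.inl l))) e (fun l => hM (some (Sum.inl l)))
    exact ⟨1 + n, by omega,
      steps_add ((steps_one (hM none) v S).trans (by simp only [code, stepAux, hb, cond_true])) h₁⟩
  | @ite_false b p q v S _ _ _ hb _ ih =>
    intro i e hM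
    obtain ⟨n, hn, h₁⟩ := ih (fun l => i (some (Sum.inr l))) e (fun l => hM (some (Sum.inr l)))
    exact ⟨1 + n, by omega,
      steps_add ((steps_one (hM none) v S).trans (by simp only [code, stepAux, hb, cond_false])) h₁⟩
  | @loop_false b p v S hb =>
    intro i e hM
    exact ⟨1, le_rfl,
      (steps_one (hM none) v S).trans (by simp only [code, stepAux, hb, cond_false])⟩
  | @loop_true b p v S _ _ _ _ _ _ hb _ _ ih₁ ih₂ =>
    intro i e hM
    obtain ⟨n, hn, h₁⟩ := ih₁ (fun l => i (some l)) (i none) (fun l => hM (some l))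
    obtain ⟨m, hm, h₂⟩ := ih₂ i e hM
    exact ⟨1 + (n + m), by omega, steps_add
      ((steps_one (hM none) v S).trans (by simp only [code, stepAux, hb, cond_true]))
      (steps_add h₁ h₂)⟩
  | mono _ hc ih =>
    intro i e hM
    obtain ⟨n, hn, h⟩ := ih i e hM
    exact ⟨n, hn.trans hc, h⟩

/-- The machine that runs a program and then halts. -/
def machine (p : Prog Γ σ) : Option p.Label → Stmt Γ (Option p.Label) σ
  | none => .halt
  | some l => p.code some none l

/-- The exit label of the program is the running label `some none` of the machine. One further step
executes `halt` there, which accounts for the `+ 1`. -/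
theorem Runs.machine_steps {p : Prog Γ σ} {v v' : σ} {S S' : ∀ k, List (Γ k)} {c : ℕ}
    (h : Runs p v S v' S' c) :
    ∃ n ≤ c + 1, Prog.steps p.machine n ⟨some (some p.entry), v, S⟩ = some ⟨none, v', S'⟩ := by
  obtain ⟨n, hn, h⟩ := h.steps p.machine some none (fun _ => rfl)
  exact ⟨n + 1, by omega, steps_add h (by simp [Prog.steps, flip, machine])⟩

theorem Runs.load_eq {f : σ → σ} {v v' : σ} {S : ∀ k, List (Γ k)} (h : f v = v') :
    Runs (Prog.load f) v S v' S 1 := h ▸ Runs.load f v S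

/-- Inversion needs an induction because `mono` may be applied any number of times on top of `seq`.
-/
theorem Runs.seq_inv {p q : Prog Γ σ} {v v'' : σ} {S S'' : ∀ k, List (Γ k)} {c : ℕ}
    (h : Runs (Prog.seq p q) v S v'' S'' c) :
    ∃ v' S' c₁ c₂, Runs p v S v' S' c₁ ∧ Runs q v' S' v'' S'' c₂ ∧ c₁ + c₂ ≤ c := by
  generalize hr : Prog.seq p q = r at h
  induction h with
  | seq h₁ h₂ => cases hr; exact ⟨_, _, _, _, h₁, h₂, le_rfl⟩
  | mono _ hc ih =>
    obtain ⟨v', S', c₁, c₂, h₁, h₂, h⟩ := ih hr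
    exact ⟨v', S', c₁, c₂, h₁, h₂, h.trans hc⟩
  | _ => cases hr

/-- Run `p`, then, as long as the test `b` succeeds, run `q` and `p`. -/
def poll (p : Prog Γ σ) (b : σ → Bool) (q : Prog Γ σ) : Prog Γ σ :=
  seq p (loop b (seq q p))

theorem Runs.poll_done {p q : Prog Γ σ} {b : σ → Bool} {v v' : σ} {S S' : ∀ k, List (Γ k)} {c : ℕ}
    (h : Runs p v S v' S' c) (hb : b v' = false) : Runs (poll p b q) v S v' S' (c + 1) :=
  .seq h (.loop_false hb)

/-- The remaining run of `poll` begins with its own `p`. That `p` has to be split off and moved into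
the loop body, behind `q`. -/
theorem Runs.poll_step {p q : Prog Γ σ} {b : σ → Bool} {v v₁ v₂ v₃ : σ}
    {S S₁ S₂ S₃ : ∀ k, List (Γ k)} {c₁ c₂ c₃ : ℕ} (h₁ : Runs p v S v₁ S₁ c₁) (hb : b v₁ = true)
    (h₂ : Runs q v₁ S₁ v₂ S₂ c₂) (h₃ : Runs (poll p b q) v₂ S₂ v₃ S₃ c₃) :
    Runs (poll p b q) v S v₃ S₃ (c₁ + c₂ + c₃ + 1) := by
  obtain ⟨v', S', d₁, d₂, h, h', hd⟩ := h₃.seq_inv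
  exact (h₁.seq (.loop_true hb (h₂.seq h) h')).mono (by omega)

/-- Run a program `n` times. -/
def iter (p : Prog Γ σ) : ℕ → Prog Γ σ
  | 0 => load id
  | n + 1 => seq p (iter p n)

end Prog

end CSP

/-! ### Stacks, register and primitive instructions of the search machine -/

namespace CSP

/-- The stacks of the machine: the formula, the array of cells and the advice word, each with an
auxiliary stack to which it is moved while it is read, and the output. -/
inductive Stack : Type
  | inp
  | inp'
  | arr
  | arr'
  | adv
  | adv'
  | out
  deriving DecidableEq

instance : Fintype Stack where
  elems := {.inp, .inp', .arr, .arr', .adv, .adv', .out}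
  complete := by intro s; cases s <;> simp

/-- The alphabets of the stacks. -/
abbrev Alphabet (X : Type) (A : ℕ) : Stack → Type
  | .inp => Symbol
  | .inp' => Symbol
  | .arr => X
  | .arr' => X
  | .adv => Fin (A + 1)
  | .adv' => Fin (A + 1)
  | .out => Bool

/-- The contents of the stacks. -/
def mem {X : Type} {A : ℕ} (i i' : List Symbol) (x x' : List X) (a a' : List (Fin (A + 1)))
    (o : List Bool) : ∀ k, List (Alphabet X A k)
  | .inp => i
  | .inp' => i'
  | .arr => x
  | .arr' => x'
  | .adv => a
  | .adv' => a'
  | .out => o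

/-- The finite data that determine a search procedure guided by advice: an array of cells is set up
from the advice word, one block for each letter; for each letter of the advice, the formula is
scanned `rounds` times, where a literal may look at and change the cell of its variable, and the end
of a constraint and of the formula may change all cells in parallel. -/
structure Procedure (Q X : Type) (A b : ℕ) where
  /-- the number of scans for each letter -/
  rounds : ℕ
  /-- the initial cells of the block of a letter -/
  init : Fin (A + 1) → Fin b → X
  /-- the initial state -/
  start : Q
  /-- the effect of a letter on the state -/
  letter : Q → Fin (A + 1) → Q
  /-- the effect of a literal on the state and on the cell of the variable -/
  lit : Q → ℕ → X → Q × X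
  /-- the effect of the end of a constraint on the state -/
  closeState : Q → Q
  /-- the effect of the end of a constraint on the cells -/
  closeCell : Q → X → X
  /-- the effect of the end of a scan on the state -/
  endState : Q → Q
  /-- the effect of the end of a scan on the cells -/
  endCell : Q → X → X
  /-- the states in which the procedure accepts -/
  accept : Q → Bool

/-- The register of the machine: the state of the procedure, the answer once it is known, and
scratch fields. -/
@[ext]
structure Reg (Q X : Type) (A b d : ℕ) where
  /-- the state of the procedure -/
  state : Q
  /-- the answer -/
  ans : Option Bool
  /-- the symbol last read -/
  sym : Option Symbol
  /-- the cell last read -/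
  cell : Option X
  /-- the letter last read -/
  ltr : Option (Fin (A + 1))
  /-- the value of a literal -/
  num : Fin (d + 1)
  /-- the position in a block -/
  pos : Fin b

noncomputable instance {Q X : Type} {A b d : ℕ} [Fintype Q] [Fintype X] :
    Fintype (Reg Q X A b d) :=
  Fintype.ofInjective
    (fun v => (v.state, v.ans, v.sym, v.cell, v.ltr, v.num, v.pos))
    (by intro v w h; simp only [Prod.mk.injEq] at h; ext1 <;> tauto)

namespace Procedure

open Prog

variable {Q X : Type} {A b d : ℕ}

section Primitives

/-- A program of the machine. -/
abbrev MProg (Q X : Type) (A b d : ℕ) : Type := Prog (Alphabet X A) (Reg Q X A b d)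

/-- Look at the next symbol. -/
def peekInp : MProg Q X A b d := .peek .inp fun v y => { v with sym := y }
/-- Read a symbol. -/
def popInp : MProg Q X A b d := .pop .inp fun v y => { v with sym := y }
/-- Write the symbol last read. -/
def pushInp : MProg Q X A b d := .push .inp fun v => v.sym.getD .one
/-- Read a symbol from the auxiliary stack. -/
def popInp' : MProg Q X A b d := .pop .inp' fun v y => { v with sym := y }
/-- Write the symbol last read to the auxiliary stack. -/
def pushInp' : MProg Q X A b d := .push .inp' fun v => v.sym.getD .one
/-- Read a cell. -/
def popArr : MProg Q X A b d := .pop .arr fun v y => { v with cell := y }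
/-- Write a cell. -/
def pushArr (f : Reg Q X A b d → X) : MProg Q X A b d := .push .arr f
/-- Read a cell from the auxiliary stack. -/
def popArr' : MProg Q X A b d := .pop .arr' fun v y => { v with cell := y }
/-- Write a cell to the auxiliary stack. -/
def pushArr' (f : Reg Q X A b d → X) : MProg Q X A b d := .push .arr' f
/-- Read a letter. -/
def popAdv : MProg Q X A b d := .pop .adv fun v y => { v with ltr := y }
/-- Write a letter. -/
def pushAdv (f : Fin (A + 1) → Fin (A + 1)) : MProg Q X A b d :=
  .push .adv fun v => f (v.ltr.getD 0)
/-- Read a letter from the auxiliary stack. -/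
def popAdv' : MProg Q X A b d := .pop .adv' fun v y => { v with ltr := y }
/-- Write a letter to the auxiliary stack. -/
def pushAdv' (f : Fin (A + 1) → Fin (A + 1)) : MProg Q X A b d :=
  .push .adv' fun v => f (v.ltr.getD 0)
/-- Write the answer. -/
def pushOut : MProg Q X A b d := .push .out fun v => v.ans.getD false

variable {q : Q} {n : Option Bool} {y : Option Symbol} {z : Option X} {l : Option (Fin (A + 1))}
  {m : Fin (d + 1)} {r : Fin b} {i i' : List Symbol} {x x' : List X} {a a' : List (Fin (A + 1))}
  {o : List Bool}

theorem runs_push {k : Stack} {f : Reg Q X A b d → Alphabet X A k} {v : Reg Q X A b d}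
    {S S' : ∀ k, List (Alphabet X A k)} (h : ∀ k', Function.update S k (f v :: S k) k' = S' k') :
    Runs (.push k f) v S v S' 1 :=
  funext h ▸ Runs.push k f v S

theorem runs_pop {k : Stack} {f : Reg Q X A b d → Option (Alphabet X A k) → Reg Q X A b d}
    {v v' : Reg Q X A b d} {S S' : ∀ k, List (Alphabet X A k)} (hv : f v (S k).head? = v')
    (h : ∀ k', Function.update S k (S k).tail k' = S' k') : Runs (.pop k f) v S v' S' 1 :=
  hv ▸ funext h ▸ Runs.pop k f v S

theorem runs_peekInp : Runs (peekInp : MProg Q X A b d) ⟨q, n, y, z, l, m, r⟩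
    (mem i i' x x' a a' o) ⟨q, n, i.head?, z, l, m, r⟩ (mem i i' x x' a a' o) 1 :=
  .peek _ _ _ _

theorem runs_popInp : Runs (popInp : MProg Q X A b d) ⟨q, n, y, z, l, m, r⟩
    (mem i i' x x' a a' o) ⟨q, n, i.head?, z, l, m, r⟩ (mem i.tail i' x x' a a' o) 1 :=
  runs_pop rfl (by rintro (_ | _) <;> rfl)

theorem runs_pushInp {s : Symbol} : Runs (pushInp : MProg Q X A b d)
    ⟨q, n, some s, z, l, m, r⟩ (mem i i' x x' a a' o)
    ⟨q, n, some s, z, l, m, r⟩ (mem (s :: i) i' x x' a a' o) 1 :=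
  runs_push (by rintro (_ | _) <;> rfl)

theorem runs_popInp' : Runs (popInp' : MProg Q X A b d) ⟨q, n, y, z, l, m, r⟩
    (mem i i' x x' a a' o) ⟨q, n, i'.head?, z, l, m, r⟩ (mem i i'.tail x x' a a' o) 1 :=
  runs_pop rfl (by rintro (_ | _) <;> rfl)

theorem runs_pushInp' {s : Symbol} : Runs (pushInp' : MProg Q X A b d)
    ⟨q, n, some s, z, l, m, r⟩ (mem i i' x x' a a' o)
    ⟨q, n, some s, z, l, m, r⟩ (mem i (s :: i') x x' a a' o) 1 :=
  runs_push (by rintro (_ | _) <;> rfl)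

theorem runs_popArr : Runs (popArr : MProg Q X A b d) ⟨q, n, y, z, l, m, r⟩
    (mem i i' x x' a a' o) ⟨q, n, y, x.head?, l, m, r⟩ (mem i i' x.tail x' a a' o) 1 :=
  runs_pop rfl (by rintro (_ | _) <;> rfl)

theorem runs_pushArr {f : Reg Q X A b d → X} : Runs (pushArr f) ⟨q, n, y, z, l, m, r⟩
    (mem i i' x x' a a' o)
    ⟨q, n, y, z, l, m, r⟩ (mem i i' (f ⟨q, n, y, z, l, m, r⟩ :: x) x' a a' o) 1 :=
  runs_push (by rintro (_ | _) <;> rfl)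

theorem runs_popArr' : Runs (popArr' : MProg Q X A b d) ⟨q, n, y, z, l, m, r⟩
    (mem i i' x x' a a' o) ⟨q, n, y, x'.head?, l, m, r⟩ (mem i i' x x'.tail a a' o) 1 :=
  runs_pop rfl (by rintro (_ | _) <;> rfl)

theorem runs_pushArr' {f : Reg Q X A b d → X} : Runs (pushArr' f) ⟨q, n, y, z, l, m, r⟩
    (mem i i' x x' a a' o)
    ⟨q, n, y, z, l, m, r⟩ (mem i i' x (f ⟨q, n, y, z, l, m, r⟩ :: x') a a' o) 1 :=
  runs_push (by rintro (_ | _) <;> rfl)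

theorem runs_popAdv : Runs (popAdv : MProg Q X A b d) ⟨q, n, y, z, l, m, r⟩
    (mem i i' x x' a a' o) ⟨q, n, y, z, a.head?, m, r⟩ (mem i i' x x' a.tail a' o) 1 :=
  runs_pop rfl (by rintro (_ | _) <;> rfl)

theorem runs_pushAdv {f : Fin (A + 1) → Fin (A + 1)} :
    Runs (pushAdv f : MProg Q X A b d) ⟨q, n, y, z, l, m, r⟩ (mem i i' x x' a a' o)
    ⟨q, n, y, z, l, m, r⟩ (mem i i' x x' (f (l.getD 0) :: a) a' o) 1 :=
  runs_push (by rintro (_ | _) <;> rfl)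

theorem runs_popAdv' : Runs (popAdv' : MProg Q X A b d) ⟨q, n, y, z, l, m, r⟩
    (mem i i' x x' a a' o) ⟨q, n, y, z, a'.head?, m, r⟩ (mem i i' x x' a a'.tail o) 1 :=
  runs_pop rfl (by rintro (_ | _) <;> rfl)

theorem runs_pushAdv' {f : Fin (A + 1) → Fin (A + 1)} :
    Runs (pushAdv' f : MProg Q X A b d) ⟨q, n, y, z, l, m, r⟩ (mem i i' x x' a a' o)
    ⟨q, n, y, z, l, m, r⟩ (mem i i' x x' a (f (l.getD 0) :: a') o) 1 :=
  runs_push (by rintro (_ | _) <;> rfl)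

theorem runs_pushOut : Runs (pushOut : MProg Q X A b d) ⟨q, n, y, z, l, m, r⟩
    (mem i i' x x' a a' o)
    ⟨q, n, y, z, l, m, r⟩ (mem i i' x x' a a' (n.getD false :: o)) 1 :=
  runs_push (by rintro (_ | _) <;> rfl)

end Primitives

end Procedure

end CSP

/-! ### Scanning the formula: programs and their functional model -/

namespace CSP

namespace Procedure

open Prog

variable {Q X : Type} {A b d : ℕ}

/-- `Does p q n S q' n' S' c`: in at most `c` steps, `p` changes the state from `q` to `q'`, the
answer from `n` to `n'`, and the stacks from `S` to `S'`; the scratch fields are arbitrary. -/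
def Does (p : MProg Q X A b d) (q : Q) (n : Option Bool) (S : ∀ k, List (Alphabet X A k))
    (q' : Q) (n' : Option Bool) (S' : ∀ k, List (Alphabet X A k)) (c : ℕ) : Prop :=
  ∀ y z l m r, ∃ y' z' l' m' r', Runs p ⟨q, n, y, z, l, m, r⟩ S ⟨q', n', y', z', l', m', r'⟩ S' c

section Does

variable {p p' : MProg Q X A b d} {q q' q'' : Q} {n n' n'' : Option Bool}
  {S S' S'' : ∀ k, List (Alphabet X A k)} {c c' : ℕ}

theorem Does.seq (h : Does p q n S q' n' S' c) (h' : Does p' q' n' S' q'' n'' S'' c') :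
    Does (p.seq p') q n S q'' n'' S'' (c + c') := by
  intro y z l m r
  obtain ⟨y, z, l, m, r, h₁⟩ := h y z l m r
  obtain ⟨y, z, l, m, r, h₂⟩ := h' y z l m r
  exact ⟨y, z, l, m, r, h₁.seq h₂⟩

theorem Does.mono (h : Does p q n S q' n' S' c) (hc : c ≤ c') : Does p q n S q' n' S' c' := by
  intro y z l m r
  obtain ⟨y, z, l, m, r, h₁⟩ := h y z l m r
  exact ⟨y, z, l, m, r, h₁.mono hc⟩

end Does

section Programs

/-- Move a symbol to the auxiliary stack. -/
def readChar : MProg Q X A b d := popInp ;; pushInp'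

/-- Move all symbols back from the auxiliary stack. -/
def rewindInp : MProg Q X A b d := poll popInp' (fun v => v.sym.isSome) pushInp

variable [Inhabited X]

/-- Move all cells back from the auxiliary stack. -/
def rewindArr : MProg Q X A b d :=
  poll popArr' (fun v => v.cell.isSome) (pushArr fun v => v.cell.getD default)

/-- Apply a function to all cells. -/
def mapArr (f : Q → X → X) : MProg Q X A b d :=
  poll popArr (fun v => v.cell.isSome) (pushArr' fun v => f v.state (v.cell.getD default)) ;;
    rewindArr

/-- Read a number and move that many cells to the auxiliary stack. -/
def walk : MProg Q X A b d :=
  poll readChar (fun v => v.sym == some .one) (popArr ;; pushArr' fun v => v.cell.getD default)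

/-- Read a number and add it to the field `num`. -/
def addVal : MProg Q X A b d :=
  poll readChar (fun v => v.sym == some .one) (.load fun v => { v with num := Fin.ofNat (d + 1) (v.num + 1) })

/-- Process a literal. -/
def litProg (P : Procedure Q X A b) : MProg Q X A b d :=
  walk ;; .load (fun v => { v with num := 0 }) ;; addVal ;; popArr ;;
    .load (fun v =>
      { v with
        state := (P.lit v.state v.num (v.cell.getD default)).1
        cell := some (P.lit v.state v.num (v.cell.getD default)).2 }) ;;
    pushArr (fun v => v.cell.getD default) ;; rewindArr

/-- Process the end of a constraint. -/
def closeProg (P : Procedure Q X A b) : MProg Q X A b d :=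
  readChar ;; mapArr P.closeCell ;; .load fun v => { v with state := P.closeState v.state }

/-- Process the formula. -/
def readFormula (P : Procedure Q X A b) : MProg Q X A b d :=
  poll peekInp (fun v => v.sym.isSome)
    (.ite (fun v => v.sym == some .close) P.closeProg P.litProg)

/-- Process the formula and move back to its start. -/
def scanProg (P : Procedure Q X A b) : MProg Q X A b d := P.readFormula ;; rewindInp

variable {q : Q} {n : Option Bool} {y : Option Symbol} {z : Option X} {l : Option (Fin (A + 1))}
  {m : Fin (d + 1)} {r : Fin b} {i i' : List Symbol} {x x' : List X} {a a' : List (Fin (A + 1))}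
  {o : List Bool}

theorem runs_readChar {s : Symbol} : Runs (readChar : MProg Q X A b d) ⟨q, n, y, z, l, m, r⟩
    (mem (s :: i) i' x x' a a' o) ⟨q, n, some s, z, l, m, r⟩ (mem i (s :: i') x x' a a' o) 2 :=
  Runs.mono (.seq runs_popInp runs_pushInp') le_rfl

theorem runs_rewindArr : Runs (rewindArr : MProg Q X A b d) ⟨q, n, y, z, l, m, r⟩
    (mem i i' x x' a a' o) ⟨q, n, y, none, l, m, r⟩ (mem i i' (x'.reverse ++ x) [] a a' o)
    (3 * x'.length + 2) := by
  induction x' generalizing x z with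
  | nil => exact .poll_done runs_popArr' rfl
  | cons w x' ih =>
    rw [List.reverse_cons, List.append_assoc]
    exact Runs.mono (Runs.poll_step runs_popArr' rfl runs_pushArr ih) (by
      rw [List.length_cons]; omega)

theorem runs_rewindInp : Runs (rewindInp : MProg Q X A b d) ⟨q, n, y, z, l, m, r⟩
    (mem i i' x x' a a' o) ⟨q, n, none, z, l, m, r⟩ (mem (i'.reverse ++ i) [] x x' a a' o)
    (3 * i'.length + 2) := by
  induction i' generalizing i y with
  | nil => exact .poll_done runs_popInp' rfl
  | cons w x' ih =>
    rw [List.reverse_cons, List.append_assoc]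
    exact Runs.mono (Runs.poll_step runs_popInp' rfl runs_pushInp ih) (by
      rw [List.length_cons]; omega)

theorem runs_mapArr_fst {f : Q → X → X} :
    Runs (poll popArr (fun v => v.cell.isSome)
      (pushArr' fun v => f v.state (v.cell.getD default)) : MProg Q X A b d) ⟨q, n, y, z, l, m, r⟩
    (mem i i' x x' a a' o) ⟨q, n, y, none, l, m, r⟩
    (mem i i' [] ((x.map (f q)).reverse ++ x') a a' o) (3 * x.length + 2) := by
  induction x generalizing x' z with
  | nil => exact .poll_done runs_popArr rfl
  | cons w x ih =>
    rw [List.map_cons, List.reverse_cons, List.append_assoc]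
    exact Runs.mono (Runs.poll_step runs_popArr rfl runs_pushArr' ih) (by
      rw [List.length_cons]; omega)

theorem runs_mapArr {f : Q → X → X} : Runs (mapArr f : MProg Q X A b d) ⟨q, n, y, z, l, m, r⟩
    (mem i i' x [] a a' o) ⟨q, n, y, none, l, m, r⟩ (mem i i' (x.map (f q)) [] a a' o)
    (6 * x.length + 4) := by
  have h := (runs_mapArr_fst (d := d) (q := q) (n := n) (y := y) (z := z) (l := l) (m := m) (r := r)
    (i := i) (i' := i') (x := x) (x' := []) (a := a) (a' := a') (o := o) (f := f)).seq runs_rewindArr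
  simp only [List.append_nil, List.reverse_reverse, List.length_reverse, List.length_map] at h
  exact h.mono (by omega)

theorem encodeNat_succ (k : ℕ) : encodeNat (k + 1) = .one :: encodeNat k := rfl

theorem length_encodeNat (k : ℕ) : (encodeNat k).length = k + 1 := by simp [encodeNat]

theorem runs_walk {x₁ : List X} : ∃ z', Runs (walk : MProg Q X A b d) ⟨q, n, y, z, l, m, r⟩
    (mem (encodeNat x₁.length ++ i) i' (x₁ ++ x) x' a a' o) ⟨q, n, some .sep, z', l, m, r⟩
    (mem i ((encodeNat x₁.length).reverse ++ i') x (x₁.reverse ++ x') a a' o)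
    (5 * x₁.length + 3) := by
  induction x₁ generalizing i' x' y z with
  | nil => exact ⟨z, .poll_done runs_readChar rfl⟩
  | cons w x₁ ih =>
    obtain ⟨z', h⟩ := ih (i' := .one :: i') (x' := w :: x') (y := some .one) (z := some w)
    refine ⟨z', ?_⟩
    rw [List.length_cons, encodeNat_succ, List.reverse_cons, List.reverse_cons, List.append_assoc,
      List.append_assoc]
    exact Runs.mono (Runs.poll_step runs_readChar rfl (.seq runs_popArr runs_pushArr') h) (by omega)

theorem runs_addVal {c : ℕ} : Runs (addVal : MProg Q X A b d) ⟨q, n, y, z, l, m, r⟩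
    (mem (encodeNat c ++ i) i' x x' a a' o) ⟨q, n, some .sep, z, l, Fin.ofNat (d + 1) (m + c), r⟩
    (mem i ((encodeNat c).reverse ++ i') x x' a a' o) (4 * c + 3) := by
  induction c generalizing i' y m with
  | zero =>
    have hm : Fin.ofNat (d + 1) (m + 0) = m := by ext; simp
    rw [hm]
    exact .poll_done runs_readChar rfl
  | succ c ih =>
    have hm : Fin.ofNat (d + 1) (m + (c + 1)) = Fin.ofNat (d + 1) (Fin.ofNat (d + 1) (m + 1) + c) := by
      ext
      simp only [Fin.val_ofNat, Nat.mod_add_mod]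
      congr 1
      omega
    rw [encodeNat_succ, List.reverse_cons, List.append_assoc, hm]
    exact Runs.mono (Runs.poll_step runs_readChar rfl (.load _ _ _) ih) (by omega)

end Programs

section Model

variable {N : ℕ}

/-- The effect of a literal on state and array. -/
def litStep (P : Procedure Q X A b) (s : Q × (Fin N → X)) (u : Literal d N) : Q × (Fin N → X) :=
  ((P.lit s.1 u.2 (s.2 u.1)).1, Function.update s.2 u.1 (P.lit s.1 u.2 (s.2 u.1)).2)

/-- The effect of the end of a constraint on state and array. -/
def closeStep (P : Procedure Q X A b) (s : Q × (Fin N → X)) : Q × (Fin N → X) :=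
  (P.closeState s.1, fun p => P.closeCell s.1 (s.2 p))

/-- The effect of a constraint on state and array. -/
def constraintStep (P : Procedure Q X A b) (s : Q × (Fin N → X)) (C : List (Literal d N)) :
    Q × (Fin N → X) :=
  P.closeStep (C.foldl P.litStep s)

/-- The effect of a formula on state and array. -/
def scan (P : Procedure Q X A b) (L : List (List (Literal d N))) (s : Q × (Fin N → X)) :
    Q × (Fin N → X) :=
  L.foldl P.constraintStep s

/-- The effect of a scan on state and array. -/
def round (P : Procedure Q X A b) (L : List (List (Literal d N))) (s : Q × (Fin N → X)) :
    Q × (Fin N → X) :=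
  (P.endState (P.scan L s).1, fun p => P.endCell (P.scan L s).1 ((P.scan L s).2 p))

/-- The effect of a letter of the advice on state and array. -/
def letterStep (P : Procedure Q X A b) (L : List (List (Literal d N))) (s : Q × (Fin N → X))
    (a : Fin (A + 1)) : Q × (Fin N → X) :=
  (P.round L)^[P.rounds] (P.letter s.1 a, s.2)

/-- The answer of the procedure for a formula, an initial array and an advice word. -/
def check (P : Procedure Q X A b) (L : List (List (Literal d N))) (x : Fin N → X)
    (a : List (Fin (A + 1))) : Bool :=
  P.accept (P.scan L (a.foldl (P.letterStep L) (P.start, x))).1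

end Model

section Scan

variable [Inhabited X] {N : ℕ} (P : Procedure Q X A b) {q : Q} {n : Option Bool}
  {y : Option Symbol} {z : Option X} {l : Option (Fin (A + 1))} {m : Fin (d + 1)} {r : Fin b}
  {i i' : List Symbol} {a a' : List (Fin (A + 1))} {o : List Bool}

/-- Links the two views of the array: on the machine, the first p cells are walked over and the top
of the remaining stack is replaced; in the model, this is `Function.update`. -/
theorem ofFn_split (x : Fin N → X) (p : Fin N) :
    ∃ x₁ x₂ : List X, x₁.length = p ∧ List.ofFn x = x₁ ++ x p :: x₂ ∧
      ∀ w, List.ofFn (Function.update x p w) = x₁ ++ w :: x₂ := by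
  have key : ∀ f : Fin N → X, List.ofFn f =
      (List.ofFn f).take p ++ f p :: (List.ofFn f).drop (p + 1) := by
    intro f
    conv_lhs => rw [← List.take_append_drop p (List.ofFn f)]
    rw [List.drop_eq_getElem_cons (by simp), List.getElem_ofFn]
  refine ⟨(List.ofFn x).take p, (List.ofFn x).drop (p + 1), by simp, key x, fun w => ?_⟩
  rw [key (Function.update x p w), Function.update_self]
  congr 1
  · apply List.ext_getElem (by simp)
    intro j h₁ h₂
    simp only [List.getElem_take, List.getElem_ofFn]
    rw [Function.update_of_ne]
    simp only [List.length_take, List.length_ofFn] at h₁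
    intro h
    have := congrArg Fin.val h
    simp only at this
    omega
  · congr 1
    apply List.ext_getElem (by simp)
    intro j h₁ h₂
    simp only [List.getElem_drop, List.getElem_ofFn]
    rw [Function.update_of_ne]
    intro h
    have := congrArg Fin.val h
    simp only at this
    omega

theorem does_litProg (x : Fin N → X) (u : Literal d N) :
    Does (P.litProg : MProg Q X A b d) q n
      (mem (encodeLiteral u ++ i) i' (List.ofFn x) [] a a' o)
      (P.litStep (q, x) u).1 n
      (mem i ((encodeLiteral u).reverse ++ i') (List.ofFn (P.litStep (q, x) u).2) [] a a' o)
      (12 * (encodeLiteral u).length) := by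
  intro y z l m r
  obtain ⟨x₁, x₂, h₁, h₂, h₃⟩ := ofFn_split x u.1
  obtain ⟨z', hw⟩ := runs_walk (d := d) (q := q) (n := n) (y := y) (z := z) (l := l) (m := m)
    (r := r) (i := encodeNat u.2 ++ i) (i' := i') (x := x u.1 :: x₂) (x' := []) (a := a) (a' := a')
    (o := o) (x₁ := x₁)
  rw [h₁] at hw
  -- The counter works modulo d + 1, and the value of a literal is below d, so it never wraps.
  have hu : ((Fin.ofNat (d + 1) ((0 : Fin (d + 1)) + (u.2 : ℕ)) : Fin (d + 1)) : ℕ) = u.2 := by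
    simp
  have hr := runs_rewindArr (d := d) (q := (P.lit q u.2 (x u.1)).1) (n := n)
    (y := some .sep) (z := some (P.lit q u.2 (x u.1)).2) (l := l)
    (m := Fin.ofNat (d + 1) ((0 : Fin (d + 1)) + (u.2 : ℕ))) (r := r) (i := i)
    (i' := (encodeNat u.2).reverse ++ ((encodeNat u.1).reverse ++ i'))
    (x := (P.lit q u.2 (x u.1)).2 :: x₂) (x' := x₁.reverse ++ []) (a := a) (a' := a') (o := o)
  rw [List.append_nil, List.reverse_reverse, List.length_reverse, h₁] at hr
  rw [List.append_nil] at hw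
  refine ⟨some .sep, none, l, Fin.ofNat (d + 1) ((0 : Fin (d + 1)) + (u.2 : ℕ)), r, ?_⟩
  simp only [encodeLiteral, List.reverse_append, List.append_assoc, litStep, h₃, h₂]
  refine Runs.mono (hw.seq ((Runs.load _ _ _).seq (runs_addVal.seq (runs_popArr.seq
    ((Runs.load_eq ?_).seq (runs_pushArr.seq hr)))))) ?_
  · simp only [hu, List.head?_cons, Option.getD_some]
  · simp only [List.length_append, length_encodeNat]
    omega

theorem does_closeProg (x : Fin N → X) :
    Does (P.closeProg : MProg Q X A b d) q n (mem (.close :: i) i' (List.ofFn x) [] a a' o)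
      (P.closeStep (q, x)).1 n
      (mem i (.close :: i') (List.ofFn (P.closeStep (q, x)).2) [] a a' o) (6 * N + 7) := by
  intro y z l m r
  have h := runs_mapArr (d := d) (q := q) (n := n) (y := some .close) (z := z) (l := l) (m := m)
      (r := r) (i := i) (i' := .close :: i') (x := List.ofFn x) (a := a) (a' := a') (o := o)
      (f := P.closeCell)
  rw [List.map_ofFn, List.length_ofFn] at h
  exact ⟨_, _, _, _, _, Runs.mono (runs_readChar.seq (h.seq (Runs.load _ _ _))) (by omega)⟩

end Scan

end Procedure

end CSP

/-! ### Running the procedure on one advice word -/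

namespace CSP

namespace Procedure

open Prog

variable {Q X : Type} {A b d N : ℕ} [Inhabited X] (P : Procedure Q X A b) {q : Q}
  {n : Option Bool} {i i' : List Symbol} {x x' : List X} {a a' : List (Fin (A + 1))} {o : List Bool}

section Scan

variable {q' : Q} {n' : Option Bool} {S : ∀ k, List (Alphabet X A k)} {c : ℕ}

theorem does_readFormula_literal {s : Q × (Fin N → X)} {u : Literal d N}
    (h : Does (P.readFormula : MProg Q X A b d) (P.litStep s u).1 n
      (mem i ((encodeLiteral u).reverse ++ i') (List.ofFn (P.litStep s u).2) [] a a' o) q' n' S c) :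
    Does (P.readFormula : MProg Q X A b d) s.1 n
      (mem (encodeLiteral u ++ i) i' (List.ofFn s.2) [] a a' o) q' n' S
      (14 * (encodeLiteral u).length + c) := by
  intro y z l m r
  obtain ⟨y₁, z₁, l₁, m₁, r₁, h₁⟩ := P.does_litProg (q := s.1) (n := n) (i := i) (i' := i') (a := a)
    (a' := a') (o := o) s.2 u (encodeLiteral u ++ i).head? z l m r
  obtain ⟨y₂, z₂, l₂, m₂, r₂, h₂⟩ := h y₁ z₁ l₁ m₁ r₁
  have hl : 2 ≤ (encodeLiteral u).length := by
    simp only [encodeLiteral, List.length_append, length_encodeNat]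
    omega
  -- A literal starts with `one` or `sep`, never with `close`, so one symbol of lookahead decides
  -- which program to run.
  have hy : ∃ t, (encodeLiteral u ++ i).head? = some t ∧ t ≠ .close := by
    obtain ⟨⟨p, hp⟩, e⟩ := u
    cases p
    · exact ⟨.sep, rfl, by simp⟩
    · exact ⟨.one, rfl, by simp⟩
  obtain ⟨t, ht, ht'⟩ := hy
  refine ⟨y₂, z₂, l₂, m₂, r₂, Runs.mono (Runs.poll_step runs_peekInp ?_ (.ite_false ?_ h₁) h₂) ?_⟩
  · simp only [ht, Option.isSome_some]
  · simpa only [ht, beq_eq_false_iff_ne, ne_eq, Option.some.injEq] using ht'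
  · omega

theorem does_readFormula_close {s : Q × (Fin N → X)}
    (h : Does (P.readFormula : MProg Q X A b d) (P.closeStep s).1 n
      (mem i (.close :: i') (List.ofFn (P.closeStep s).2) [] a a' o) q' n' S c) :
    Does (P.readFormula : MProg Q X A b d) s.1 n
      (mem (.close :: i) i' (List.ofFn s.2) [] a a' o) q' n' S (6 * N + 10 + c) := by
  intro y z l m r
  obtain ⟨y₁, z₁, l₁, m₁, r₁, h₁⟩ := P.does_closeProg (d := d) (q := s.1) (n := n) (i := i)
    (i' := i') (a := a) (a' := a') (o := o) s.2 (some .close) z l m r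
  obtain ⟨y₂, z₂, l₂, m₂, r₂, h₂⟩ := h y₁ z₁ l₁ m₁ r₁
  exact ⟨y₂, z₂, l₂, m₂, r₂,
    Runs.mono (Runs.poll_step runs_peekInp rfl (.ite_true rfl h₁) h₂) (by omega)⟩

theorem does_readFormula_literals {s : Q × (Fin N → X)} {C : List (Literal d N)}
    (h : Does (P.readFormula : MProg Q X A b d) (C.foldl P.litStep s).1 n
      (mem i ((C.flatMap encodeLiteral).reverse ++ i') (List.ofFn (C.foldl P.litStep s).2) [] a a' o)
      q' n' S c) :
    Does (P.readFormula : MProg Q X A b d) s.1 n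
      (mem (C.flatMap encodeLiteral ++ i) i' (List.ofFn s.2) [] a a' o) q' n' S
      (14 * (C.flatMap encodeLiteral).length + c) := by
  induction C generalizing s i' with
  | nil => simpa using h
  | cons u C ih =>
    rw [List.flatMap_cons, List.append_assoc]
    rw [List.flatMap_cons, List.reverse_append, List.append_assoc, List.foldl_cons] at h
    refine (P.does_readFormula_literal (ih h)).mono ?_
    rw [List.length_append]
    omega

/-- Literals cost a constant number of steps per symbol, because walking to a cell is paid for by
its unary index. The pass over all N cells at the end of a constraint is charged to the symbol
`close`. -/
theorem does_readFormula {s : Q × (Fin N → X)} {L : List (List (Literal d N))} :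
    Does (P.readFormula : MProg Q X A b d) s.1 n
      (mem (L.flatMap encodeConstraint) i' (List.ofFn s.2) [] a a' o) (P.scan L s).1 n
      (mem [] ((L.flatMap encodeConstraint).reverse ++ i') (List.ofFn (P.scan L s).2) [] a a' o)
      ((6 * N + 14) * (L.flatMap encodeConstraint).length + 2) := by
  induction L generalizing s i' with
  | nil => exact fun y z l m r => ⟨_, _, _, _, _, Runs.poll_done runs_peekInp rfl⟩
  | cons C L ih =>
    have h := P.does_readFormula_literals (s := s) (C := C)
      (P.does_readFormula_close (ih (i' := .close :: ((C.flatMap encodeLiteral).reverse ++ i'))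
        (s := P.constraintStep s C)))
    rw [List.flatMap_cons, encodeConstraint]
    simp only [List.append_assoc, List.cons_append, List.nil_append, List.reverse_append,
      List.reverse_cons]
    refine h.mono ?_
    simp only [List.length_append, List.length_cons]
    nlinarith [Nat.zero_le (N * (List.flatMap encodeLiteral C).length)]

/-- A bound for the number of steps of a scan. -/
def scanCost (N w : ℕ) : ℕ := (6 * N + 17) * (w + 1)

theorem does_scanProg {s : Q × (Fin N → X)} {L : List (List (Literal d N))} :
    Does (P.scanProg : MProg Q X A b d) s.1 n
      (mem (L.flatMap encodeConstraint) [] (List.ofFn s.2) [] a a' o) (P.scan L s).1 n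
      (mem (L.flatMap encodeConstraint) [] (List.ofFn (P.scan L s).2) [] a a' o)
      (scanCost N (L.flatMap encodeConstraint).length) := by
  intro y z l m r
  obtain ⟨y₁, z₁, l₁, m₁, r₁, h₁⟩ := P.does_readFormula (n := n) (i' := []) (a := a)
    (a' := a') (o := o) (s := s) (L := L) y z l m r
  have h := h₁.seq runs_rewindInp
  simp only [List.append_nil, List.reverse_reverse, List.length_reverse] at h
  refine ⟨_, _, _, _, _, h.mono ?_⟩
  rw [scanCost]
  nlinarith

/-- A scan and the update at its end. -/
def roundProg : MProg Q X A b d :=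
  P.scanProg ;; mapArr P.endCell ;; .load fun v => { v with state := P.endState v.state }

theorem does_roundProg {s : Q × (Fin N → X)} {L : List (List (Literal d N))} :
    Does (P.roundProg : MProg Q X A b d) s.1 n
      (mem (L.flatMap encodeConstraint) [] (List.ofFn s.2) [] a a' o) (P.round L s).1 n
      (mem (L.flatMap encodeConstraint) [] (List.ofFn (P.round L s).2) [] a a' o)
      (2 * scanCost N (L.flatMap encodeConstraint).length) := by
  refine (P.does_scanProg.seq (Does.seq (q' := (P.scan L s).1) (n' := n) (c := 6 * N + 4) (c' := 1)
    (S' := mem (L.flatMap encodeConstraint) [] (List.ofFn (P.round L s).2) [] a a' o) ?_ ?_)).mono ?_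
  · intro y z l m r
    have h := runs_mapArr (d := d) (q := (P.scan L s).1) (n := n) (y := y) (z := z) (l := l) (m := m)
      (r := r) (i := L.flatMap encodeConstraint) (i' := []) (x := List.ofFn (P.scan L s).2) (a := a)
      (a' := a') (o := o) (f := P.endCell)
    rw [List.map_ofFn, List.length_ofFn] at h
    exact ⟨_, _, _, _, _, h⟩
  · exact fun y z l m r => ⟨_, _, _, _, _, .load _ _ _⟩
  · rw [scanCost]
    nlinarith

theorem does_iter_roundProg {s : Q × (Fin N → X)} {L : List (List (Literal d N))} (k : ℕ) :
    Does (Prog.iter P.roundProg k : MProg Q X A b d) s.1 n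
      (mem (L.flatMap encodeConstraint) [] (List.ofFn s.2) [] a a' o) ((P.round L)^[k] s).1 n
      (mem (L.flatMap encodeConstraint) [] (List.ofFn ((P.round L)^[k] s).2) [] a a' o)
      (k * (2 * scanCost N (L.flatMap encodeConstraint).length) + 1) := by
  induction k generalizing s with
  | zero => exact fun y z l m r => ⟨_, _, _, _, _, (Runs.load id _ _).mono (by omega)⟩
  | succ k ih =>
    rw [Function.iterate_succ_apply]
    exact (P.does_roundProg.seq (ih (s := P.round L s))).mono (by
      rw [Nat.add_mul, one_mul]
      omega)

/-- Run the procedure on an advice word, which is moved to the auxiliary stack. -/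
def processProg : MProg Q X A b d :=
  poll popAdv (fun v => v.ltr.isSome)
    (pushAdv' id ;; .load (fun v => { v with state := P.letter v.state (v.ltr.getD 0) }) ;;
      Prog.iter P.roundProg P.rounds)

theorem does_processProg {s : Q × (Fin N → X)} {L : List (List (Literal d N))} :
    Does (P.processProg : MProg Q X A b d) s.1 n
      (mem (L.flatMap encodeConstraint) [] (List.ofFn s.2) [] a a' o)
      (a.foldl (P.letterStep L) s).1 n
      (mem (L.flatMap encodeConstraint) [] (List.ofFn (a.foldl (P.letterStep L) s).2) []
        [] (a.reverse ++ a') o)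
      (a.length * (P.rounds * (2 * scanCost N (L.flatMap encodeConstraint).length) + 5) + 2) := by
  induction a generalizing s a' with
  | nil => exact fun y z l m r => ⟨y, z, none, m, r, Runs.mono (Runs.poll_done runs_popAdv rfl) (by simp)⟩
  | cons w a ih =>
    intro y z l m r
    obtain ⟨y₁, z₁, l₁, m₁, r₁, h₁⟩ := P.does_iter_roundProg (n := n) (a := a) (a' := w :: a')
      (o := o) (s := (P.letter s.1 w, s.2)) (L := L) P.rounds y z (some w) m r
    obtain ⟨y₂, z₂, l₂, m₂, r₂, h₂⟩ := ih (s := P.letterStep L s w) (a' := w :: a') y₁ z₁ l₁ m₁ r₁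
    rw [List.foldl_cons, List.reverse_cons, List.append_assoc]
    refine ⟨y₂, z₂, l₂, m₂, r₂, Runs.mono (Runs.poll_step runs_popAdv rfl
      (runs_pushAdv'.seq ((Runs.load _ _ _).seq h₁)) h₂) ?_⟩
    rw [List.length_cons, Nat.add_mul, one_mul]
    omega

end Scan

section Moves

/-- Move the advice back from the auxiliary stack. -/
def rewindAdv : MProg Q X A b d := poll popAdv' (fun v => v.ltr.isSome) (pushAdv id)

/-- Move the advice to the auxiliary stack. -/
def forwardAdv : MProg Q X A b d := poll popAdv (fun v => v.ltr.isSome) (pushAdv' id)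

/-- Delete the cells. -/
def clearArr : MProg Q X A b d := poll popArr (fun v => v.cell.isSome) (.load id)

/-- Delete the advice. -/
def clearAdv : MProg Q X A b d := poll popAdv (fun v => v.ltr.isSome) (.load id)

/-- Delete the formula. -/
def clearInp : MProg Q X A b d := poll popInp (fun v => v.sym.isSome) (.load id)

theorem does_rewindAdv : Does (rewindAdv : MProg Q X A b d) q n (mem i i' x x' a a' o) q n
    (mem i i' x x' (a'.reverse ++ a) [] o) (3 * a'.length + 2) := by
  induction a' generalizing a with
  | nil => exact fun y z l m r => ⟨_, _, _, _, _, Runs.poll_done runs_popAdv' rfl⟩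
  | cons w a' ih =>
    intro y z l m r
    obtain ⟨y₁, z₁, l₁, m₁, r₁, h₁⟩ := ih (a := w :: a) y z (some w) m r
    rw [List.reverse_cons, List.append_assoc]
    exact ⟨y₁, z₁, l₁, m₁, r₁, Runs.mono (Runs.poll_step runs_popAdv' rfl runs_pushAdv h₁) (by
      rw [List.length_cons]; omega)⟩

theorem does_forwardAdv : Does (forwardAdv : MProg Q X A b d) q n (mem i i' x x' a a' o) q n
    (mem i i' x x' [] (a.reverse ++ a') o) (3 * a.length + 2) := by
  induction a generalizing a' with
  | nil => exact fun y z l m r => ⟨_, _, _, _, _, Runs.poll_done runs_popAdv rfl⟩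
  | cons w a ih =>
    intro y z l m r
    obtain ⟨y₁, z₁, l₁, m₁, r₁, h₁⟩ := ih (a' := w :: a') y z (some w) m r
    rw [List.reverse_cons, List.append_assoc]
    exact ⟨y₁, z₁, l₁, m₁, r₁, Runs.mono (Runs.poll_step runs_popAdv rfl runs_pushAdv' h₁) (by
      rw [List.length_cons]; omega)⟩

theorem does_clearArr : Does (clearArr : MProg Q X A b d) q n (mem i i' x x' a a' o) q n
    (mem i i' [] x' a a' o) (3 * x.length + 2) := by
  induction x with
  | nil => exact fun y z l m r => ⟨_, _, _, _, _, Runs.poll_done runs_popArr rfl⟩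
  | cons w x ih =>
    intro y z l m r
    obtain ⟨y₁, z₁, l₁, m₁, r₁, h₁⟩ := ih y (some w) l m r
    exact ⟨y₁, z₁, l₁, m₁, r₁, Runs.mono (Runs.poll_step runs_popArr rfl (.load _ _ _) h₁) (by
      rw [List.length_cons]; omega)⟩

theorem does_clearAdv : Does (clearAdv : MProg Q X A b d) q n (mem i i' x x' a a' o) q n
    (mem i i' x x' [] a' o) (3 * a.length + 2) := by
  induction a with
  | nil => exact fun y z l m r => ⟨_, _, _, _, _, Runs.poll_done runs_popAdv rfl⟩
  | cons w a ih =>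
    intro y z l m r
    obtain ⟨y₁, z₁, l₁, m₁, r₁, h₁⟩ := ih y z (some w) m r
    exact ⟨y₁, z₁, l₁, m₁, r₁, Runs.mono (Runs.poll_step runs_popAdv rfl (.load _ _ _) h₁) (by
      rw [List.length_cons]; omega)⟩

theorem does_clearInp : Does (clearInp : MProg Q X A b d) q n (mem i i' x x' a a' o) q n
    (mem [] i' x x' a a' o) (3 * i.length + 2) := by
  induction i with
  | nil => exact fun y z l m r => ⟨_, _, _, _, _, Runs.poll_done runs_popInp rfl⟩
  | cons w i ih =>
    intro y z l m r
    obtain ⟨y₁, z₁, l₁, m₁, r₁, h₁⟩ := ih (some w) z l m r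
    exact ⟨y₁, z₁, l₁, m₁, r₁, Runs.mono (Runs.poll_step runs_popInp rfl (.load _ _ _) h₁) (by
      rw [List.length_cons]; omega)⟩

/-- Write the cells at the given positions of the block of the letter last read. -/
def pushCells : List (Fin b) → MProg Q X A b d
  | [] => .load id
  | j :: js => pushArr (fun v => P.init (v.ltr.getD 0) j) ;; pushCells js

theorem runs_pushCells {y : Option Symbol} {z : Option X} {w : Fin (A + 1)} {m : Fin (d + 1)}
    {r : Fin b} (js : List (Fin b)) :
    Runs (P.pushCells js : MProg Q X A b d) ⟨q, n, y, z, some w, m, r⟩ (mem i i' x x' a a' o)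
      ⟨q, n, y, z, some w, m, r⟩ (mem i i' ((js.map (P.init w)).reverse ++ x) x' a a' o)
      (js.length + 1) := by
  induction js generalizing x with
  | nil => exact Runs.load id _ _
  | cons j js ih =>
    rw [List.map_cons, List.reverse_cons, List.append_assoc]
    exact Runs.mono (runs_pushArr.seq ih) (by rw [List.length_cons]; omega)

/-- The initial cells of an advice word. -/
def blocks (a : List (Fin (A + 1))) : List X := a.flatMap fun w => List.ofFn (P.init w)

/-- Move the advice back from the auxiliary stack and set up the array. -/
def buildProg : MProg Q X A b d :=
  poll popAdv' (fun v => v.ltr.isSome) (pushAdv id ;; P.pushCells (List.finRange b).reverse)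

/-- The advice lies reversed on the auxiliary stack and comes back last letter first. The array is a
stack as well and grows from its last block to its first, so it always equals the blocks of the part
of the advice already restored. -/
theorem does_buildProg : Does (P.buildProg : MProg Q X A b d) q n
    (mem i i' (P.blocks a) x' a a' o) q n
    (mem i i' (P.blocks (a'.reverse ++ a)) x' (a'.reverse ++ a) [] o)
    (a'.length * (b + 4) + 2) := by
  induction a' generalizing a with
  | nil => exact fun y z l m r => ⟨y, z, none, m, r, Runs.mono (Runs.poll_done runs_popAdv' rfl) (by simp)⟩
  | cons w a' ih =>
    intro y z l m r
    obtain ⟨y₁, z₁, l₁, m₁, r₁, h₁⟩ := ih (a := w :: a) y z (some w) m r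
    have h := P.runs_pushCells (d := d) (q := q) (n := n) (y := y) (z := z) (w := w) (m := m)
      (r := r) (i := i) (i' := i') (x := P.blocks a) (x' := x') (a := w :: a) (a' := a') (o := o)
      (List.finRange b).reverse
    -- Pushing the cells of a block in reverse order leaves them in the right order on the stack.
    have hb : ((List.finRange b).reverse.map (P.init w)).reverse ++ P.blocks a
        = P.blocks (w :: a) := by
      rw [List.map_reverse, List.reverse_reverse, ← List.ofFn_eq_map]
      rfl
    rw [hb] at h
    rw [List.reverse_cons, List.append_assoc]
    exact ⟨y₁, z₁, l₁, m₁, r₁, Runs.mono (Runs.poll_step runs_popAdv' rfl (runs_pushAdv.seq h) h₁)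
      (by
        rw [List.length_reverse, List.length_finRange, List.length_cons, Nat.add_mul, one_mul]
        omega)⟩

end Moves

/-! ### Enumerating advice words as numbers in base A + 1 -/

section Odometer

/-- The number with the given digits, the least significant digit first. -/
def value : List (Fin (A + 1)) → ℕ
  | [] => 0
  | w :: a => w + (A + 1) * value a

theorem value_lt (a : List (Fin (A + 1))) : value a < (A + 1) ^ a.length := by
  induction a with
  | nil => simp [value]
  | cons w a ih =>
    rw [value, List.length_cons, pow_succ']
    calc (w : ℕ) + (A + 1) * value a < (A + 1) * (value a + 1) := by
          rw [Nat.mul_add, mul_one]; omega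
      _ ≤ _ := Nat.mul_le_mul_left _ ih

theorem value_injective : ∀ {a a' : List (Fin (A + 1))}, a.length = a'.length →
    value a = value a' → a = a'
  | [], [], _, _ => rfl
  | w :: a, w' :: a', hl, hv => by
    have h₁ : (w : ℕ) = w' := by
      have := congrArg (· % (A + 1)) hv
      simpa only [value, Nat.add_mul_mod_self_left, Nat.mod_eq_of_lt w.2, Nat.mod_eq_of_lt w'.2]
        using this
    have h₂ : value a = value a' := by
      simp only [value, h₁, Nat.add_left_cancel_iff] at hv
      exact Nat.eq_of_mul_eq_mul_left (Nat.succ_pos A) hv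
    rw [Fin.ext h₁, value_injective (Nat.succ.inj hl) h₂]

theorem value_replicate_zero (k : ℕ) (a : List (Fin (A + 1))) :
    value (List.replicate k 0 ++ a) = (A + 1) ^ k * value a := by
  induction k with
  | zero => simp
  | succ k ih => simp only [List.replicate_succ, List.cons_append, value, ih, pow_succ']; simp [mul_assoc]

theorem value_replicate_last (k : ℕ) (a : List (Fin (A + 1))) :
    value (List.replicate k (Fin.last A) ++ a) + 1 = (A + 1) ^ k * (value a + 1) := by
  induction k with
  | zero => simp
  | succ k ih =>
    rw [List.replicate_succ, List.cons_append, value, pow_succ', mul_assoc, ← ih, Fin.val_last]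
    ring

/-- Replace the leading maximal digits by zeros. -/
def carryProg : MProg Q X A b d :=
  poll popAdv (fun v => v.ltr == some (Fin.last A)) (pushAdv' fun _ => 0)

/-- Replace the advice word by the next one; the answer is `false` if there is none. -/
def nextProg : MProg Q X A b d :=
  (carryProg ;; .ite (fun v => v.ltr.isSome) (pushAdv (· + 1))
    (.load fun v => { v with ans := some false })) ;; rewindAdv

/-- The carry turns the leading maximal digits into zeros. The first other digit, if there is one,
has been popped and waits in the register to be incremented. -/
theorem runs_carryProg : ∃ k a₂, a = List.replicate k (Fin.last A) ++ a₂ ∧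
    a₂.head? ≠ some (Fin.last A) ∧
    ∀ (y : Option Symbol) (z : Option X) (l : Option (Fin (A + 1))) (m : Fin (d + 1)) (r : Fin b),
      Runs (carryProg : MProg Q X A b d) ⟨q, n, y, z, l, m, r⟩ (mem i i' x x' a a' o)
        ⟨q, n, y, z, a₂.head?, m, r⟩ (mem i i' x x' a₂.tail (List.replicate k 0 ++ a') o)
        (3 * k + 2) := by
  induction a generalizing a' with
  | nil => exact ⟨0, [], rfl, by simp, fun y z l m r => Runs.poll_done runs_popAdv rfl⟩
  | cons w a ih =>
    by_cases hw : w = Fin.last A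
    · obtain ⟨k, a₂, h₁, h₂, h₃⟩ := ih (a' := 0 :: a')
      refine ⟨k + 1, a₂, by rw [h₁, hw]; rfl, h₂, fun y z l m r => ?_⟩
      rw [List.replicate_succ', List.append_assoc]
      exact Runs.mono (Runs.poll_step runs_popAdv (by simp [hw]) runs_pushAdv'
        (h₃ y z (some w) m r)) (by omega)
    · exact ⟨0, w :: a, rfl, by simpa using hw, fun y z l m r =>
        Runs.poll_done runs_popAdv (by simpa using hw)⟩

/-- If some digit is not maximal, the carry stops there and the value grows by one. Otherwise the
word was the last of its length, and the answer becomes `false`. -/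
theorem does_nextProg :
    (∃ a₂ : List (Fin (A + 1)), a₂.length = a.length ∧ value a₂ = value a + 1 ∧
      Does (nextProg : MProg Q X A b d) q none (mem i i' x x' a [] o) q none (mem i i' x x' a₂ [] o)
        (6 * a.length + 6)) ∨
    (value a + 1 = (A + 1) ^ a.length ∧ ∃ a₂ : List (Fin (A + 1)), a₂.length = a.length ∧
      Does (nextProg : MProg Q X A b d) q none (mem i i' x x' a [] o) q (some false)
        (mem i i' x x' a₂ [] o) (6 * a.length + 6)) := by
  obtain ⟨k, a₂, h₁, h₂, h₃⟩ := runs_carryProg (a := a) (a' := []) (b := b) (d := d) (q := q)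
    (n := none) (i := i) (i' := i') (x := x) (x' := x') (o := o)
  rw [List.append_nil] at h₃
  have hrev : ∀ a₄ : List (Fin (A + 1)), (List.replicate k 0).reverse ++ a₄ =
      List.replicate k 0 ++ a₄ := fun a₄ => by rw [List.reverse_replicate]
  cases a₂ with
  | nil =>
    refine Or.inr ⟨?_, List.replicate k 0 ++ [], by simp [h₁], ?_⟩
    · have := value_replicate_last k ([] : List (Fin (A + 1)))
      rw [← h₁] at this
      rw [this, h₁]
      simp [value]
    · rw [← hrev]
      refine ((Does.seq (c := 3 * k + 4) (fun y z l m r => ?_) does_rewindAdv)).mono ?_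
      · exact ⟨_, _, _, _, _, Runs.mono ((h₃ y z l m r).seq (.ite_false rfl (.load _ _ _)))
          (by omega)⟩
      · simp only [h₁, List.length_append, List.length_replicate]
        omega
  | cons w a₃ =>
    have hw : w ≠ Fin.last A := by simpa using h₂
    refine Or.inl ⟨List.replicate k 0 ++ (w + 1) :: a₃, by simp [h₁], ?_, ?_⟩
    · rw [value_replicate_zero, h₁, value_replicate_last, value, value,
        Fin.val_add_one_of_lt (lt_of_le_of_ne (Fin.le_last w) hw)]
      ring
    · rw [← hrev]
      refine ((Does.seq (c := 3 * k + 4) (fun y z l m r => ?_) does_rewindAdv)).mono ?_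
      · exact ⟨_, _, _, _, _, Runs.mono ((h₃ y z l m r).seq (.ite_true rfl runs_pushAdv))
          (by omega)⟩
      · simp only [h₁, List.length_append, List.length_replicate]
        omega

end Odometer

end Procedure

end CSP

/-! ### Exhaustive search over the advice words -/

namespace CSP

namespace Procedure

open Prog

variable {Q X : Type} {A b d : ℕ} [Inhabited X] [NeZero b] (P : Procedure Q X A b) {q : Q}
  {n : Option Bool} {i i' : List Symbol} {x x' : List X} {a a' : List (Fin (A + 1))} {o : List Bool}

/-- The initial array of an advice word. -/
def initArray (N : ℕ) (a : List (Fin (A + 1))) (p : Fin N) : X :=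
  P.init (a.getD (p / b) 0) ⟨p % b, Nat.mod_lt _ (NeZero.pos b)⟩

theorem ofFn_initArray : List.ofFn (P.initArray (a.length * b) a) = P.blocks a := by
  have ha : P.blocks a = (List.ofFn fun j : Fin a.length => List.ofFn (P.init a[j])).flatten := by
    conv_lhs => rw [blocks, List.flatMap, ← List.ofFn_getElem (xs := a), List.map_ofFn]
    simp [Function.comp_def]
  rw [ha, List.ofFn_mul]
  congr 2
  funext j
  congr 1
  funext p
  have h₁ : (j * b + p : ℕ) / b = j := by
    rw [Nat.mul_comm, Nat.mul_add_div (NeZero.pos b), Nat.div_eq_of_lt p.2, add_zero]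
  have h₂ : (j * b + p : ℕ) % b = p := by
    rw [Nat.mul_comm, Nat.mul_add_mod, Nat.mod_eq_of_lt p.2]
  simp only [initArray, h₁, h₂]
  simp

/-- The answer of the procedure for a formula and an advice word. -/
def answer {N : ℕ} (L : List (List (Literal d N))) (a : List (Fin (A + 1))) : Bool :=
  P.check L (P.initArray N a) a

/-- Try the current advice word, and go on to the next one if it fails. -/
def tryProg : MProg Q X A b d :=
  forwardAdv ;; P.buildProg ;; .load (fun v => { v with state := P.start }) ;; P.processProg ;;
    rewindAdv ;; P.scanProg ;; clearArr ;;
    .ite (fun v => P.accept v.state) (.load fun v => { v with ans := some true }) nextProg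

/-- A bound for the number of steps for each advice word. -/
def tryCost (N N₀ w : ℕ) : ℕ :=
  N₀ * (b + P.rounds * (2 * scanCost N w) + 21) + 2 * scanCost N w + 20

/-- An attempt restores the formula and the stacks, except that the advice may have changed, so
attempts can be chained. The outcomes are success, failure with a successor word, and failure on the
last word. -/
theorem does_tryProg {L : List (List (Literal d (a.length * b)))} {o : List Bool} {r : ℕ}
    (hr : r = P.tryCost (a.length * b) a.length (L.flatMap encodeConstraint).length) :
    let W := L.flatMap encodeConstraint
    (P.answer L a = true ∧ ∃ q', Does (P.tryProg : MProg Q X A b d) q none (mem W [] [] [] a [] o)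
      q' (some true) (mem W [] [] [] a [] o) r) ∨
    (P.answer L a = false ∧ (∃ q' a₂, a₂.length = a.length ∧ value a₂ = value a + 1 ∧
      Does (P.tryProg : MProg Q X A b d) q none (mem W [] [] [] a [] o)
        q' none (mem W [] [] [] a₂ [] o) r)) ∨
    (P.answer L a = false ∧ value a + 1 = (A + 1) ^ a.length ∧ ∃ q' a₂, a₂.length = a.length ∧
      Does (P.tryProg : MProg Q X A b d) q none (mem W [] [] [] a [] o)
        q' (some false) (mem W [] [] [] a₂ [] o) r) := by
  intro W
  set x := P.initArray (a.length * b) a with hx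
  set s := a.foldl (P.letterStep L) (P.start, x) with hs
  have main : ∀ {q₁ q₂ : Q} {n₂ : Option Bool} {a₂ : List (Fin (A + 1))}, q₁ = (P.scan L s).1 →
      Does (.ite (fun v => P.accept v.state) (.load fun v => { v with ans := some true })
        nextProg : MProg Q X A b d) q₁ none (mem W [] [] [] a [] o) q₂ n₂ (mem W [] [] [] a₂ [] o)
        (6 * a.length + 7) →
      Does (P.tryProg : MProg Q X A b d) q none (mem W [] [] [] a [] o) q₂ n₂
        (mem W [] [] [] a₂ [] o) r := by
    intro q₁ q₂ n₂ a₂ hq h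
    subst hq
    have h₁ : Does (forwardAdv : MProg Q X A b d) q none (mem W [] [] [] a [] o) q none
        (mem W [] [] [] [] a.reverse o) (3 * a.length + 2) := by
      simpa using does_forwardAdv (d := d) (q := q) (n := none) (i := W) (i' := []) (x := [])
        (x' := []) (a := a) (a' := []) (o := o)
    have h₂ : Does (P.buildProg : MProg Q X A b d) q none (mem W [] [] [] [] a.reverse o) q none
        (mem W [] (List.ofFn x) [] a [] o) (a.length * (b + 4) + 2) := by
      have := P.does_buildProg (d := d) (q := q) (n := none) (i := W) (i' := []) (x' := [])
        (a := []) (a' := a.reverse) (o := o)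
      rw [List.reverse_reverse, List.append_nil, List.length_reverse] at this
      rw [hx, ofFn_initArray]
      exact this
    have h₃ : Does (.load fun v => { v with state := P.start } : MProg Q X A b d) q none
        (mem W [] (List.ofFn x) [] a [] o) P.start none (mem W [] (List.ofFn x) [] a [] o) 1 :=
      fun y z l m r => ⟨_, _, _, _, _, .load _ _ _⟩
    have h₄ : Does (P.processProg : MProg Q X A b d) P.start none
        (mem W [] (List.ofFn x) [] a [] o) s.1 none (mem W [] (List.ofFn s.2) [] [] a.reverse o)
        (a.length * (P.rounds * (2 * scanCost (a.length * b) W.length) + 5) + 2) := by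
      have := P.does_processProg (n := none) (a := a) (a' := []) (o := o) (s := (P.start, x))
        (L := L)
      rwa [List.append_nil] at this
    have h₅ : Does (rewindAdv : MProg Q X A b d) s.1 none
        (mem W [] (List.ofFn s.2) [] [] a.reverse o) s.1 none (mem W [] (List.ofFn s.2) [] a [] o)
        (3 * a.length + 2) := by
      simpa using does_rewindAdv (d := d) (q := s.1) (n := none) (i := W) (i' := [])
        (x := List.ofFn s.2) (x' := []) (a := []) (a' := a.reverse) (o := o)
    have h₆ := P.does_scanProg (n := none) (a := a) (a' := []) (o := o) (s := s) (L := L)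
    have h₇ := does_clearArr (b := b) (d := d) (q := (P.scan L s).1) (n := none) (i := W) (i' := [])
      (x := List.ofFn (P.scan L s).2) (x' := []) (a := a) (a' := []) (o := o)
    refine (h₁.seq (h₂.seq (h₃.seq (h₄.seq (h₅.seq (h₆.seq (h₇.seq h))))))).mono ?_
    -- Deleting the cells is paid for by the second `scanCost` in `tryCost`.
    have hN : 3 * (a.length * b) ≤ scanCost (a.length * b) W.length :=
      (by omega : 3 * (a.length * b) ≤ 6 * (a.length * b) + 17).trans
        (Nat.le_mul_of_pos_right _ (Nat.succ_pos _))
    rw [hr, tryCost, List.length_ofFn]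
    change _ ≤ a.length * (b + P.rounds * (2 * scanCost (a.length * b) W.length) + 21) +
      2 * scanCost (a.length * b) W.length + 20
    change _ + (_ + (_ + (_ + (_ + (scanCost (a.length * b) W.length + _))))) ≤ _
    generalize scanCost (a.length * b) W.length = u at *
    simp only [Nat.mul_add]
    omega
  cases hacc : P.accept (P.scan L s).1
  · right
    rcases does_nextProg (X := X) (b := b) (d := d) (q := (P.scan L s).1) (a := a) (i := W) (i' := [])
      (x := []) (x' := []) (o := o) with ⟨a₂, h₁, h₂, h₃⟩ | ⟨h₁, a₂, h₂, h₃⟩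
    · refine Or.inl ⟨hacc, (P.scan L s).1, a₂, h₁, h₂, main rfl fun y z l m r => ?_⟩
      obtain ⟨y, z, l, m, r, h⟩ := h₃ y z l m r
      exact ⟨y, z, l, m, r, .ite_false hacc h⟩
    · refine Or.inr ⟨hacc, h₁, (P.scan L s).1, a₂, h₂, main rfl fun y z l m r => ?_⟩
      obtain ⟨y, z, l, m, r, h⟩ := h₃ y z l m r
      exact ⟨y, z, l, m, r, .ite_false hacc h⟩
  · exact Or.inl ⟨hacc, (P.scan L s).1, main rfl fun y z l m r => ⟨_, _, _, _, _,
      Runs.mono (.ite_true hacc (.load _ _ _)) (by omega)⟩⟩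

/-- Try the advice words one after the other. -/
def searchProg : MProg Q X A b d := .loop (fun v => v.ans.isNone) P.tryProg

-- Induction on the number f of advice words not yet tried, all words of smaller value having
-- failed. As words of equal length are determined by their value, the search is complete when the
-- odometer overflows.
open Classical in
theorem does_searchProg {N₀ : ℕ} {L : List (List (Literal d (N₀ * b)))} {o : List Bool} (f : ℕ)
    (hl : a.length = N₀) (hv : value a + f = (A + 1) ^ N₀)
    (ha : ∀ a' : List (Fin (A + 1)), a'.length = N₀ → value a' < value a → P.answer L a' = false) :
    let W := L.flatMap encodeConstraint
    ∃ q' a₂, a₂.length = N₀ ∧ Does (P.searchProg : MProg Q X A b d) q none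
      (mem W [] [] [] a [] o) q' (some (decide (∃ a' : List (Fin (A + 1)), a'.length = N₀ ∧
        P.answer L a' = true))) (mem W [] [] [] a₂ [] o)
      (f * (P.tryCost (N₀ * b) N₀ W.length + 1) + 1) := by
  intro W
  induction f generalizing a q with
  | zero =>
    have := value_lt a
    rw [hl] at this
    omega
  | succ f ih =>
    have finished : ∀ {q' : Q} {a₂ : List (Fin (A + 1))} {v : Bool}, a₂.length = N₀ →
        Does (P.tryProg : MProg Q X A b d) q none (mem W [] [] [] a [] o) q' (some v)
          (mem W [] [] [] a₂ [] o) (P.tryCost (N₀ * b) N₀ W.length) →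
        v = decide (∃ a' : List (Fin (A + 1)), a'.length = N₀ ∧ P.answer L a' = true) →
        ∃ q' a₂, a₂.length = N₀ ∧ Does (P.searchProg : MProg Q X A b d) q none
          (mem W [] [] [] a [] o) q' (some (decide (∃ a' : List (Fin (A + 1)), a'.length = N₀ ∧
            P.answer L a' = true))) (mem W [] [] [] a₂ [] o)
          ((f + 1) * (P.tryCost (N₀ * b) N₀ W.length + 1) + 1) := by
      intro q' a₂ v h₁ h₂ hv
      refine ⟨q', a₂, h₁, fun y z l m r => ?_⟩
      obtain ⟨y, z, l, m, r, h⟩ := h₂ y z l m r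
      rw [← hv]
      refine ⟨y, z, l, m, r, Runs.mono (.loop_true rfl h (.loop_false rfl)) ?_⟩
      rw [Nat.add_mul]
      omega
    subst hl
    rcases P.does_tryProg (q := q) (a := a) (L := L) (o := o) rfl with
      ⟨h₁, q', h₂⟩ | ⟨h₁, q', a₂, h₂, h₃, h₄⟩ | ⟨h₁, h₂, q', a₂, h₃, h₄⟩
    · exact finished rfl h₂ (decide_eq_true ⟨a, rfl, h₁⟩).symm
    · obtain ⟨q'', a₃, h₅, h₆⟩ := ih (q := q') h₂ (by omega) (fun a' hl' hv' => by
        rcases Nat.lt_or_ge (value a') (value a) with h | h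
        · exact ha a' hl' h
        · rw [value_injective hl' (by omega)]
          exact h₁)
      refine ⟨q'', a₃, h₅, fun y z l m r => ?_⟩
      obtain ⟨y, z, l, m, r, h⟩ := h₄ y z l m r
      obtain ⟨y, z, l, m, r, h'⟩ := h₆ y z l m r
      refine ⟨y, z, l, m, r, Runs.mono (.loop_true rfl h h') ?_⟩
      rw [Nat.add_mul, one_mul]
      exact (by omega : ∀ u v : ℕ, u + (v + 1) + 1 ≤ v + (u + 1) + 1) _ _
    · refine finished h₃ h₄ (decide_eq_false ?_).symm
      rintro ⟨a', hl', h'⟩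
      have := value_lt a'
      rw [hl'] at this
      rcases Nat.lt_or_ge (value a') (value a) with h | h
      · simp [ha a' hl' h] at h'
      · rw [value_injective hl' (by omega), h₁] at h'
        cases h'

/-- Read the number of variables and write the first advice word. -/
def parseProg : MProg Q X A b d :=
  pushAdv (fun _ => 0) ;; poll popInp (fun v => v.sym == some .one)
    (.load (fun v => { v with pos := Fin.ofNat b (v.pos + 1) }) ;;
      .ite (fun v => (v.pos : ℕ) == 0) (pushAdv fun _ => 0) (.load id))

/-- After j unary digits the field `pos` holds j mod b, and j / b + 1 letters have been written. A
new letter is due exactly when b divides the new count. The final n / b + 1 blocks have room for all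
n variables. -/
theorem runs_parse_loop {y : Option Symbol} {z : Option X} {l : Option (Fin (A + 1))}
    {m : Fin (d + 1)} (j k : ℕ) : Runs (poll popInp (fun v => v.sym == some .one)
    (.load (fun v => { v with pos := Fin.ofNat b (v.pos + 1) }) ;;
      .ite (fun v => (v.pos : ℕ) == 0) (pushAdv fun _ => 0) (.load id)) : MProg Q X A b d)
    ⟨q, n, y, z, l, m, Fin.ofNat b j⟩
    (mem (encodeNat k ++ i) i' x x' (List.replicate (j / b + 1) 0) a' o)
    ⟨q, n, some .sep, z, l, m, Fin.ofNat b (j + k)⟩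
    (mem i i' x x' (List.replicate ((j + k) / b + 1) 0) a' o) (5 * k + 2) := by
  induction k generalizing j y with
  | zero => exact .poll_done runs_popInp rfl
  | succ k ih =>
    have h := ih (j + 1) (y := some .one)
    have hj : (Fin.ofNat b ((Fin.ofNat b j : Fin b) + 1) : Fin b) = Fin.ofNat b (j + 1) := by
      ext
      simp
    rw [show j + (k + 1) = j + 1 + k by omega, encodeNat_succ]
    refine Runs.mono (Runs.poll_step runs_popInp rfl (c₂ := 1 + 2) (.seq (.load _ _ _) ?_) h)
      (by omega)
    simp only [hj]
    rw [Nat.succ_div]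
    by_cases hb : b ∣ j + 1
    · rw [if_pos hb]
      exact .ite_true (by simpa [Fin.val_ofNat] using Nat.mod_eq_zero_of_dvd hb) runs_pushAdv
    · rw [if_neg hb]
      refine .ite_false ?_ (.load id _ _)
      simpa [Fin.val_ofNat] using fun h => hb (Nat.dvd_of_mod_eq_zero h)

/-- The whole program. -/
def mainProg : MProg Q X A b d :=
  parseProg ;; P.searchProg ;; clearInp ;; clearAdv ;; pushOut ;;
    .load fun _ => ⟨P.start, none, none, none, none, 0, Fin.ofNat b 0⟩

/-- A bound for the number of steps of the whole program. -/
def totalCost (n w : ℕ) : ℕ :=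
  (A + 1) ^ (n / b + 1) * (P.tryCost ((n / b + 1) * b) (n / b + 1) w + 1) + 3 * w + 8 * n + 20

-- The prescribed halting configuration has the initial register and nothing but the output on its
-- stacks, hence the clearing and the final reset. The bound is one below `totalCost` to leave room
-- for the halting step.
open Classical in
theorem runs_mainProg (n : ℕ) (L : List (List (Literal d ((n / b + 1) * b)))) :
    Runs (P.mainProg : MProg Q X A b d) ⟨P.start, none, none, none, none, 0, Fin.ofNat b 0⟩
      (mem (encodeNat n ++ L.flatMap encodeConstraint) [] [] [] [] [] [])
      ⟨P.start, none, none, none, none, 0, Fin.ofNat b 0⟩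
      (mem [] [] [] [] [] [] [decide (∃ a : List (Fin (A + 1)), a.length = n / b + 1 ∧
        P.answer L a = true)])
      (P.totalCost n (L.flatMap encodeConstraint).length - 1) := by
  have h₁ := runs_parse_loop (b := b) (d := d) (q := P.start) (n := none)
    (i := L.flatMap encodeConstraint) (i' := []) (x := ([] : List X)) (x' := []) (A := A)
    (a' := []) (o := []) (y := none) (z := none) (l := none) (m := 0) 0 n
  rw [Nat.zero_div, zero_add, zero_add] at h₁
  have hv : value (List.replicate (n / b + 1) (0 : Fin (A + 1))) = 0 := by
    have := value_replicate_zero (n / b + 1) ([] : List (Fin (A + 1)))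
    simpa [value] using this
  obtain ⟨q', a₂, ha₂, h₂⟩ := P.does_searchProg (q := P.start) (L := L) (o := [])
    (a := List.replicate (n / b + 1) 0) ((A + 1) ^ (n / b + 1)) (by simp) (by rw [hv, zero_add])
    (by intro a' _ h; omega)
  have h₃ := h₂.seq (does_clearInp.seq does_clearAdv)
  obtain ⟨y, z, l, m, r, h₄⟩ := h₃ (some .sep) none none 0 (Fin.ofNat b n)
  obtain ⟨v₁, S₁, c₁, c₂, h₅, h₆, hc⟩ := h₄.seq_inv
  obtain ⟨v₂, S₂, c₃, c₄, h₇, h₈, hc'⟩ := h₆.seq_inv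
  refine Runs.mono ((runs_pushAdv.seq h₁).seq (h₅.seq (h₇.seq (h₈.seq (runs_pushOut.seq
    (.load _ _ _)))))) ?_
  rw [totalCost]
  rw [ha₂] at hc
  have : n / b ≤ n := Nat.div_le_self n b
  omega

/-- The machine that runs a procedure with all advice words. -/
noncomputable def toMachine (d : ℕ) [Fintype Q] [Fintype X] : Turing.TM2ComputableAux Symbol Bool where
  tm :=
    { K := Stack
      k₀ := .inp
      k₁ := .out
      Γ := Alphabet X A
      Λ := Option (P.mainProg : MProg Q X A b d).Label
      main := some (P.mainProg : MProg Q X A b d).entry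
      σ := Reg Q X A b d
      initialState := ⟨P.start, none, none, none, none, 0, Fin.ofNat b 0⟩
      Γk₀Fin := inferInstanceAs (Fintype Symbol)
      m := (P.mainProg : MProg Q X A b d).machine }
  inputAlphabet := Equiv.refl Symbol
  outputAlphabet := Equiv.refl Bool

open Classical in
theorem toMachine_outputs [Fintype Q] [Fintype X] (n : ℕ)
    (L : List (List (Literal d ((n / b + 1) * b)))) :
    Nonempty (Turing.TM2OutputsInTime (P.toMachine d).tm
      ((encodeNat n ++ L.flatMap encodeConstraint).map (P.toMachine d).inputAlphabet.symm)
      (some ([decide (∃ a : List (Fin (A + 1)), a.length = n / b + 1 ∧ P.answer L a = true)].map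
        (P.toMachine d).outputAlphabet.symm))
      (P.totalCost n (L.flatMap encodeConstraint).length)) := by
  obtain ⟨k, hk, h⟩ := (P.runs_mainProg n L).machine_steps
  refine ⟨⟨⟨k, ?_⟩, hk.trans ?_⟩⟩
  · have h₁ : Turing.initList (P.toMachine d).tm ((encodeNat n ++ L.flatMap encodeConstraint).map
        (P.toMachine d).inputAlphabet.symm) =
        (⟨some (some (P.mainProg : MProg Q X A b d).entry),
          ⟨P.start, none, none, none, none, 0, Fin.ofNat b 0⟩,
          mem (encodeNat n ++ L.flatMap encodeConstraint) [] [] [] [] [] []⟩ :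
          Turing.TM2.Cfg (Alphabet X A) _ _) := by
      refine congrArg (Turing.TM2.Cfg.mk _ _) (funext fun k => ?_)
      cases k <;> try rfl
      exact List.map_id _
    have h₂ : ∀ v : Bool, Turing.haltList (P.toMachine d).tm ([v].map
        (P.toMachine d).outputAlphabet.symm) =
        (⟨none, ⟨P.start, none, none, none, none, 0, Fin.ofNat b 0⟩,
          mem [] [] [] [] [] [] [v]⟩ : Turing.TM2.Cfg (Alphabet X A) _ _) := by
      intro v
      refine congrArg (Turing.TM2.Cfg.mk _ _) (funext fun k => ?_)
      cases k <;> rfl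
    rw [Option.map_some, h₂, h₁]
    exact h
  · rw [totalCost]
    omega

end Procedure

end CSP

/-! ### Covering codes by greedy choice and generating functions -/

namespace CSP

section Covering

open Finset

/-- Greedy covering: if every `v` is related to at least a fraction `p` of all `w`, then a few `w`
suffice for all `v`. -/
theorem exists_covering {W V : Type} [Fintype W] [Nonempty W] [Fintype V] [Nonempty V]
    (R : W → V → Prop) {p : ℝ} (hp : 0 < p) (hp₁ : p ≤ 1)
    (h : ∀ v, ∀ S : Finset W, (∀ w, w ∈ S ↔ R w v) → p * Fintype.card W ≤ #S) :
    ∃ C : Finset W, (∀ v, ∃ w ∈ C, R w v) ∧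
      (#C : ℝ) ≤ (Real.log (Fintype.card V) + 1) / p := by
  classical
  -- By double counting, some w is related to at least a fraction p of the elements still uncovered.
  -- Each choice therefore shrinks the uncovered set by a factor 1 - p.
  have greedy : ∀ j : ℕ, ∃ C : Finset W, #C ≤ j ∧
      ((#{v : V | ∀ w ∈ C, ¬ R w v} : ℕ) : ℝ) ≤ (1 - p) ^ j * Fintype.card V := by
    intro j
    induction j with
    | zero => exact ⟨∅, by simp, by simp⟩
    | succ j ih =>
      obtain ⟨C, hC, hU⟩ := ih
      set U : Finset V := {v | ∀ w ∈ C, ¬ R w v} with hUdef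
      have hsum : ∑ _w : W, p * (#U : ℝ) ≤ ∑ w : W, ((#{v ∈ U | R w v} : ℕ) : ℝ) := by
        have : ∑ w : W, ((#{v ∈ U | R w v} : ℕ) : ℝ) = ∑ v ∈ U, ((#{w : W | R w v} : ℕ) : ℝ) := by
          exact_mod_cast (sum_card_bipartiteAbove_eq_sum_card_bipartiteBelow (s := univ) (t := U) R)
        rw [this, sum_const, card_univ, nsmul_eq_mul]
        calc (Fintype.card W : ℝ) * (p * #U) = ∑ v ∈ U, p * Fintype.card W := by
              rw [sum_const, nsmul_eq_mul]; ring
          _ ≤ _ := sum_le_sum fun v _ => h v _ (by simp)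
      obtain ⟨w, -, hw⟩ := exists_le_of_sum_le univ_nonempty hsum
      refine ⟨insert w C, (card_insert_le _ _).trans (by omega), ?_⟩
      have hsplit : (#{v : V | ∀ w' ∈ insert w C, ¬ R w' v} : ℕ) + #{v ∈ U | R w v} = #U := by
        rw [add_comm, ← card_filter_add_card_filter_not (s := U) (p := fun v => R w v)]
        congr 2
        ext v
        simp only [hUdef, mem_filter, mem_univ, true_and, mem_insert, forall_eq_or_imp]
        tauto
      have hsplit' : ((#{v : V | ∀ w' ∈ insert w C, ¬ R w' v} : ℕ) : ℝ) + (#{v ∈ U | R w v} : ℕ)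
          = #U := by exact_mod_cast hsplit
      calc ((#{v : V | ∀ w' ∈ insert w C, ¬ R w' v} : ℕ) : ℝ) ≤ (1 - p) * #U := by linarith
        _ ≤ (1 - p) * ((1 - p) ^ j * Fintype.card V) :=
          mul_le_mul_of_nonneg_left hU (by linarith)
        _ = _ := by ring
  have hV : (0 : ℝ) < Fintype.card V := by exact_mod_cast Fintype.card_pos
  have hlog : 0 ≤ Real.log (Fintype.card V) :=
    Real.log_nonneg (by exact_mod_cast Nat.one_le_iff_ne_zero.2 Fintype.card_ne_zero)
  -- This makes p * j exceed the logarithm of the size of V, so fewer than one element stays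
  -- uncovered.
  set j := ⌊Real.log (Fintype.card V) / p⌋₊ + 1 with hj
  obtain ⟨C, hC, hU⟩ := greedy j
  have hjlt : Real.log (Fintype.card V) < p * j := by
    have := Nat.lt_floor_add_one (Real.log (Fintype.card V) / p)
    rw [div_lt_iff₀ hp] at this
    rw [hj]
    push_cast
    linarith
  have hlt : (1 - p) ^ j * (Fintype.card V : ℝ) < 1 := by
    calc (1 - p) ^ j * (Fintype.card V : ℝ) ≤ Real.exp (-p) ^ j * Fintype.card V := by
          refine mul_le_mul_of_nonneg_right (pow_le_pow_left₀ (by linarith) ?_ j) hV.le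
          linarith [Real.add_one_le_exp (-p)]
      _ = Real.exp (-(p * j)) * Real.exp (Real.log (Fintype.card V)) := by
          rw [Real.exp_log hV, ← Real.exp_nat_mul, mul_comm p, mul_neg]
      _ = Real.exp (Real.log (Fintype.card V) - p * j) := by
          rw [← Real.exp_add]
          ring_nf
      _ < 1 := by
          rw [Real.exp_lt_one_iff]
          linarith
  refine ⟨C, fun v => ?_, ?_⟩
  · by_contra hv
    push Not at hv
    have : 1 ≤ #{v : V | ∀ w ∈ C, ¬ R w v} := card_pos.2 ⟨v, by simpa using hv⟩
    have : (1 : ℝ) ≤ (#{v : V | ∀ w ∈ C, ¬ R w v} : ℕ) := by exact_mod_cast this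
    linarith
  · have h₁ : (#C : ℝ) ≤ j := by exact_mod_cast hC
    have h₂ : (j : ℝ) ≤ Real.log (Fintype.card V) / p + 1 := by
      rw [hj]
      push_cast
      linarith [Nat.floor_le (div_nonneg hlog hp.le)]
    have h₃ : 1 ≤ 1 / p := by rwa [le_div_iff₀ hp, one_mul]
    rw [add_div]
    linarith

/-- Covering codes for a homogeneous distance with values at most `2`. -/
theorem exists_code {T : Type} [Fintype T] [Nonempty T] (δ : T → T → ℕ) (hδ : ∀ x y, δ x y ≤ 2)
    (hom : ∀ a a' : T, ∃ e : Equiv.Perm T, ∀ x, δ (e x) a' = δ x a) {r g : ℝ} (hr : 0 < r)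
    (hg : ∀ a, ∑ x, r ^ δ x a = g) (t : ℕ) :
    ∃ (c : ℕ) (C : Finset (Fin t → T)), (∀ v : Fin t → T, ∃ w ∈ C, ∑ i, δ (w i) (v i) = c) ∧
      (#C : ℝ) * g ^ t ≤
        (t * Real.log (Fintype.card T) + 1) * (2 * t + 1) * (Fintype.card T : ℝ) ^ t * r ^ c := by
  classical
  have hg₀ : 0 < g := by
    obtain ⟨a⟩ := ‹Nonempty T›
    rw [← hg a]
    exact sum_pos (fun x _ => pow_pos hr _) ⟨a, mem_univ a⟩
  let dist (w v : Fin t → T) : ℕ := ∑ i, δ (w i) (v i)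
  have hdist : ∀ w v, dist w v ∈ range (2 * t + 1) := by
    intro w v
    have : dist w v ≤ ∑ _i : Fin t, 2 := sum_le_sum fun i _ => hδ _ _
    rw [sum_const, card_univ, Fintype.card_fin, smul_eq_mul] at this
    rw [mem_range]
    omega
  -- Homogeneity in each coordinate makes the size of a sphere independent of its centre.
  have hinv : ∀ v v' : Fin t → T, ∀ c, #{w | dist w v = c} = #{w | dist w v' = c} := by
    intro v v' c
    choose e he using fun i => hom (v i) (v' i)
    refine card_equiv (Equiv.piCongrRight e) fun w => ?_
    simp [dist, he]
  obtain ⟨v₀⟩ : Nonempty (Fin t → T) := inferInstance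
  -- The distance is a sum over coordinates, so its generating function factorises.
  have hgen : ∑ w, r ^ dist w v₀ = g ^ t := by
    calc ∑ w : Fin t → T, r ^ dist w v₀ = ∑ w : Fin t → T, ∏ i, r ^ δ (w i) (v₀ i) := by
          simp only [dist, prod_pow_eq_pow_sum]
      _ = ∏ i : Fin t, ∑ x, r ^ δ x (v₀ i) := by
          rw [prod_univ_sum, Fintype.piFinset_univ]
      _ = g ^ t := by simp [hg]
  have hfib : ∑ w, r ^ dist w v₀ = ∑ c ∈ range (2 * t + 1), (#{w | dist w v₀ = c} : ℝ) * r ^ c := by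
    rw [← sum_fiberwise_of_maps_to (fun w _ => hdist w v₀)]
    refine sum_congr rfl fun c _ => ?_
    rw [sum_congr rfl (g := fun _ => r ^ c) (fun w hw => by rw [(mem_filter.1 hw).2]), sum_const,
      nsmul_eq_mul]
  -- One of the 2t + 1 possible distances carries an average share of the total weight. The radius c
  -- is thus found rather than prescribed, and codewords are required at distance exactly c.
  have hpig : ∑ _c ∈ range (2 * t + 1), g ^ t / (2 * t + 1) ≤
      ∑ c ∈ range (2 * t + 1), (#{w | dist w v₀ = c} : ℝ) * r ^ c := by
    rw [← hfib, hgen, sum_const, card_range, nsmul_eq_mul]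
    push_cast
    rw [mul_div_cancel₀ _ (by positivity)]
  obtain ⟨c, -, hc⟩ := exists_le_of_sum_le (nonempty_range_iff.2 (by omega)) hpig
  have hT : (0 : ℝ) < Fintype.card T := by exact_mod_cast Fintype.card_pos
  set p : ℝ := g ^ t / ((2 * t + 1) * r ^ c * (Fintype.card T : ℝ) ^ t) with hp
  have hp₀ : 0 < p := by positivity
  have hpc : p * (Fintype.card T : ℝ) ^ t ≤ #{w | dist w v₀ = c} := by
    have : p * (Fintype.card T : ℝ) ^ t = g ^ t / (2 * t + 1) / r ^ c := by
      rw [hp]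
      field_simp
    rw [this, div_le_iff₀ (by positivity)]
    exact hc
  have hcard : (Fintype.card (Fin t → T) : ℝ) = (Fintype.card T : ℝ) ^ t := by simp
  obtain ⟨C, hC, hCc⟩ := exists_covering (fun w v : Fin t → T => dist w v = c) hp₀ (by
      have h₁ : (#{w | dist w v₀ = c} : ℝ) ≤ (Fintype.card T : ℝ) ^ t := by
        rw [← hcard]
        exact_mod_cast card_le_univ _
      exact le_of_mul_le_mul_right (by linarith) (pow_pos hT t)) (fun v S hS => by
      have : S = ({w | dist w v = c} : Finset (Fin t → T)) := by ext w; simp [hS]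
      rw [hcard, this, hinv v v₀]
      exact hpc)
  refine ⟨c, C, hC, ?_⟩
  rw [hcard, Real.log_pow, le_div_iff₀ hp₀, hp, mul_div_assoc', div_le_iff₀ (by positivity)] at hCc
  linarith

end Covering

end CSP

/-! ### The local search procedure and the outcome of a scan -/

namespace CSP

/-- A mark `(i, j)` stands for the `j`-th free variable of the `i`-th collected constraint. -/
abbrev Mark (t κ : ℕ) : Type := Fin (t + 1) × Fin (κ + 2)

/-- A cell of the array of the local search: the value of a variable, whether it has been fixed, and
possibly a mark. -/
@[ext]
structure Cell (e t κ : ℕ) where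
  /-- the value of the variable -/
  val : Fin (e + 1)
  /-- whether the value is fixed -/
  fixed : Bool
  /-- the mark -/
  mark : Option (Mark t κ)

noncomputable instance {e t κ : ℕ} : Fintype (Cell e t κ) :=
  Fintype.ofInjective (fun x => (x.val, x.fixed, x.mark))
    (by intro v w h; simp only [Prod.mk.injEq] at h; ext1 <;> tauto)

instance {e t κ : ℕ} : Inhabited (Cell e t κ) := ⟨⟨0, false, none⟩⟩

/-- The state of the local search. -/
@[ext]
structure SearchState (A R t κ : ℕ) where
  /-- the current letter of the advice -/
  ltr : Fin (A + 1)
  /-- the number of scans done for this letter -/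
  idx : Fin (R + 1)
  /-- whether the search has entered the phase in which it fixes variables -/
  phase : Bool
  /-- the number of collected constraints -/
  cnt : Fin (t + 1)
  /-- the number of marked variables of the current constraint -/
  pos : Fin (κ + 2)
  /-- whether the current constraint can still be collected -/
  ok : Bool

noncomputable instance {A R t κ : ℕ} : Fintype (SearchState A R t κ) :=
  Fintype.ofInjective (fun x => (x.ltr, x.idx, x.phase, x.cnt, x.pos, x.ok))
    (by intro v w h; simp only [Prod.mk.injEq] at h; ext1 <;> tauto)

/-- An operation on the marked variables. -/
inductive Op (e t κ : ℕ) : Type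
  /-- in the first phase: if `t` constraints have been collected, change marked variables according
  to `f`, otherwise fix all marked variables to the values `β` and enter the second phase -/
  | main (f : Mark t κ → Option (Fin e)) (β : Mark t κ → Fin (e + 1))
  /-- in the second phase: change and fix marked variables according to `f` -/
  | branch (f : Mark t κ → Option (Fin e))

namespace Op

variable {e t κ : ℕ}

/-- The phase after an operation. -/
def nextPhase (o : Op e t κ) (phase : Bool) (c : ℕ) : Bool :=
  match o with
  | main _ _ => phase || decide (c < t)
  | branch _ => phase

/-- The effect of an operation on a cell. -/
def apply (o : Op e t κ) (phase : Bool) (c : ℕ) (x : Cell e t κ) : Cell e t κ :=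
  match x.mark with
  | none => x
  | some μ =>
    match o, phase with
    | main f β, false =>
      if c < t then ⟨β μ, true, none⟩
      else ⟨(f μ).elim x.val x.val.succAbove, x.fixed, none⟩
    | branch f, true => (f μ).elim ⟨x.val, x.fixed, none⟩ fun v => ⟨x.val.succAbove v, true, none⟩
    | _, _ => ⟨x.val, x.fixed, none⟩

end Op

/-- The local search with given initial values and operations for each letter of the advice. -/
def localSearch {e t κ A R b : ℕ} (init : Fin (A + 1) → Fin b → Fin (e + 1))
    (op : Fin (A + 1) → ℕ → Op e t κ) : Procedure (SearchState A R t κ) (Cell e t κ) A b where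
  rounds := R
  init w j := ⟨init w j, false, none⟩
  start := ⟨0, 0, false, 0, 0, true⟩
  letter s w := { s with ltr := w, idx := 0 }
  -- A constraint stays collectible as long as its literals are false and meet no mark, and fewer
  -- than t constraints have been collected. A false literal on a fixed variable is passed over
  -- without a mark.
  lit s c x :=
    if s.ok = true ∧ (s.cnt : ℕ) < t ∧ (x.val : ℕ) = c ∧ x.mark = none then
      if x.fixed = true then (s, x)
      else ({ s with pos := Fin.ofNat (κ + 2) (s.pos + 1) }, { x with mark := some (s.cnt, s.pos) })
    else ({ s with ok := false }, x)
  closeState s :=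
    if s.ok = true ∧ (s.cnt : ℕ) < t then
      { s with cnt := Fin.ofNat (t + 1) (s.cnt + 1), pos := 0, ok := true }
    else { s with pos := 0, ok := true }
  -- The marks of an abandoned constraint carry the current count, which no collected constraint
  -- has, so they can be recognised and erased.
  closeCell s x :=
    if s.ok = true then x
    else if x.mark.map Prod.fst = some s.cnt then { x with mark := none } else x
  endState s :=
    { s with
      idx := Fin.ofNat (R + 1) (s.idx + 1)
      phase := (op s.ltr s.idx).nextPhase s.phase s.cnt
      cnt := 0, pos := 0, ok := true }
  endCell s x := (op s.ltr s.idx).apply s.phase s.cnt x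
  accept s := (s.cnt : ℕ) == 0

section Scan

variable {e t κ A R b N : ℕ} (init : Fin (A + 1) → Fin b → Fin (e + 1))
  (op : Fin (A + 1) → ℕ → Op e t κ)

/-- All literals of the constraint `C` are false for the values in `x`. -/
def Falsified (x : Fin N → Cell e t κ) (C : List (Literal (e + 1) N)) : Prop :=
  ∀ u ∈ C, (x u.1).val = u.2

/-- The variables of a constraint that are not fixed. -/
def freeVars (x : Fin N → Cell e t κ) (C : List (Literal (e + 1) N)) : List (Fin N) :=
  (C.filter fun u => !(x u.1).fixed).map Prod.fst

/-- `y` arises from `x` by marking the free variables of the constraints `G`. -/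
structure Marked (x : Fin N → Cell e t κ) (G : List (List (Literal (e + 1) N)))
    (y : Fin N → Cell e t κ) : Prop where
  val : ∀ p, (y p).val = (x p).val
  fixed : ∀ p, (y p).fixed = (x p).fixed
  mark : ∀ p (μ : Mark t κ), (y p).mark = some μ ↔
    ∃ C, G[(μ.1 : ℕ)]? = some C ∧ (freeVars x C)[(μ.2 : ℕ)]? = some p

theorem length_freeVars_le (x : Fin N → Cell e t κ) (C : List (Literal (e + 1) N)) :
    (freeVars x C).length ≤ C.length := by
  rw [freeVars, List.length_map]
  exact List.length_filter_le _ _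

theorem mem_freeVars {x : Fin N → Cell e t κ} {C : List (Literal (e + 1) N)}
    {u : Literal (e + 1) N} (hu : u ∈ C) (h : (x u.1).fixed = false) : u.1 ∈ freeVars x C := by
  rw [freeVars, List.mem_map]
  exact ⟨u, by simp [hu, h], rfl⟩

variable {x y : Fin N → Cell e t κ} {G : List (List (Literal (e + 1) N))}

theorem Marked.mark_injective (h : Marked x G y) {p p' : Fin N} {μ : Mark t κ}
    (hp : (y p).mark = some μ) (hp' : (y p').mark = some μ) : p = p' := by
  obtain ⟨C, h₁, h₂⟩ := (h.mark p μ).1 hp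
  obtain ⟨C', h₁', h₂'⟩ := (h.mark p' μ).1 hp'
  rw [h₁] at h₁'
  cases h₁'
  rw [h₂] at h₂'
  exact Option.some.inj h₂'

theorem Marked.not_fixed (h : Marked x G y) {p : Fin N} (hp : (y p).mark ≠ none) :
    (x p).fixed = false := by
  obtain ⟨μ, hμ⟩ := Option.ne_none_iff_exists'.1 hp
  obtain ⟨C, -, h₂⟩ := (h.mark p μ).1 hμ
  obtain ⟨u, hu, rfl⟩ := List.mem_map.1 (List.mem_of_getElem? h₂)
  simpa using (List.mem_filter.1 hu).2

/-- The state of the search after some literals of a constraint, `G` being the constraints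
collected before. -/
def PartialSpec (x y : Fin N → Cell e t κ) (G : List (List (Literal (e + 1) N)))
    (C : List (Literal (e + 1) N)) (s : SearchState A R t κ)
    (r : SearchState A R t κ × (Fin N → Cell e t κ)) : Prop :=
  (r.1 = { s with pos := Fin.ofNat (κ + 2) (freeVars x C).length, ok := true } ∧ G.length < t ∧
    Falsified x C ∧ (∀ u ∈ C, (y u.1).mark = none) ∧ Marked x (G ++ [C]) r.2) ∨
  ((∃ j, r.1 = { s with pos := j, ok := false }) ∧
    (G.length = t ∨ ¬ Falsified x C ∨ ∃ u ∈ C, (y u.1).mark ≠ none) ∧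
    ∀ p, r.2 p = y p ∨ (y p).mark = none ∧ ∃ j, r.2 p = { y p with mark := some (s.cnt, j) })

theorem litStep_ok {s : SearchState A R t κ} {y : Fin N → Cell e t κ} {u : Literal (e + 1) N}
    (h : s.ok = true ∧ (s.cnt : ℕ) < t ∧ (y u.1).val = u.2 ∧ (y u.1).mark = none) :
    (localSearch (R := R) init op).litStep (s, y) u =
      if (y u.1).fixed = true then (s, y) else
        ({ s with pos := Fin.ofNat (κ + 2) (s.pos + 1) },
          Function.update y u.1 { y u.1 with mark := some (s.cnt, s.pos) }) := by
  have h' : s.ok = true ∧ (s.cnt : ℕ) < t ∧ ((y u.1).val : ℕ) = u.2 ∧ (y u.1).mark = none :=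
    ⟨h.1, h.2.1, congrArg Fin.val h.2.2.1, h.2.2.2⟩
  simp only [Procedure.litStep, localSearch, if_pos h']
  split <;> simp

theorem litStep_not_ok {s : SearchState A R t κ} {y : Fin N → Cell e t κ} {u : Literal (e + 1) N}
    (h : ¬ (s.ok = true ∧ (s.cnt : ℕ) < t ∧ (y u.1).val = u.2 ∧ (y u.1).mark = none)) :
    (localSearch (R := R) init op).litStep (s, y) u = ({ s with ok := false }, y) := by
  have h' : ¬ (s.ok = true ∧ (s.cnt : ℕ) < t ∧ ((y u.1).val : ℕ) = u.2 ∧ (y u.1).mark = none) :=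
    fun h' => h ⟨h'.1, h'.2.1, Fin.ext h'.2.2.1, h'.2.2.2⟩
  simp [Procedure.litStep, localSearch, if_neg h']

/-- The delicate point is that a falsified constraint never stumbles over its own marks. Two
different literals on the same variable forbid different values, and at most one of these is the
current value. A mark met while all literals are false is therefore left by an earlier constraint.
-/
theorem foldl_litStep {s : SearchState A R t κ} (hs : s.ok = true) (hs' : s.pos = 0)
    (hc : (s.cnt : ℕ) = G.length) (hG : G.length < t) (hy : Marked x G y)
    (C : List (Literal (e + 1) N)) (hC : C.Nodup) (hk : C.length ≤ κ + 1) :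
    PartialSpec x y G C s (C.foldl (localSearch (R := R) init op).litStep (s, y)) := by
  induction C using List.reverseRecOn with
  | nil =>
    refine Or.inl ⟨?_, hG, by simp [Falsified], by simp, hy.val, hy.fixed, fun p μ => ?_⟩
    · ext <;> simp [hs, hs', freeVars]
    · rw [List.foldl_nil, hy.mark]
      constructor
      · rintro ⟨C, h₁, h₂⟩
        exact ⟨C, by rw [List.getElem?_append_left (List.getElem?_eq_some_iff.1 h₁).1, h₁], h₂⟩
      · rintro ⟨C, h₁, h₂⟩
        rcases Nat.lt_or_ge (μ.1 : ℕ) G.length with h | h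
        · exact ⟨C, by rwa [List.getElem?_append_left h] at h₁, h₂⟩
        · rw [List.getElem?_append_right h, List.getElem?_singleton] at h₁
          split at h₁
          · cases h₁
            simp [freeVars] at h₂
          · cases h₁
  | append_singleton C u ih =>
    rw [List.nodup_append] at hC
    rw [List.length_append, List.length_singleton] at hk
    rw [List.foldl_append, List.foldl_cons, List.foldl_nil]
    set r := C.foldl (localSearch (R := R) init op).litStep (s, y) with hr
    have hfal : ¬ Falsified x C → ¬ Falsified x (C ++ [u]) := fun h h' =>
      h fun v hv => h' v (List.mem_append_left _ hv)
    rcases ih hC.1 (by omega) with ⟨h₁, h₂, h₃, h₄, h₅⟩ | ⟨⟨j, h₁⟩, h₂, h₃⟩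
    · have hr₁ : r = (r.1, r.2) := rfl
      have hrc : r.1.cnt = s.cnt := by rw [h₁]
      have hrp : r.1.pos = Fin.ofNat (κ + 2) (freeVars x C).length := by rw [h₁]
      have hlen : (freeVars x C).length < κ + 2 := by
        have := length_freeVars_le x C
        omega
      by_cases hu : (r.2 u.1).val = u.2 ∧ (r.2 u.1).mark = none
      · rw [hr₁, litStep_ok init op ⟨by rw [h₁], by rw [hrc, hc]; exact hG, hu.1, hu.2⟩]
        have hu₁ : (x u.1).val = u.2 := by rw [← h₅.val]; exact hu.1
        have hfal' : Falsified x (C ++ [u]) := by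
          intro v hv
          rcases List.mem_append.1 hv with hv | hv
          · exact h₃ v hv
          · rw [List.mem_singleton.1 hv]; exact hu₁
        have hunm : (y u.1).mark = none := by
          by_contra hne
          obtain ⟨μ, hμ⟩ := Option.ne_none_iff_exists'.1 hne
          obtain ⟨D, hD, hD'⟩ := (hy.mark u.1 μ).1 hμ
          have := (h₅.mark u.1 μ).2
            ⟨D, by rw [List.getElem?_append_left (List.getElem?_eq_some_iff.1 hD).1, hD], hD'⟩
          rw [hu.2] at this
          cases this
        have hmark' : ∀ v ∈ C ++ [u], (y v.1).mark = none := by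
          intro v hv
          rcases List.mem_append.1 hv with hv | hv
          · exact h₄ v hv
          · rw [List.mem_singleton.1 hv]; exact hunm
        by_cases hfix : (r.2 u.1).fixed = true
        · rw [if_pos hfix]
          have hx : (x u.1).fixed = true := by rw [← h₅.fixed]; exact hfix
          have hfree : freeVars x (C ++ [u]) = freeVars x C := by simp [freeVars, hx]
          refine Or.inl ⟨by rw [hfree]; exact h₁, h₂, hfal', hmark', h₅.val, h₅.fixed,
            fun p μ => ?_⟩
          rw [h₅.mark]
          rcases Nat.lt_or_ge (μ.1 : ℕ) G.length with h | h
          · simp only [List.getElem?_append_left h]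
          · simp only [List.getElem?_append_right h, List.getElem?_singleton]
            split <;> simp [hfree]
        · rw [if_neg hfix]
          have hx : (x u.1).fixed = false := by
            rw [← h₅.fixed]; exact Bool.not_eq_true _ ▸ hfix
          have hfree : freeVars x (C ++ [u]) = freeVars x C ++ [u.1] := by simp [freeVars, hx]
          have hpos : (r.1.pos : ℕ) = (freeVars x C).length := by
            rw [hrp, Fin.val_ofNat, Nat.mod_eq_of_lt hlen]
          refine Or.inl ⟨?_, h₂, hfal', hmark', ?_, ?_, fun p μ => ?_⟩
          · simp only [hpos]
            rw [h₁, hfree]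
            simp
          · intro p
            by_cases hp : p = u.1
            · subst hp; simp [h₅.val]
            · simp [Function.update_of_ne hp, h₅.val]
          · intro p
            by_cases hp : p = u.1
            · subst hp; simp [h₅.fixed]
            · simp [Function.update_of_ne hp, h₅.fixed]
          · have hold := h₅.mark p μ
            have hold' : ∀ ν : Mark t κ, (∃ D, (G ++ [C])[(ν.1 : ℕ)]? = some D ∧
                (freeVars x D)[(ν.2 : ℕ)]? = some u.1) → False := by
              intro ν h
              have := (h₅.mark u.1 ν).2 h
              rw [hu.2] at this
              cases this
            have hcar : (r.1.cnt : ℕ) = G.length := by rw [hrc, hc]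
            by_cases hp : p = u.1
            · subst hp
              simp only [Function.update_self, Option.some.injEq]
              constructor
              · rintro rfl
                refine ⟨C ++ [u], ?_, ?_⟩
                · rw [List.getElem?_append_right (by rw [hcar]), hcar]
                  simp
                · simp only [hpos]
                  rw [hfree]
                  simp
              · rintro ⟨D, hD, hD'⟩
                rcases Nat.lt_or_ge (μ.1 : ℕ) G.length with h | h
                · rw [List.getElem?_append_left h] at hD
                  exact (hold' μ ⟨D, by rw [List.getElem?_append_left h, hD], hD'⟩).elim
                · rw [List.getElem?_append_right h, List.getElem?_singleton] at hD
                  split at hD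
                  · rename_i h0
                    cases hD
                    have hcnt : (μ.1 : ℕ) = G.length := by omega
                    rw [hfree] at hD'
                    rcases Nat.lt_or_ge (μ.2 : ℕ) (freeVars x C).length with h' | h'
                    · rw [List.getElem?_append_left h'] at hD'
                      exact (hold' μ ⟨C, by rw [List.getElem?_append_right h, hcnt]; simp, hD'⟩).elim
                    · rw [List.getElem?_append_right h', List.getElem?_singleton] at hD'
                      split at hD'
                      · refine Prod.ext (Fin.ext ?_) (Fin.ext ?_)
                        · simp only; omega
                        · simp only; omega
                      · cases hD'
                  · cases hD
            · simp only [Function.update_of_ne hp]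
              rw [hold]
              rcases Nat.lt_or_ge (μ.1 : ℕ) G.length with h | h
              · simp only [List.getElem?_append_left h]
              · simp only [List.getElem?_append_right h, List.getElem?_singleton]
                split
                · simp only [Option.some.injEq, exists_eq_left', hfree]
                  rcases Nat.lt_or_ge (μ.2 : ℕ) (freeVars x C).length with h' | h'
                  · rw [List.getElem?_append_left h']
                  · rw [List.getElem?_append_right h', List.getElem?_singleton,
                      List.getElem?_eq_none h']
                    split
                    · simp [Ne.symm hp]
                    · simp
                · simp
      · rw [hr₁, litStep_not_ok init op fun h => hu ⟨h.2.2.1, h.2.2.2⟩]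
        refine Or.inr ⟨⟨Fin.ofNat (κ + 2) (freeVars x C).length, by rw [h₁]⟩, ?_, fun p => ?_⟩
        · by_cases hv : (x u.1).val = u.2
          · right
            right
            refine ⟨u, by simp, fun hne => hu ⟨by rw [h₅.val, hv], ?_⟩⟩
            by_contra hm
            obtain ⟨μ, hμ⟩ := Option.ne_none_iff_exists'.1 hm
            obtain ⟨D, hD, hD'⟩ := (h₅.mark u.1 μ).1 hμ
            rcases Nat.lt_or_ge (μ.1 : ℕ) G.length with h | h
            · have := (hy.mark u.1 μ).2 ⟨D, by rwa [List.getElem?_append_left h] at hD, hD'⟩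
              rw [hne] at this
              cases this
            · rw [List.getElem?_append_right h, List.getElem?_singleton] at hD
              split at hD
              · cases hD
                -- The mark would stem from an earlier literal v of the same constraint. Both
                -- literals are false and have the same variable, so they coincide, against the
                -- absence of repetitions.
                obtain ⟨v, hv', hvu⟩ := List.mem_map.1 (List.mem_of_getElem? hD')
                have hvC := (List.mem_filter.1 hv').1
                refine hC.2.2 v hvC u (by simp) (Prod.ext hvu ?_)
                rw [← h₃ v hvC, ← hv, hvu]
              · cases hD
          · exact Or.inr (Or.inl fun h => hv (h u (by simp)))
        · have hm : (r.2 p).val = (y p).val ∧ (r.2 p).fixed = (y p).fixed :=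
            ⟨by rw [h₅.val, hy.val], by rw [h₅.fixed, hy.fixed]⟩
          rcases hrm : (r.2 p).mark with _ | μ
          · left
            refine Cell.ext hm.1 hm.2 ?_
            rw [hrm]
            by_contra hne
            obtain ⟨μ, hμ⟩ := Option.ne_none_iff_exists'.1 (Ne.symm hne)
            obtain ⟨D, hD, hD'⟩ := (hy.mark p μ).1 hμ
            have := (h₅.mark p μ).2
              ⟨D, by rw [List.getElem?_append_left (List.getElem?_eq_some_iff.1 hD).1, hD], hD'⟩
            rw [hrm] at this
            cases this
          · obtain ⟨D, hD, hD'⟩ := (h₅.mark p μ).1 hrm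
            rcases Nat.lt_or_ge (μ.1 : ℕ) G.length with h | h
            · left
              refine Cell.ext hm.1 hm.2 ?_
              rw [hrm, (hy.mark p μ).2 ⟨D, by rwa [List.getElem?_append_left h] at hD, hD'⟩]
            · right
              rw [List.getElem?_append_right h, List.getElem?_singleton] at hD
              split at hD
              · cases hD
                obtain ⟨v, hv', hvu⟩ := List.mem_map.1 (List.mem_of_getElem? hD')
                refine ⟨by rw [← hvu]; exact h₄ v (List.mem_filter.1 hv').1, μ.2, ?_⟩
                refine Cell.ext hm.1 hm.2 ?_
                simp only [hrm]
                congr 1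
                exact Prod.ext (Fin.ext (by simp only; omega)) rfl
              · cases hD
    · have hr₁ : r = (r.1, r.2) := rfl
      rw [hr₁, litStep_not_ok init op (by rw [h₁]; simp)]
      refine Or.inr ⟨⟨j, by rw [h₁]⟩, ?_, h₃⟩
      rcases h₂ with h | h | ⟨v, hv, h⟩
      · exact Or.inl h
      · exact Or.inr (Or.inl (hfal h))
      · exact Or.inr (Or.inr ⟨v, List.mem_append_left _ hv, h⟩)

theorem foldl_litStep_full {s : SearchState A R t κ} (hs : (s.cnt : ℕ) = t)
    (C : List (Literal (e + 1) N)) :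
    ∃ o, C.foldl (localSearch (R := R) init op).litStep (s, y) = ({ s with ok := o }, y) := by
  induction C generalizing s with
  | nil => exact ⟨s.ok, rfl⟩
  | cons u C ih =>
    obtain ⟨o, h⟩ := ih (s := { s with ok := false }) hs
    refine ⟨o, ?_⟩
    rw [List.foldl_cons, litStep_not_ok init op (by omega), h]

theorem closeStep_collect {s : SearchState A R t κ} (h : s.ok = true ∧ (s.cnt : ℕ) < t) :
    (localSearch (R := R) init op).closeStep (s, y) =
      ({ s with cnt := Fin.ofNat (t + 1) (s.cnt + 1), pos := 0, ok := true }, y) := by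
  simp only [Procedure.closeStep, localSearch, if_pos h, if_pos h.1]

theorem closeStep_skip {s : SearchState A R t κ} (h : ¬ (s.ok = true ∧ (s.cnt : ℕ) < t)) :
    (localSearch (R := R) init op).closeStep (s, y) = ({ s with pos := 0, ok := true }, fun p =>
      if s.ok = true then y p
      else if (y p).mark.map Prod.fst = some s.cnt then { y p with mark := none } else y p) := by
  simp only [Procedure.closeStep, localSearch, if_neg h]

theorem Marked.fst_ne (hy : Marked x G y) {i : Fin (t + 1)} (hi : (i : ℕ) = G.length) (p : Fin N) :
    (y p).mark.map Prod.fst ≠ some i := by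
  intro hm
  obtain ⟨μ, hμ, hμ'⟩ := Option.map_eq_some_iff.1 hm
  obtain ⟨D, hD, -⟩ := (hy.mark p μ).1 hμ
  have := (List.getElem?_eq_some_iff.1 hD).1
  rw [hμ', hi] at this
  exact lt_irrefl _ this

/-- An abandoned attempt has changed only unmarked cells, giving them the index `G.length`, which no
collected constraint uses. Erasing that index restores `y` exactly. -/
theorem constraintStep_spec {s : SearchState A R t κ} (hs : s.ok = true) (hs' : s.pos = 0)
    (hc : (s.cnt : ℕ) = G.length) (hG : G.length ≤ t) (hy : Marked x G y)
    {C : List (Literal (e + 1) N)} (hC : C.Nodup) (hk : C.length ≤ κ + 1) :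
    ∃ G' y', (localSearch (R := R) init op).constraintStep (s, y) C =
        ({ s with cnt := Fin.ofNat (t + 1) G'.length }, y') ∧ G'.length ≤ t ∧ Marked x G' y' ∧
      (G' = G ++ [C] ∧ Falsified x C ∨ G' = G ∧
        (G.length = t ∨ ¬ Falsified x C ∨ ∃ u ∈ C, (y u.1).mark ≠ none)) := by
  have hcnt : Fin.ofNat (t + 1) G.length = s.cnt := by
    ext
    rw [Fin.val_ofNat, Nat.mod_eq_of_lt (by omega), hc]
  rcases hG.lt_or_eq with hlt | heq
  · rw [Procedure.constraintStep]
    have hfold := foldl_litStep (R := R) init op hs hs' hc hlt hy C hC hk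
    generalize C.foldl (localSearch (R := R) init op).litStep (s, y) = r at hfold
    obtain ⟨r₁, r₂⟩ := r
    rcases hfold with ⟨h₁, h₂, h₃, h₄, h₅⟩ | ⟨⟨j, h₁⟩, h₂, h₃⟩
    · simp only at h₁
      subst h₁
      refine ⟨G ++ [C], r₂, ?_, by simpa using hlt, h₅, Or.inl ⟨rfl, h₃⟩⟩
      rw [closeStep_collect init op ⟨rfl, by simpa only [hc] using hlt⟩, List.length_append,
        List.length_singleton, ← hc]
      exact Prod.ext (SearchState.ext rfl rfl rfl rfl hs'.symm hs.symm) rfl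
    · simp only at h₁
      subst h₁
      refine ⟨G, y, ?_, hG, hy, Or.inr ⟨rfl, h₂⟩⟩
      rw [closeStep_skip init op (by simp)]
      refine Prod.ext (SearchState.ext rfl rfl rfl hcnt.symm hs'.symm hs.symm) (funext fun p => ?_)
      simp only [Bool.false_eq_true, if_false]
      rcases h₃ p with h | ⟨hn, j', h⟩
      · simp only at h
        rw [h, if_neg (hy.fst_ne hc p)]
      · simp only at h
        rw [h]
        refine (if_pos rfl).trans ?_
        exact Cell.ext rfl rfl hn.symm
  · obtain ⟨o, ho⟩ := foldl_litStep_full (R := R) (y := y) init op (s := s) (by omega) C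
    refine ⟨G, y, ?_, hG, hy, Or.inr ⟨rfl, Or.inl heq⟩⟩
    rw [Procedure.constraintStep, ho, closeStep_skip init op (by simp only; omega)]
    refine Prod.ext (SearchState.ext rfl rfl rfl hcnt.symm hs'.symm hs.symm) (funext fun p => ?_)
    simp only
    rw [if_neg (hy.fst_ne hc p), ite_self]

theorem Marked.append (hy : Marked x G y) {y' : Fin N → Cell e t κ}
    {G' : List (List (Literal (e + 1) N))} (hy' : Marked x (G ++ G') y') {p : Fin N}
    (hp : (y p).mark ≠ none) : (y' p).mark ≠ none := by
  obtain ⟨μ, hμ⟩ := Option.ne_none_iff_exists'.1 hp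
  obtain ⟨D, hD, hD'⟩ := (hy.mark p μ).1 hμ
  rw [(hy'.mark p μ).2
    ⟨D, by rw [List.getElem?_append_left (List.getElem?_eq_some_iff.1 hD).1, hD], hD'⟩]
  simp

/-- Marks of collected constraints persist, so a constraint skipped because of a marked variable
still meets a mark at the end, and a full collection stays full. The collection G made so far is
kept general for the induction. -/
theorem scan_aux (L : List (List (Literal (e + 1) N)))
    (hL : ∀ C ∈ L, C.Nodup ∧ C.length ≤ κ + 1) {s : SearchState A R t κ} (hs : s.ok = true)
    (hs' : s.pos = 0) (hc : (s.cnt : ℕ) = G.length) (hG : G.length ≤ t) (hy : Marked x G y) :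
    ∃ G' y', (localSearch (R := R) init op).scan L (s, y) =
        ({ s with cnt := Fin.ofNat (t + 1) (G ++ G').length }, y') ∧ (G ++ G').length ≤ t ∧
      Marked x (G ++ G') y' ∧ (∀ C ∈ G', C ∈ L ∧ Falsified x C) ∧
      ∀ C ∈ L, Falsified x C → (G ++ G').length = t ∨ C ∈ G' ∨ ∃ u ∈ C, (y' u.1).mark ≠ none := by
  induction L generalizing G s y with
  | nil =>
    refine ⟨[], y, ?_, by simpa using hG, by simpa using hy, by simp, by simp⟩
    refine Prod.ext (SearchState.ext rfl rfl rfl (Fin.ext ?_) rfl rfl) rfl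
    simp [Procedure.scan, hc, Nat.mod_eq_of_lt (Nat.lt_succ_of_le hG)]
  | cons C L ih =>
    obtain ⟨G₁, y₁, h₁, h₂, h₃, h₄⟩ := constraintStep_spec (R := R) init op hs hs' hc hG hy
      (hL C (by simp)).1 (hL C (by simp)).2
    obtain ⟨G₂, y₂, h₅, h₆, h₇, h₈, h₉⟩ := ih (fun D hD => hL D (List.mem_cons_of_mem _ hD))
      (s := { s with cnt := Fin.ofNat (t + 1) G₁.length }) hs hs'
      (by simp [Nat.mod_eq_of_lt (Nat.lt_succ_of_le h₂)]) h₂ h₃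
    have hscan : (localSearch (R := R) init op).scan (C :: L) (s, y) =
        ({ s with cnt := Fin.ofNat (t + 1) (G₁ ++ G₂).length }, y₂) := by
      rw [Procedure.scan, List.foldl_cons, h₁]
      exact h₅
    rcases h₄ with ⟨rfl, hf⟩ | ⟨rfl, hf⟩
    · refine ⟨C :: G₂, y₂, ?_⟩
      rw [List.append_assoc] at hscan h₆ h₇ h₉
      refine ⟨hscan, h₆, h₇, ?_, ?_⟩
      · intro D hD
        rcases List.mem_cons.1 hD with rfl | hD
        · exact ⟨by simp, hf⟩
        · exact ⟨List.mem_cons_of_mem _ (h₈ D hD).1, (h₈ D hD).2⟩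
      · intro D hD hDf
        rcases List.mem_cons.1 hD with rfl | hD
        · exact Or.inr (Or.inl (by simp))
        · rcases h₉ D hD hDf with h | h | h
          · exact Or.inl h
          · exact Or.inr (Or.inl (List.mem_cons_of_mem _ h))
          · exact Or.inr (Or.inr h)
    · refine ⟨G₂, y₂, hscan, h₆, h₇, fun D hD => ⟨List.mem_cons_of_mem _ (h₈ D hD).1, (h₈ D hD).2⟩,
        ?_⟩
      intro D hD hDf
      rcases List.mem_cons.1 hD with rfl | hD
      · rcases hf with h | h | ⟨u, hu, h⟩
        · left
          rw [List.length_append] at h₆ ⊢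
          omega
        · exact (h hDf).elim
        · exact Or.inr (Or.inr ⟨u, hu, hy.append h₇ h⟩)
      · exact h₉ D hD hDf

/-- What a scan finds: constraints that are falsified, at most `t` of them, and if fewer than `t`,
then every falsified constraint is among them or shares a variable with them. -/
theorem scan_spec (L : List (List (Literal (e + 1) N)))
    (hL : ∀ C ∈ L, C.Nodup ∧ C.length ≤ κ + 1) {s : SearchState A R t κ} (hs : s.ok = true)
    (hs' : s.pos = 0) (hc : s.cnt = 0) (hx : ∀ p, (x p).mark = none) :
    ∃ G y, (localSearch (R := R) init op).scan L (s, x) =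
        ({ s with cnt := Fin.ofNat (t + 1) G.length }, y) ∧ G.length ≤ t ∧
      Marked x G y ∧ (∀ C ∈ G, C ∈ L ∧ Falsified x C) ∧
      ∀ C ∈ L, Falsified x C → G.length = t ∨ C ∈ G ∨ ∃ u ∈ C, (y u.1).mark ≠ none := by
  obtain ⟨G, y, h⟩ := scan_aux (R := R) init op (G := []) (x := x) (y := x) L hL hs hs'
    (by simp [hc]) (by simp) ⟨fun _ => rfl, fun _ => rfl, fun p μ => by simp [hx]⟩
  exact ⟨G, y, h⟩

end Scan

end CSP

/-! ### The two phases of the search and the progress of one operation -/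

namespace CSP

open Finset

section Steps

variable {e t κ A R b N : ℕ} (init : Fin (A + 1) → Fin b → Fin (e + 1))
  (op : Fin (A + 1) → ℕ → Op e t κ) (L : List (List (Literal (e + 1) N)))

theorem Op.mark_apply (o : Op e t κ) (phase : Bool) (c : ℕ) (x : Cell e t κ) :
    (o.apply phase c x).mark = none := by
  rw [Op.apply]
  split
  · assumption
  · cases o with
    | main f β =>
      cases phase
      · simp only
        split <;> rfl
      · rfl
    | branch f =>
      cases phase
      · rfl
      · rename_i μ _
        simp only
        cases f μ <;> rfl

/-- Overwrite the parts of the state that a scan does not use. -/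
def overwrite (s' : SearchState A R t κ)
    (r : SearchState A R t κ × (Fin N → Cell e t κ)) : SearchState A R t κ × (Fin N → Cell e t κ) :=
  ({ r.1 with ltr := s'.ltr, idx := s'.idx, phase := s'.phase }, r.2)

theorem litStep_overwrite (s' : SearchState A R t κ) (r : SearchState A R t κ × (Fin N → Cell e t κ))
    (u : Literal (e + 1) N) :
    (localSearch init op).litStep (overwrite s' r) u =
      overwrite s' ((localSearch init op).litStep r u) := by
  simp only [Procedure.litStep, localSearch, overwrite]
  split <;> [split; skip] <;> rfl

theorem closeStep_overwrite (s' : SearchState A R t κ)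
    (r : SearchState A R t κ × (Fin N → Cell e t κ)) :
    (localSearch init op).closeStep (overwrite s' r) =
      overwrite s' ((localSearch init op).closeStep r) := by
  simp only [Procedure.closeStep, localSearch, overwrite]
  split <;> rfl

/-- A scan ignores the letter, the scan number and the phase, so its effect can be computed from the
start state. This frees the analysis of `opStep` from bookkeeping. -/
theorem scan_overwrite (s' : SearchState A R t κ) (r : SearchState A R t κ × (Fin N → Cell e t κ)) :
    (localSearch init op).scan L (overwrite s' r) =
      overwrite s' ((localSearch init op).scan L r) := by
  refine List.foldl_hom _ fun r C => ?_
  rw [Procedure.constraintStep, Procedure.constraintStep, ← closeStep_overwrite]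
  congr 1
  exact List.foldl_hom _ fun r u => litStep_overwrite init op s' r u

/-- The state at the start of a scan. -/
def SearchState.Clean (s : SearchState A R t κ) : Prop := s.cnt = 0 ∧ s.pos = 0 ∧ s.ok = true

/-- Scan the formula and perform an operation. -/
def opStep (r : Bool × (Fin N → Cell e t κ)) (o : Op e t κ) : Bool × (Fin N → Cell e t κ) :=
  let r' := (localSearch (R := R) init op).scan L ((localSearch (R := R) init op).start, r.2)
  (o.nextPhase r.1 r'.1.cnt, fun p => o.apply r.1 r'.1.cnt (r'.2 p))

theorem scan_clean {s : SearchState A R t κ} (hs : s.Clean) (x : Fin N → Cell e t κ) :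
    (localSearch init op).scan L (s, x) =
      overwrite s ((localSearch init op).scan L ((localSearch (R := R) init op).start, x)) := by
  rw [← scan_overwrite]
  congr 1
  exact Prod.ext (SearchState.ext rfl rfl rfl hs.1 hs.2.1 hs.2.2) rfl

theorem round_eq {s : SearchState A R t κ} (hs : s.Clean) (x : Fin N → Cell e t κ) :
    (localSearch init op).round L (s, x) =
      ({ s with
          idx := Fin.ofNat (R + 1) (s.idx + 1)
          phase := (opStep (R := R) init op L (s.phase, x) (op s.ltr s.idx)).1 },
        (opStep (R := R) init op L (s.phase, x) (op s.ltr s.idx)).2) := by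
  rw [Procedure.round, scan_clean init op L hs]
  exact Prod.ext (SearchState.ext rfl rfl rfl hs.1.symm hs.2.1.symm hs.2.2.symm) rfl

/-- The effect of a letter on phase and array. -/
def letterRun (r : Bool × (Fin N → Cell e t κ)) (a : Fin (A + 1)) : Bool × (Fin N → Cell e t κ) :=
  ((List.range R).map (op a)).foldl (opStep (R := R) init op L) r

theorem iterate_round_eq {s : SearchState A R t κ} (hs : s.Clean) (hs' : s.idx = 0)
    (x : Fin N → Cell e t κ) {i : ℕ} (hi : i ≤ R) :
    let r := ((List.range i).map (op s.ltr)).foldl (opStep (R := R) init op L) (s.phase, x)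
    ((localSearch init op).round L)^[i] (s, x) =
      ({ s with idx := Fin.ofNat (R + 1) i, phase := r.1 }, r.2) := by
  induction i with
  | zero => exact Prod.ext (SearchState.ext rfl hs' rfl rfl rfl rfl) rfl
  | succ i ih =>
    rw [Function.iterate_succ_apply', ih (by omega), round_eq init op L (by exact hs)]
    simp only [Fin.val_ofNat, Nat.mod_eq_of_lt (by omega : i < R + 1), List.range_succ,
      List.map_append, List.foldl_append, List.map_cons, List.map_nil, List.foldl_cons,
      List.foldl_nil]

theorem foldl_letterStep_eq {s : SearchState A R t κ} (hs : s.Clean) (x : Fin N → Cell e t κ)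
    (a : List (Fin (A + 1))) :
    ∃ s' : SearchState A R t κ, s'.Clean ∧ a.foldl ((localSearch init op).letterStep L) (s, x) =
      ({ s' with phase := (a.foldl (letterRun (R := R) init op L) (s.phase, x)).1 },
        (a.foldl (letterRun (R := R) init op L) (s.phase, x)).2) := by
  induction a generalizing s x with
  | nil => exact ⟨s, hs, rfl⟩
  | cons w a ih =>
    have h : (localSearch init op).letterStep L (s, x) w =
        ({ s with
            ltr := w
            idx := Fin.ofNat (R + 1) R
            phase := (letterRun (R := R) init op L (s.phase, x) w).1 },
          (letterRun (R := R) init op L (s.phase, x) w).2) :=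
      iterate_round_eq init op L (s := { s with ltr := w, idx := 0 }) hs rfl x le_rfl
    rw [List.foldl_cons, List.foldl_cons, h]
    exact ih (by exact hs) _

/-- The outcome of a scan, see `scan_spec`. -/
structure Collected (x : Fin N → Cell e t κ) (G : List (List (Literal (e + 1) N)))
    (y : Fin N → Cell e t κ) : Prop where
  length_le : G.length ≤ t
  marked : Marked x G y
  falsified : ∀ C ∈ G, C ∈ L ∧ Falsified x C
  maximal : ∀ C ∈ L, Falsified x C → G.length = t ∨ C ∈ G ∨ ∃ u ∈ C, (y u.1).mark ≠ none

theorem exists_collected (hL : ∀ C ∈ L, C.Nodup ∧ C.length ≤ κ + 1) {x : Fin N → Cell e t κ}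
    (hx : ∀ p, (x p).mark = none) : ∃ G y, Collected L x G y ∧
      (∀ ph o, opStep (R := R) init op L (ph, x) o =
        (o.nextPhase ph G.length, fun p => o.apply ph G.length (y p))) ∧
      ∀ s : SearchState A R t κ, s.Clean →
        (((localSearch init op).scan L (s, x)).1.cnt : ℕ) = G.length := by
  obtain ⟨G, y, h₁, h₂, h₃, h₄, h₅⟩ := scan_spec (R := R) init op L hL
    (s := (localSearch (R := R) init op).start) rfl rfl rfl hx
  refine ⟨G, y, ⟨h₂, h₃, h₄, h₅⟩, fun ph o => ?_, fun s hs => ?_⟩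
  · simp only [opStep, h₁, Fin.val_ofNat, Nat.mod_eq_of_lt (Nat.lt_succ_of_le h₂)]
  · rw [scan_clean init op L hs, h₁]
    simp only [overwrite, Fin.val_ofNat, Nat.mod_eq_of_lt (Nat.lt_succ_of_le h₂)]

end Steps

section Progress

variable {e t κ A R b N : ℕ} {init : Fin (A + 1) → Fin b → Fin (e + 1)}
  {op : Fin (A + 1) → ℕ → Op e t κ} {L : List (List (Literal (e + 1) N))}
  {α : Fin N → Fin (e + 1)} {n : ℕ}

/-- No constraint is falsified. -/
def Solved (L : List (List (Literal (e + 1) N))) (x : Fin N → Cell e t κ) : Prop :=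
  (∀ p, (x p).mark = none) ∧ ∀ C ∈ L, ¬ Falsified x C

/-- The number of free variables on which `x` differs from `α`. -/
def distance (α : Fin N → Fin (e + 1)) (x : Fin N → Cell e t κ) : ℕ :=
  #{p | (x p).fixed = false ∧ (x p).val ≠ α p}

/-- The invariant of the first phase. -/
structure FirstPhase (α : Fin N → Fin (e + 1)) (n : ℕ) (r : Bool × (Fin N → Cell e t κ)) : Prop where
  phase : r.1 = false
  mark : ∀ p, (r.2 p).mark = none
  fixed : ∀ p, (r.2 p).fixed = false
  distance_le : distance α r.2 ≤ n

/-- The invariant of the second phase. -/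
structure SecondPhase (L : List (List (Literal (e + 1) N))) (α : Fin N → Fin (e + 1)) (n : ℕ)
    (r : Bool × (Fin N → Cell e t κ)) : Prop where
  phase : r.1 = true
  mark : ∀ p, (r.2 p).mark = none
  agree : ∀ p, (r.2 p).fixed = true → (r.2 p).val = α p
  free : ∀ C ∈ L, (∀ u ∈ C, (r.2 u.1).fixed = false) → ¬ Falsified r.2 C
  distance_le : distance α r.2 ≤ n

/-- `α` satisfies all constraints of `L`. -/
def Satisfies (L : List (List (Literal (e + 1) N))) (α : Fin N → Fin (e + 1)) : Prop :=
  ∀ C ∈ L, ∃ u ∈ C, α u.1 ≠ u.2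

theorem Solved.marks {x y : Fin N → Cell e t κ} {G : List (List (Literal (e + 1) N))}
    (h : Solved L x) (hG : Collected L x G y) : G = [] ∧ y = x := by
  have hG' : G = [] := List.eq_nil_iff_forall_not_mem.2 fun C hC =>
    h.2 C (hG.falsified C hC).1 (hG.falsified C hC).2
  refine ⟨hG', funext fun p => Cell.ext (hG.marked.val p) (hG.marked.fixed p) ?_⟩
  rw [h.1 p, ← Option.not_isSome_iff_eq_none, Option.isSome_iff_exists]
  rintro ⟨μ, hμ⟩
  obtain ⟨C, hC, -⟩ := (hG.marked.mark p μ).1 hμ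
  rw [hG'] at hC
  cases hC

theorem Collected.solved {x y : Fin N → Cell e t κ} (hG : Collected L x [] y)
    (hx : ∀ p, (x p).mark = none) (ht : 0 < t) : Solved L x := by
  refine ⟨hx, fun C hC hf => ?_⟩
  rcases hG.maximal C hC hf with h' | h' | ⟨u, -, hu⟩
  · simp only [List.length_nil] at h'
    omega
  · cases h'
  · obtain ⟨μ, hμ⟩ := Option.ne_none_iff_exists'.1 hu
    obtain ⟨D, hD, -⟩ := (hG.marked.mark _ μ).1 hμ
    cases hD

theorem Op.apply_of_mark_eq_none {o : Op e t κ} {ph : Bool} {c : ℕ} {x : Cell e t κ}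
    (h : x.mark = none) : o.apply ph c x = x := by
  rw [Op.apply, h]

/-- Without falsified constraints nothing is marked, and every operation is idle on unmarked cells.
The remaining scans therefore cannot spoil a solution found early. -/
theorem Solved.opStep (hL : ∀ C ∈ L, C.Nodup ∧ C.length ≤ κ + 1)
    {r : Bool × (Fin N → Cell e t κ)} (h : Solved L r.2) (o : Op e t κ) :
    Solved L (opStep (R := R) init op L r o).2 := by
  obtain ⟨G, y, hG, hstep, -⟩ := exists_collected (R := R) init op L hL h.1
  obtain ⟨-, rfl⟩ := h.marks hG
  rw [hstep]
  have : (fun p => o.apply r.1 G.length (r.2 p)) = r.2 :=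
    funext fun p => Op.apply_of_mark_eq_none (h.1 p)
  simpa only [this] using h

/-- Removing the marks gives back the array before the scan. -/
theorem Marked.erase {x y : Fin N → Cell e t κ} {G : List (List (Literal (e + 1) N))}
    (h : Marked x G y) (hx : ∀ p, (x p).mark = none) (p : Fin N) :
    (⟨(y p).val, (y p).fixed, none⟩ : Cell e t κ) = x p :=
  Cell.ext (h.val p) (h.fixed p) (hx p).symm

/-- Operations of the other phase are idle, here and in `opStep_main_second`. One fixed schedule of
operations can thus serve both phases, without knowing when the phase changes. -/
theorem opStep_branch_first (hL : ∀ C ∈ L, C.Nodup ∧ C.length ≤ κ + 1)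
    {r : Bool × (Fin N → Cell e t κ)} (h : FirstPhase α n r) (f : Mark t κ → Option (Fin e)) :
    opStep (R := R) init op L r (.branch f) = r := by
  obtain ⟨ph, x⟩ := r
  obtain ⟨G, y, hG, hstep, -⟩ := exists_collected (R := R) (x := x) init op L hL h.mark
  rw [hstep]
  obtain rfl : ph = false := h.phase
  refine Prod.ext rfl (funext fun p => Eq.trans ?_ (hG.marked.erase h.mark p))
  simp only [Op.apply]
  split
  · rename_i hm
    exact Cell.ext rfl rfl hm
  · rfl

theorem opStep_main_second (hL : ∀ C ∈ L, C.Nodup ∧ C.length ≤ κ + 1)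
    {r : Bool × (Fin N → Cell e t κ)} (h : SecondPhase L α n r) (f : Mark t κ → Option (Fin e))
    (β : Mark t κ → Fin (e + 1)) : opStep (R := R) init op L r (.main f β) = r := by
  obtain ⟨ph, x⟩ := r
  obtain ⟨G, y, hG, hstep, -⟩ := exists_collected (R := R) (x := x) init op L hL h.mark
  rw [hstep]
  obtain rfl : ph = true := h.phase
  refine Prod.ext rfl (funext fun p => Eq.trans ?_ (hG.marked.erase h.mark p))
  simp only [Op.apply]
  split
  · rename_i hm
    exact Cell.ext rfl rfl hm
  · rfl

/-- A falsified constraint contains a variable on which `x` differs from a satisfying assignment;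
it is marked if the constraint has been collected and the variable is free. -/
theorem exists_marked (hL : ∀ C ∈ L, C.Nodup ∧ C.length ≤ κ + 1) (hα : Satisfies L α)
    {x y : Fin N → Cell e t κ} {G : List (List (Literal (e + 1) N))} (hG : Collected L x G y)
    (agree : ∀ p, (x p).fixed = true → (x p).val = α p) {i : Fin (t + 1)}
    {C : List (Literal (e + 1) N)} (hC : G[(i : ℕ)]? = some C) :
    ∃ p j, (y p).mark = some (i, j) ∧ (x p).val ≠ α p ∧ (j : ℕ) < (freeVars x C).length := by
  have hmem := List.mem_of_getElem? hC
  obtain ⟨hCL, hCf⟩ := hG.falsified C hmem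
  obtain ⟨u, hu, hne⟩ := hα C hCL
  have hval : (x u.1).val ≠ α u.1 := by
    rw [hCf u hu]
    exact hne.symm
  have hfree : (x u.1).fixed = false := by
    by_contra h
    exact hval (agree _ (by simpa using h))
  obtain ⟨j, hj⟩ := List.getElem?_of_mem (mem_freeVars hu hfree)
  have hlt := (List.getElem?_eq_some_iff.1 hj).1
  have hlen := length_freeVars_le x C
  have hk := (hL C hCL).2
  exact ⟨u.1, ⟨j, by omega⟩, (hG.marked.mark _ _).2 ⟨C, hC, hj⟩, hval, hlt⟩

/-- Change the `j`-th variable of the `i`-th constraint, where `w i = (j, v)`, to its `v`-th other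
value. -/
def codeFn (w : Fin t → Fin (κ + 1) × Fin e) (μ : Mark t κ) : Option (Fin e) :=
  if h : (μ.1 : ℕ) < t then
    if ((w ⟨μ.1, h⟩).1 : ℕ) = μ.2 then some (w ⟨μ.1, h⟩).2 else none
  else none

/-- Change the `j`-th variable of the first constraint to its `v`-th other value. -/
def branchFn (w : Fin κ × Fin e) (μ : Mark t κ) : Option (Fin e) :=
  if (μ.1 : ℕ) = 0 ∧ (μ.2 : ℕ) = w.1 then some w.2 else none

/-- The first collected constraint has a free variable on which the array disagrees with α. Setting
it to its value in α and fixing it lowers the distance, and the constraints with all variables free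
lose nothing but members. -/
theorem opStep_branch_second (hL : ∀ C ∈ L, C.Nodup ∧ C.length ≤ κ + 1) (hα : Satisfies L α)
    (ht : 0 < t) {r : Bool × (Fin N → Cell e t κ)} (h : SecondPhase L α n r) :
    Solved L r.2 ∨ ∃ w, SecondPhase L α (n - 1) (opStep (R := R) init op L r (.branch (branchFn w))) := by
  obtain ⟨ph, x⟩ := r
  obtain ⟨G, y, hG, hstep, -⟩ := exists_collected (R := R) (x := x) init op L hL h.mark
  obtain rfl : ph = true := h.phase
  cases G with
  | nil =>
    exact Or.inl (hG.solved h.mark ht)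
  | cons C G =>
    right
    obtain ⟨p, j, hp, hne, hj⟩ := exists_marked hL hα hG h.agree (i := 0) (C := C) rfl
    obtain ⟨hCL, hCf⟩ := hG.falsified C (by simp)
    -- By the invariant `free`, a falsified constraint contains a fixed variable. This is what
    -- leaves κ instead of κ + 1 candidates.
    have hlt : (freeVars x C).length < C.length := by
      by_contra hle
      refine h.free C hCL (fun u hu => ?_) hCf
      rw [freeVars, List.length_map, not_lt] at hle
      have := List.length_filter_eq_length_iff.1 (le_antisymm (List.length_filter_le _ _) hle) u hu
      simpa using this
    have hk := (hL C hCL).2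
    obtain ⟨v, hv⟩ := Fin.exists_succAbove_eq hne.symm
    have hfree : (x p).fixed = false := hG.marked.not_fixed (by rw [hp]; simp)
    refine ⟨(⟨j, by omega⟩, v), ?_⟩
    rw [hstep]
    have hnew : (fun p' => (Op.branch (branchFn (⟨j, by omega⟩, v)) : Op e t κ).apply true
        (C :: G).length (y p')) = Function.update x p ⟨α p, true, none⟩ := by
      funext p'
      by_cases hp' : p' = p
      · subst hp'
        rw [Function.update_self, Op.apply, hp]
        simp [branchFn, hG.marked.val, hv]
      · rw [Function.update_of_ne hp', Op.apply, ← hG.marked.erase h.mark p']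
        split
        · rename_i hm
          exact Cell.ext rfl rfl hm
        · rename_i μ hm
          have : (branchFn (⟨j, by omega⟩, v) : Mark t κ → Option (Fin e)) μ = none := by
            rw [branchFn, if_neg]
            rintro ⟨h₁, h₂⟩
            refine hp' (hG.marked.mark_injective hm (hp.trans (congrArg some (Prod.ext ?_ ?_))))
            · exact Fin.ext (by simpa using h₁.symm)
            · exact Fin.ext h₂.symm
          simp only [this, Option.elim_none]
    rw [hnew]
    refine ⟨rfl, fun p' => ?_, fun p' hf => ?_, fun D hD hfr hDf => ?_, ?_⟩
    · by_cases hp' : p' = p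
      · subst hp'; simp
      · simpa [Function.update_of_ne hp'] using h.mark p'
    · by_cases hp' : p' = p
      · subst hp'; simp
      · simp only [Function.update_of_ne hp'] at hf ⊢
        exact h.agree p' hf
    · have hne' : ∀ u ∈ D, u.1 ≠ p := by
        rintro u hu rfl
        simpa using hfr u hu
      refine h.free D hD (fun u hu => ?_) fun u hu => ?_
      · simpa [Function.update_of_ne (hne' u hu)] using hfr u hu
      · simpa [Function.update_of_ne (hne' u hu)] using hDf u hu
    · have hd := h.distance_le
      simp only [distance] at hd ⊢
      have hss : ({p' | (Function.update x p ⟨α p, true, none⟩ p').fixed = false ∧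
          (Function.update x p ⟨α p, true, none⟩ p').val ≠ α p'} : Finset (Fin N)) ⊂
          ({p' | (x p').fixed = false ∧ (x p').val ≠ α p'} : Finset (Fin N)) := by
        rw [ssubset_iff_of_subset]
        · exact ⟨p, by simp [hfree, hne], by simp⟩
        · intro p' hp'
          by_cases hpp : p' = p
          · subst hpp; simp at hp'
          · simpa [Function.update_of_ne hpp] using hp'
      have := card_lt_card hss
      omega

/-- The distance between words of pairs `(j, v)`, see `opStep_main_first`. -/
def stepDist {κ e : ℕ} (a a' : Fin (κ + 1) × Fin e) : ℕ :=
  if a.1 = a'.1 then if a.2 = a'.2 then 0 else 1 else 2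

/-- Each collected constraint changes the distance by at most its `stepDist` minus one: the right
change repairs a wrong variable, a wrong value on the right variable leaves it wrong at worst, and a
change elsewhere can spoil one variable. The marked variables of different constraints are disjoint,
so the changes add up. -/
theorem distance_flip {x y : Fin N → Cell e t κ} {G : List (List (Literal (e + 1) N))}
    (hx : ∀ p, (x p).fixed = false) (hG : Marked x G y) (w w' : Fin t → Fin (κ + 1) × Fin e)
    (hw' : ∀ i : Fin t, ∃ p, (y p).mark = some (i.castSucc, (w' i).1.castSucc) ∧
      (x p).val.succAbove (w' i).2 = α p)
    {x' : Fin N → Cell e t κ} (hx' : ∀ p, x' p = match (y p).mark with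
      | none => x p
      | some μ => ⟨(codeFn w μ).elim (x p).val (x p).val.succAbove, (x p).fixed, none⟩) :
    distance α x' + t ≤ distance α x + ∑ i, stepDist (w i) (w' i) := by
  set D : Fin N → ℕ := fun p => if (x p).val ≠ α p then 1 else 0 with hD
  set D' : Fin N → ℕ := fun p => if (x' p).val ≠ α p then 1 else 0 with hD'
  have hfix : ∀ p, (x' p).fixed = false := by
    intro p
    rw [hx']
    split <;> exact hx p
  have hd : distance α x = ∑ p, D p := by simp [distance, hx, hD, card_filter]
  have hd' : distance α x' = ∑ p, D' p := by simp [distance, hfix, hD', card_filter]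
  set P : Fin t → Finset (Fin N) := fun i => {p | (y p).mark = some (i.castSucc, (w i).1.castSucc)}
    with hP
  have hflip : ∀ i, ∀ p ∈ P i, (x' p).val = (x p).val.succAbove (w i).2 := by
    intro i p hp
    have hm : (y p).mark = some (i.castSucc, (w i).1.castSucc) := by simpa [hP] using hp
    rw [hx', hm]
    simp [codeFn]
  -- Outside the sets `P i` nothing changes, and every variable lies in at most one of them. The
  -- terms are arranged to avoid subtraction.
  have hpoint : ∀ p, D' p + ∑ i, (if p ∈ P i then D p else 0) =
      D p + ∑ i, (if p ∈ P i then D' p else 0) := by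
    intro p
    by_cases hex : ∃ i, p ∈ P i
    · obtain ⟨i, hi⟩ := hex
      have huniq : ∀ i', p ∈ P i' ↔ i' = i := by
        intro i'
        refine ⟨fun hi' => ?_, fun h => h ▸ hi⟩
        have h₁ : (y p).mark = some (i.castSucc, (w i).1.castSucc) := by simpa [hP] using hi
        have h₂ : (y p).mark = some (i'.castSucc, (w i').1.castSucc) := by simpa [hP] using hi'
        rw [h₁] at h₂
        exact (Fin.castSucc_injective _ (Prod.ext_iff.1 (Option.some.inj h₂)).1).symm
      simp [huniq, add_comm]
    · push Not at hex
      simp only [hex, if_false, sum_const_zero, add_zero, hD, hD']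
      have : (x' p).val = (x p).val := by
        rw [hx']
        split
        · rfl
        · rename_i μ hm
          have : codeFn w μ = none := by
            rw [codeFn]
            split
            · rename_i hlt
              rw [if_neg]
              intro hj
              refine hex ⟨μ.1, hlt⟩ ?_
              simp only [hP, mem_filter, mem_univ, true_and, hm]
              exact congrArg some (Prod.ext (Fin.ext rfl) (Fin.ext hj.symm))
            · rfl
          simp [this]
      rw [this]
  -- `P i` has at most one element. It is empty if `w i` names a position beyond the free variables
  -- of the constraint; then nothing is changed, and `stepDist` is 2.
  have hi : ∀ i, ∑ p ∈ P i, D' p + 1 ≤ ∑ p ∈ P i, D p + stepDist (w i) (w' i) := by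
    intro i
    obtain ⟨p, hp, hpv⟩ := hw' i
    have hDp : D p = 1 := if_pos (by rw [← hpv]; exact (Fin.succAbove_ne _ _).symm)
    have hsub : ∀ p₁ ∈ P i, ∀ p₂ ∈ P i, p₁ = p₂ := by
      intro p₁ h₁ p₂ h₂
      exact hG.mark_injective (by simpa [hP] using h₁) (by simpa [hP] using h₂)
    have hle : ∑ p ∈ P i, D' p ≤ 1 := by
      have hc : #(P i) ≤ 1 := card_le_one.2 hsub
      calc ∑ p ∈ P i, D' p ≤ ∑ _p ∈ P i, 1 := sum_le_sum fun q _ => by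
            simp only [hD']
            split <;> omega
        _ ≤ 1 := by simpa using hc
    by_cases hj : (w i).1 = (w' i).1
    · have hpP : p ∈ P i := by simp [hP, hp, hj]
      have hPi : P i = {p} := eq_singleton_iff_unique_mem.2 ⟨hpP, fun p' hp' => hsub p' hp' p hpP⟩
      rw [hPi, sum_singleton] at hle ⊢
      rw [sum_singleton, hDp, stepDist, if_pos hj]
      split
      · rename_i hv
        have : D' p = 0 := if_neg (by rw [hflip i p hpP, hv, hpv]; simp)
        omega
      · omega
    · rw [stepDist, if_neg hj]
      omega
  have h₁ := sum_congr (rfl : (univ : Finset (Fin N)) = univ) fun p _ => hpoint p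
  rw [sum_add_distrib, sum_add_distrib, sum_comm, sum_comm (f := fun p i => if p ∈ P i then D' p else 0)]
    at h₁
  simp only [sum_ite_mem, univ_inter] at h₁
  have h₂ := sum_le_sum fun i (_ : i ∈ univ) => hi i
  rw [sum_add_distrib, sum_add_distrib, sum_const, card_univ, Fintype.card_fin, smul_eq_mul,
    mul_one] at h₂
  rw [hd, hd']
  omega

/-- With t collected constraints, a codeword at distance c from the word of right choices gains t -
c. With fewer, β is taken to be α on the marked variables. The first outcome does not depend on β
and the second not on w, so both can be put into the advice without knowing which case occurs. -/
theorem opStep_main_first (hL : ∀ C ∈ L, C.Nodup ∧ C.length ≤ κ + 1) (hα : Satisfies L α)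
    {W : Finset (Fin t → Fin (κ + 1) × Fin e)} {c m : ℕ} (hc : c + m = t)
    (hW : ∀ w' : Fin t → Fin (κ + 1) × Fin e, ∃ w ∈ W, ∑ i, stepDist (w i) (w' i) = c) {r : Bool × (Fin N → Cell e t κ)}
    (h : FirstPhase α n r) :
    (∃ w ∈ W, ∃ r', FirstPhase α (n - m) r' ∧
      ∀ β, opStep (R := R) init op L r (.main (codeFn w) β) = r') ∨
    ∃ β r', SecondPhase L α n r' ∧
      ∀ w, opStep (R := R) init op L r (.main (codeFn w) β) = r' := by
  obtain ⟨ph, x⟩ := r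
  obtain ⟨G, y, hG, hstep, -⟩ := exists_collected (R := R) (x := x) init op L hL h.mark
  obtain rfl : ph = false := h.phase
  have hfixed := h.fixed
  simp only at hfixed
  have agree : ∀ p, (x p).fixed = true → (x p).val = α p := by simp [hfixed]
  rcases hG.length_le.lt_or_eq with hlt | heq
  · right
    classical
    set x' : Fin N → Cell e t κ := fun p => if (y p).mark = none then x p else ⟨α p, true, none⟩
      with hx'
    have hnew : ∀ w, (fun p => (Op.main (codeFn w) (fun μ => if hμ : ∃ p, (y p).mark = some μ then
        α hμ.choose else 0) : Op e t κ).apply false G.length (y p)) = x' := by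
      intro w
      funext p
      simp only [hx', Op.apply]
      rcases hm : (y p).mark with _ | μ
      · simp only [if_true]
        rw [← hG.marked.erase h.mark p]
        exact Cell.ext rfl rfl hm
      · have hex : ∃ p, (y p).mark = some μ := ⟨p, hm⟩
        simp only [if_pos hlt, dif_pos hex, reduceCtorEq, if_false]
        rw [hG.marked.mark_injective hex.choose_spec hm]
    refine ⟨fun μ => if hμ : ∃ p, (y p).mark = some μ then α hμ.choose else 0, (true, x'), ?_,
      fun w => by rw [hstep, hnew]; simp [Op.nextPhase, hlt]⟩
    refine ⟨rfl, fun p => ?_, fun p hf => ?_, fun C hC hfr hf => ?_,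
      le_trans ?_ h.distance_le⟩
    · simp only [hx']
      split
      · exact h.mark p
      · rfl
    · simp only [hx'] at hf ⊢
      split
      · rename_i hm
        simp [hm, hfixed] at hf
      · rfl
    · have hm : ∀ u ∈ C, (y u.1).mark = none := by
        intro u hu
        by_contra hne
        simpa [hx', hne] using hfr u hu
      have hf' : Falsified x C := by
        intro u hu
        simpa [hx', hm u hu] using hf u hu
      -- A constraint left entirely free carries no mark, so maximality makes it one of the
      -- collected ones. But the variable at which α satisfies it was free and hence was marked.
      rcases hG.maximal C hC hf' with h' | h' | ⟨u, hu, h'⟩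
      · omega
      · obtain ⟨i, hi⟩ := List.getElem?_of_mem h'
        have hit := (List.getElem?_eq_some_iff.1 hi).1
        obtain ⟨u, hu, hne⟩ := hα C hC
        obtain ⟨j, hj⟩ := List.getElem?_of_mem (mem_freeVars hu (hfixed u.1))
        have hlt' := (List.getElem?_eq_some_iff.1 hj).1
        have hlen := length_freeVars_le x C
        have hk := (hL C hC).2
        have := (hG.marked.mark u.1 (⟨i, by omega⟩, ⟨j, by omega⟩)).2 ⟨C, hi, hj⟩
        rw [hm u hu] at this
        cases this
      · exact h' (hm u hu)
    · refine card_le_card fun p hp => ?_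
      simp only [hx', mem_filter, mem_univ, true_and] at hp ⊢
      split at hp
      · exact hp
      · simp at hp
  · left
    have hw' : ∀ i : Fin t, ∃ a : Fin (κ + 1) × Fin e, ∃ p,
        (y p).mark = some (i.castSucc, a.1.castSucc) ∧ (x p).val.succAbove a.2 = α p := by
      intro i
      obtain ⟨C, hC⟩ : ∃ C, G[((i.castSucc : Fin (t + 1)) : ℕ)]? = some C :=
        ⟨_, List.getElem?_eq_getElem (by rw [heq]; exact i.2)⟩
      obtain ⟨p, j, hp, hne, hj⟩ := exists_marked hL hα hG agree hC
      obtain ⟨v, hv⟩ := Fin.exists_succAbove_eq hne.symm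
      have hk := (hL C (hG.falsified C (List.mem_of_getElem? hC)).1).2
      have hlen := length_freeVars_le x C
      exact ⟨(⟨j, by omega⟩, v), p, hp, hv⟩
    choose w' hw' using hw'
    obtain ⟨w, hwW, hw⟩ := hW w'
    set x' : Fin N → Cell e t κ := fun p => match (y p).mark with
      | none => x p
      | some μ => ⟨(codeFn w μ).elim (x p).val (x p).val.succAbove, (x p).fixed, none⟩ with hx'
    refine ⟨w, hwW, (false, x'), ?_, fun β => ?_⟩
    · have hdist := distance_flip hfixed hG.marked w w' hw' fun p => rfl
      have hd := h.distance_le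
      simp only at hd
      refine ⟨rfl, fun p => ?_, fun p => ?_, ?_⟩
      · simp only [hx']
        split
        · exact h.mark p
        · rfl
      · simp only [hx']
        split
        · exact hfixed p
        · exact hfixed p
      · simp only [hx']
        omega
    · rw [hstep]
      refine Prod.ext (by simp [Op.nextPhase, heq]) (funext fun p => ?_)
      simp only [hx', Op.apply]
      rcases hm : (y p).mark with _ | μ
      · simp only
        rw [← hG.marked.erase h.mark p]
        exact Cell.ext rfl rfl hm
      · simp only [heq, lt_irrefl, if_false, hG.marked.val, hG.marked.fixed]

end Progress

end CSP

/-! ### From operations to letters, and correctness of the search -/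

namespace CSP

open Finset

section Letters

variable {e t κ A R b N S m q : ℕ} {init : Fin (A + 1) → Fin b → Fin (e + 1)}
  {op : Fin (A + 1) → ℕ → Op e t κ} {L : List (List (Literal (e + 1) N))}
  {α : Fin N → Fin (e + 1)} {n : ℕ} {r : Bool × (Fin N → Cell e t κ)}

/-- The invariant once the first phase has been left or the formula has been solved. -/
def Late (L : List (List (Literal (e + 1) N))) (α : Fin N → Fin (e + 1)) (n : ℕ)
    (r : Bool × (Fin N → Cell e t κ)) : Prop :=
  Solved L r.2 ∨ SecondPhase L α n r

/-- The invariant of a successful search. -/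
def Good (L : List (List (Literal (e + 1) N))) (α : Fin N → Fin (e + 1)) (n : ℕ)
    (r : Bool × (Fin N → Cell e t κ)) : Prop :=
  FirstPhase α n r ∨ Late L α n r

/-- At distance zero the free variables agree with α, and the fixed ones always do. The values in
the array are then those of α. -/
theorem Good.solved (hα : Satisfies L α) (h : Good L α 0 r) : Solved L r.2 := by
  have key : (∀ p, (r.2 p).mark = none) → (∀ p, (r.2 p).fixed = true → (r.2 p).val = α p) →
      distance α r.2 ≤ 0 → Solved L r.2 := by
    intro h₁ h₂ h₃
    refine ⟨h₁, fun C hC hf => ?_⟩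
    obtain ⟨u, hu, hne⟩ := hα C hC
    refine hne ?_
    rw [← hf u hu]
    by_contra hne'
    rw [distance, Nat.le_zero, card_eq_zero, filter_eq_empty_iff] at h₃
    refine h₃ (mem_univ u.1) ⟨?_, fun h => hne' h.symm⟩
    by_contra hfix
    exact hne' (h₂ u.1 (by simpa using hfix)).symm
  rcases h with h | h | h
  · exact key h.mark (fun p hp => by simp [h.fixed] at hp) h.distance_le
  · exact h
  · exact key h.mark h.agree h.distance_le

theorem Late.branch [NeZero e] [NeZero κ] (hL : ∀ C ∈ L, C.Nodup ∧ C.length ≤ κ + 1)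
    (hα : Satisfies L α) (ht : 0 < t) (h : Late L α n r) :
    ∃ w, Late L α (n - 1) (opStep (R := R) init op L r (.branch (branchFn w))) := by
  rcases h with h | h
  · exact ⟨(0, 0), Or.inl (h.opStep hL _)⟩
  · rcases opStep_branch_second (init := init) (op := op) (R := R) hL hα ht h with h | ⟨w, hw⟩
    · exact ⟨(0, 0), Or.inl (h.opStep hL _)⟩
    · exact ⟨w, Or.inr hw⟩

/-- The branching operations for a sequence of choices. -/
def branchOps (z : Fin m → Fin κ × Fin e) : List (Op e t κ) :=
  List.ofFn fun i => .branch (branchFn (z i))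

theorem solved_foldl (hL : ∀ C ∈ L, C.Nodup ∧ C.length ≤ κ + 1) (os : List (Op e t κ))
    (h : Solved L r.2) : Solved L (os.foldl (opStep (R := R) init op L) r).2 := by
  induction os generalizing r with
  | nil => exact h
  | cons o os ih => exact ih (h.opStep hL o)

theorem FirstPhase.branches (hL : ∀ C ∈ L, C.Nodup ∧ C.length ≤ κ + 1) (h : FirstPhase α n r)
    (z : Fin m → Fin κ × Fin e) :
    (branchOps z).foldl (opStep (R := R) init op L) r = r := by
  induction m with
  | zero => rfl
  | succ m ih =>
    rw [branchOps, List.ofFn_succ, List.foldl_cons, opStep_branch_first hL h]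
    exact ih _

theorem Late.branches [NeZero e] [NeZero κ] (hL : ∀ C ∈ L, C.Nodup ∧ C.length ≤ κ + 1)
    (hα : Satisfies L α) (ht : 0 < t) (h : Late L α n r) (m : ℕ) :
    ∃ z : Fin m → Fin κ × Fin e,
      Late L α (n - m) ((branchOps z).foldl (opStep (R := R) init op L) r) := by
  induction m generalizing n r with
  | zero => exact ⟨Fin.elim0, h⟩
  | succ m ih =>
    obtain ⟨w, hw⟩ := h.branch (init := init) (op := op) (R := R) hL hα ht
    obtain ⟨z, hz⟩ := ih hw
    refine ⟨Fin.cons w z, ?_⟩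
    rw [branchOps, List.ofFn_succ, List.foldl_cons,
      show n - (m + 1) = n - 1 - m by omega]
    exact hz

/-- A step of the first phase together with the steps of the second phase of the same length. -/
def macroOps (w : Fin t → Fin (κ + 1) × Fin e) (β : Mark t κ → Fin (e + 1))
    (z : Fin m → Fin κ × Fin e) : List (Op e t κ) :=
  .main (codeFn w) β :: branchOps z

theorem Late.macroOps [NeZero e] [NeZero κ] (hL : ∀ C ∈ L, C.Nodup ∧ C.length ≤ κ + 1)
    (hα : Satisfies L α) (ht : 0 < t) (h : Late L α n r) (m : ℕ) :
    ∃ z : Fin m → Fin κ × Fin e, ∀ w β,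
      Late L α (n - m) ((macroOps w β z).foldl (opStep (R := R) init op L) r) := by
  rcases h with h | h
  · exact ⟨fun _ => (0, 0), fun w β => Or.inl (solved_foldl hL _ h)⟩
  · obtain ⟨z, hz⟩ := Late.branches (R := R) (init := init) (op := op) hL hα ht (Or.inr h) m
    refine ⟨z, fun w β => ?_⟩
    rw [CSP.macroOps, List.foldl_cons, opStep_main_second hL h]
    exact hz

/-- If the first phase continues, the main operation gains m and the branches are idle. If it ends
here, fixing variables does not increase the distance, and the m branches that follow gain m or
reach a solution. -/
theorem FirstPhase.macroOps [NeZero e] [NeZero κ] (hL : ∀ C ∈ L, C.Nodup ∧ C.length ≤ κ + 1)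
    (hα : Satisfies L α) (ht : 0 < t) {W : Finset (Fin t → Fin (κ + 1) × Fin e)} {c : ℕ}
    (hc : c + m = t) (hW : ∀ w' : Fin t → Fin (κ + 1) × Fin e, ∃ w ∈ W, ∑ i, stepDist (w i) (w' i) = c)
    (h : FirstPhase α n r) :
    (∃ w ∈ W, ∃ r', FirstPhase α (n - m) r' ∧ ∀ β (z : Fin m → Fin κ × Fin e),
      (macroOps w β z).foldl (opStep (R := R) init op L) r = r') ∨
    ∃ β, ∃ z : Fin m → Fin κ × Fin e, ∀ w,
      Late L α (n - m) ((macroOps w β z).foldl (opStep (R := R) init op L) r) := by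
  rcases opStep_main_first (R := R) (init := init) (op := op) hL hα hc hW h with
    ⟨w, hw, r', h', hr'⟩ | ⟨β, r', h', hr'⟩
  · refine Or.inl ⟨w, hw, r', h', fun β z => ?_⟩
    rw [CSP.macroOps, List.foldl_cons, hr', h'.branches hL]
  · obtain ⟨z, hz⟩ := Late.branches (R := R) (init := init) (op := op) hL hα ht (Or.inr h') m
    refine Or.inr ⟨β, z, fun w => ?_⟩
    rw [CSP.macroOps, List.foldl_cons, hr']
    exact hz

/-- The operations for a letter of the advice. -/
def letterOps (cw : Fin S → Fin t → Fin (κ + 1) × Fin e) (br : Fin S → Fin m → Fin κ × Fin e)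
    (β : Mark t κ → Fin (e + 1)) (σ : Fin q → Fin S) : List (Op e t κ) :=
  (List.ofFn σ).flatMap fun s => macroOps (cw s) β (br s)

theorem length_letterOps (cw : Fin S → Fin t → Fin (κ + 1) × Fin e)
    (br : Fin S → Fin m → Fin κ × Fin e) (β : Mark t κ → Fin (e + 1)) (σ : Fin q → Fin S) :
    (letterOps cw br β σ).length = q * (m + 1) := by
  rw [letterOps, List.length_flatMap]
  simp [macroOps, branchOps, Function.comp_def]

theorem letterOps_cons (cw : Fin S → Fin t → Fin (κ + 1) × Fin e)
    (br : Fin S → Fin m → Fin κ × Fin e) (β : Mark t κ → Fin (e + 1)) (s : Fin S) (σ : Fin q → Fin S) :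
    letterOps cw br β (Fin.cons s σ : Fin (q + 1) → Fin S) =
      macroOps (cw s) β (br s) ++ letterOps cw br β σ := by
  simp [letterOps, List.ofFn_succ]

variable {cw : Fin S → Fin t → Fin (κ + 1) × Fin e} {br : Fin S → Fin m → Fin κ × Fin e}

theorem Late.letterOps [NeZero e] [NeZero κ] (hL : ∀ C ∈ L, C.Nodup ∧ C.length ≤ κ + 1)
    (hα : Satisfies L α) (ht : 0 < t) (hbr : Function.Surjective br) (β : Mark t κ → Fin (e + 1))
    (q : ℕ) (h : Late L α n r) : ∃ σ : Fin q → Fin S,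
      Late L α (n - q * m) ((letterOps cw br β σ).foldl (opStep (R := R) init op L) r) := by
  induction q generalizing n r with
  | zero => exact ⟨Fin.elim0, by simpa [CSP.letterOps] using h⟩
  | succ q ih =>
    obtain ⟨z, hz⟩ := h.macroOps (R := R) (init := init) (op := op) hL hα ht m
    obtain ⟨s, rfl⟩ := hbr z
    obtain ⟨σ, hσ⟩ := ih (hz (cw s) β)
    refine ⟨Fin.cons s σ, ?_⟩
    rw [letterOps_cons, List.foldl_append, Nat.succ_mul, Nat.add_comm, ← Nat.sub_sub]
    exact hσ

/-- One β per letter is enough: main operations ignore it before the phase changes and are idle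
afterwards. Each symbol of σ names both a codeword and a branching sequence, and only the one for
the current phase takes effect, except at the change, where the main operation uses β alone. -/
theorem FirstPhase.letterOps [NeZero e] [NeZero κ] (hL : ∀ C ∈ L, C.Nodup ∧ C.length ≤ κ + 1)
    (hα : Satisfies L α) (ht : 0 < t) {W : Finset (Fin t → Fin (κ + 1) × Fin e)} {c : ℕ}
    (hc : c + m = t) (hW : ∀ w' : Fin t → Fin (κ + 1) × Fin e, ∃ w ∈ W, ∑ i, stepDist (w i) (w' i) = c)
    (hcw : ∀ w ∈ W, ∃ s, cw s = w) (hbr : Function.Surjective br) (q : ℕ) (h : FirstPhase α n r) :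
    ∃ β, ∃ σ : Fin q → Fin S,
      Good L α (n - q * m) ((letterOps cw br β σ).foldl (opStep (R := R) init op L) r) := by
  induction q generalizing n r with
  | zero => exact ⟨fun _ => 0, Fin.elim0, Or.inl (by simpa [CSP.letterOps] using h)⟩
  | succ q ih =>
    rw [show n - (q + 1) * m = n - m - q * m by rw [Nat.succ_mul]; omega]
    rcases h.macroOps (R := R) (init := init) (op := op) hL hα ht hc hW with
      ⟨w, hw, r', h', hr'⟩ | ⟨β, z, hz⟩
    · obtain ⟨s, rfl⟩ := hcw w hw
      obtain ⟨β, σ, hσ⟩ := ih h'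
      refine ⟨β, Fin.cons s σ, ?_⟩
      rw [letterOps_cons, List.foldl_append, hr']
      exact hσ
    · obtain ⟨s, rfl⟩ := hbr z
      obtain ⟨σ, hσ⟩ := (hz (cw s)).letterOps (R := R) (init := init) (op := op) (cw := cw) hL hα ht
        hbr β q
      refine ⟨β, Fin.cons s σ, Or.inr ?_⟩
      rw [letterOps_cons, List.foldl_append]
      exact hσ

theorem Good.letterOps [NeZero e] [NeZero κ] (hL : ∀ C ∈ L, C.Nodup ∧ C.length ≤ κ + 1)
    (hα : Satisfies L α) (ht : 0 < t) {W : Finset (Fin t → Fin (κ + 1) × Fin e)} {c : ℕ}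
    (hc : c + m = t) (hW : ∀ w' : Fin t → Fin (κ + 1) × Fin e, ∃ w ∈ W, ∑ i, stepDist (w i) (w' i) = c)
    (hcw : ∀ w ∈ W, ∃ s, cw s = w) (hbr : Function.Surjective br) (q : ℕ) (h : Good L α n r) :
    ∃ β, ∃ σ : Fin q → Fin S,
      Good L α (n - q * m) ((letterOps cw br β σ).foldl (opStep (R := R) init op L) r) := by
  rcases h with h | h
  · exact h.letterOps hL hα ht hc hW hcw hbr q
  · obtain ⟨σ, hσ⟩ := h.letterOps (R := R) (init := init) (op := op) (cw := cw) hL hα ht hbr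
      (fun _ => 0) q
    exact ⟨_, σ, Or.inr hσ⟩

end Letters

section Search

variable {e t κ A b N S m q : ℕ}

/-- The operations as a function of the letter and the number of the scan. -/
def letterOp (cw : Fin S → Fin t → Fin (κ + 1) × Fin e) (br : Fin S → Fin m → Fin κ × Fin e)
    (β : Fin (A + 1) → Mark t κ → Fin (e + 1)) (σ : Fin (A + 1) → Fin q → Fin S)
    (a : Fin (A + 1)) (i : ℕ) : Op e t κ :=
  (letterOps cw br (β a) (σ a)).getD i (.branch fun _ => none)

theorem letterRun_eq (init : Fin (A + 1) → Fin b → Fin (e + 1))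
    (cw : Fin S → Fin t → Fin (κ + 1) × Fin e) (br : Fin S → Fin m → Fin κ × Fin e)
    (β : Fin (A + 1) → Mark t κ → Fin (e + 1)) (σ : Fin (A + 1) → Fin q → Fin S)
    (L : List (List (Literal (e + 1) N))) (r : Bool × (Fin N → Cell e t κ)) (a : Fin (A + 1)) :
    letterRun (R := q * (m + 1)) init (letterOp cw br β σ) L r a =
      (letterOps cw br (β a) (σ a)).foldl
        (opStep (R := q * (m + 1)) init (letterOp cw br β σ) L) r := by
  rw [letterRun]
  congr 1
  refine List.ext_getElem (by simp [length_letterOps]) fun i h₁ h₂ => ?_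
  simp only [List.getElem_map, List.getElem_range, letterOp]
  exact List.getD_eq_getElem _ _ h₂

/-- The local search accepts some advice word if and only if the formula is satisfiable, if the
start words and the operations come from covering codes. -/
theorem exists_answer_iff [NeZero b] [NeZero e] [NeZero κ] (ht : 0 < t) {N₀ : ℕ}
    {L : List (List (Literal (e + 1) (N₀ * b)))} (hL : ∀ C ∈ L, C.Nodup ∧ C.length ≤ κ + 1)
    {W : Finset (Fin t → Fin (κ + 1) × Fin e)} {c : ℕ} (hc : c + m = t)
    (hW : ∀ w' : Fin t → Fin (κ + 1) × Fin e, ∃ w ∈ W, ∑ i, stepDist (w i) (w' i) = c)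
    {cw : Fin S → Fin t → Fin (κ + 1) × Fin e} (hcw : ∀ w ∈ W, ∃ s, cw s = w)
    {br : Fin S → Fin m → Fin κ × Fin e} (hbr : Function.Surjective br)
    {W₀ : Finset (Fin b → Fin (e + 1))} {c₀ : ℕ}
    (hW₀ : ∀ v : Fin b → Fin (e + 1), ∃ w ∈ W₀, ∑ i, (if w i = v i then 0 else 1) = c₀)
    (hq : c₀ ≤ q * m) {init : Fin (A + 1) → Fin b → Fin (e + 1)}
    {β : Fin (A + 1) → Mark t κ → Fin (e + 1)} {σ : Fin (A + 1) → Fin q → Fin S}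
    (hsurj : ∀ w ∈ W₀, ∀ β₀ σ₀, ∃ a, init a = w ∧ β a = β₀ ∧ σ a = σ₀) :
    (∃ a : List (Fin (A + 1)), a.length = N₀ ∧
      (localSearch (R := q * (m + 1)) init (letterOp cw br β σ)).answer L a = true) ↔
    ∃ α, Satisfies L α := by
  set op := letterOp cw br β σ with hop
  set P := localSearch (R := q * (m + 1)) init op with hP
  have hstart : P.start.Clean := ⟨rfl, rfl, rfl⟩
  have hmark₀ : ∀ (a : List (Fin (A + 1))) p, (P.initArray (N₀ * b) a p).mark = none :=
    fun _ _ => rfl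
  -- The final scan collects nothing if and only if no constraint is falsified, since t is positive.
  -- In particular acceptance is always sound, as the array then holds a satisfying assignment.
  have hanswer : ∀ a : List (Fin (A + 1)), P.answer L a = true ↔
      Solved L (a.foldl (letterRun (R := q * (m + 1)) init op L)
        (false, P.initArray (N₀ * b) a)).2 := by
    intro a
    have hmarks : ∀ (a : List (Fin (A + 1))) (r : Bool × (Fin (N₀ * b) → Cell e t κ)),
        (∀ p, (r.2 p).mark = none) →
        ∀ p, ((a.foldl (letterRun (R := q * (m + 1)) init op L) r).2 p).mark = none := by
      have hops : ∀ (os : List (Op e t κ)) (r : Bool × (Fin (N₀ * b) → Cell e t κ)),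
          (∀ p, (r.2 p).mark = none) →
          ∀ p, ((os.foldl (opStep (R := q * (m + 1)) init op L) r).2 p).mark = none := by
        intro os
        induction os with
        | nil => exact fun r h => h
        | cons o os ih => exact fun r _ => ih _ fun p => Op.mark_apply _ _ _ _
      intro a
      induction a with
      | nil => exact fun r h => h
      | cons w a ih => exact fun r h => ih _ (hops _ r h)
    obtain ⟨s', hs', h⟩ := foldl_letterStep_eq init op L hstart (P.initArray (N₀ * b) a) a
    set r := a.foldl (letterRun (R := q * (m + 1)) init op L) (false, P.initArray (N₀ * b) a)
      with hr
    have hrm : ∀ p, (r.2 p).mark = none := hmarks a _ (hmark₀ a)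
    obtain ⟨G, y, hG, -, hcnt⟩ := exists_collected (R := q * (m + 1)) init op L hL hrm
    have hc := hcnt { s' with phase := r.1 } hs'
    have hans : P.answer L a = true ↔ G = [] := by
      have : P.answer L a = P.accept (P.scan L ({ s' with phase := r.1 }, r.2)).1 := by
        rw [Procedure.answer, Procedure.check]
        congr 3
      rw [this, ← List.length_eq_zero_iff, ← hc]
      exact beq_iff_eq
    rw [hans]
    refine ⟨?_, fun hS => (hS.marks hG).1⟩
    rintro rfl
    exact hG.solved hrm ht
  constructor
  · rintro ⟨a, -, ha⟩
    refine ⟨fun p => ((a.foldl (letterRun (R := q * (m + 1)) init op L)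
        (false, P.initArray (N₀ * b) a)).2 p).val, fun C hC => ?_⟩
    have := ((hanswer a).1 ha).2 C hC
    rw [Falsified] at this
    push Not at this
    exact this
  · rintro ⟨α, hα⟩
    have hblock : ∀ i : Fin N₀, ∃ w ∈ W₀, ∑ j, (if w j = α (finProdFinEquiv (i, j)) then 0 else 1) =
        c₀ := fun i => hW₀ _
    choose w hw hwc using hblock
    -- Only the start words are prescribed. The remaining parts of each letter are chosen as the
    -- search reaches it, and each letter gains q * m.
    have hlist : ∀ (ws : List (Fin b → Fin (e + 1))) (n : ℕ) (r : Bool × (Fin (N₀ * b) → Cell e t κ)),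
        (∀ v ∈ ws, v ∈ W₀) → Good L α n r → ∃ a : List (Fin (A + 1)), a.map init = ws ∧
          Good L α (n - ws.length * (q * m))
            (a.foldl (letterRun (R := q * (m + 1)) init op L) r) := by
      intro ws
      induction ws with
      | nil => exact fun n r _ h => ⟨[], rfl, by simpa using h⟩
      | cons v ws ih =>
        intro n r hv h
        obtain ⟨β₀, σ₀, h'⟩ := h.letterOps (R := q * (m + 1)) (init := init) (op := op) hL hα ht hc
          hW hcw hbr q
        obtain ⟨x, hx₁, hx₂, hx₃⟩ := hsurj v (hv v (by simp)) β₀ σ₀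
        obtain ⟨a, ha, h''⟩ := ih _ _ (fun v' hv' => hv v' (by simp [hv'])) h'
        refine ⟨x :: a, by rw [List.map_cons, hx₁, ha], ?_⟩
        rw [List.foldl_cons, List.length_cons, Nat.succ_mul, Nat.add_comm _ (q * m), ← Nat.sub_sub,
          hop, letterRun_eq, hx₂, hx₃]
        exact h''
    have hdist : ∀ a : List (Fin (A + 1)), a.map init = List.ofFn w →
        distance α (P.initArray (N₀ * b) a) = N₀ * c₀ := by
      intro a ha
      have hval : ∀ i j, (P.initArray (N₀ * b) a (finProdFinEquiv (i, j))).val = w i j := by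
        intro i j
        have h₁ : ((finProdFinEquiv (i, j) : Fin (N₀ * b)) : ℕ) / b = i := by
          rw [finProdFinEquiv_apply_val, Nat.add_mul_div_left _ _ (NeZero.pos b),
            Nat.div_eq_of_lt j.2, zero_add]
        have h₂ : ((finProdFinEquiv (i, j) : Fin (N₀ * b)) : ℕ) % b = j := by
          rw [finProdFinEquiv_apply_val, Nat.add_mul_mod_self_left, Nat.mod_eq_of_lt j.2]
        have hlen : a.length = N₀ := by simpa using congrArg List.length ha
        have hi : (i : ℕ) < a.length := hlen ▸ i.2
        have h₃ : init (a.getD i 0) = w i := by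
          rw [List.getD_eq_getElem _ _ hi]
          have := List.getElem_of_eq ha (i := i) (by simpa using hi)
          simpa using this
        rw [← h₃]
        simp only [Procedure.initArray, hP, localSearch, h₁, h₂]
      have hfix : ∀ p, (P.initArray (N₀ * b) a p).fixed = false := fun p => rfl
      simp only [distance, hfix, true_and, card_filter]
      rw [← finProdFinEquiv.sum_comp, Fintype.sum_prod_type]
      simp only [hval, ite_not, hwc, sum_const, card_univ, Fintype.card_fin, smul_eq_mul]
    have hws : ∀ v ∈ List.ofFn w, v ∈ W₀ := by
      intro v hv
      obtain ⟨i, rfl⟩ := (List.mem_ofFn' _ _).1 hv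
      exact hw i
    -- The search parts of the letters depend on the initial array, which is itself built from the
    -- letters, but only through their start words. An arbitrary word with the right start words
    -- settles the array first.
    obtain ⟨a₀, ha₀⟩ : ∃ a : List (Fin (A + 1)), a.map init = List.ofFn w := by
      refine ⟨List.ofFn fun i => (hsurj (w i) (hw i) (fun _ => 0) fun _ => ?_).choose, ?_⟩
      · exact (hbr fun _ => (0, 0)).choose
      · rw [List.map_ofFn]
        congr 1
        funext i
        exact (hsurj (w i) (hw i) (fun _ => 0) _).choose_spec.1
    have hg : Good L α (N₀ * c₀) (false, P.initArray (N₀ * b) a₀) :=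
      Or.inl ⟨rfl, hmark₀ a₀, fun _ => rfl, (hdist a₀ ha₀).le⟩
    obtain ⟨a, ha, h⟩ := hlist _ _ _ hws hg
    have hlen : a.length = N₀ := by simpa using congrArg List.length ha
    have hsame : P.initArray (N₀ * b) a = P.initArray (N₀ * b) a₀ := by
      have hi : ∀ i : ℕ, i < N₀ → init (a.getD i 0) = init (a₀.getD i 0) := by
        intro i hi
        have hlen₀ : a₀.length = N₀ := by simpa using congrArg List.length ha₀
        rw [List.getD_eq_getElem _ _ (hlen ▸ hi), List.getD_eq_getElem _ _ (hlen₀ ▸ hi)]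
        have := List.getElem_of_eq (ha.trans ha₀.symm) (i := i) (by simpa [hlen] using hi)
        simpa using this
      funext p
      have := hi (p / b) (Nat.div_lt_of_lt_mul (p.2.trans_eq (Nat.mul_comm _ _)))
      simp only [Procedure.initArray, hP, localSearch, this]
    refine ⟨a, hlen, (hanswer a).2 ?_⟩
    rw [hsame]
    rw [List.length_ofFn, Nat.sub_eq_zero_of_le (Nat.mul_le_mul_left _ hq)] at h
    exact h.solved hα

end Search

end CSP

/-! ### Choice of parameters and the size of the advice alphabet -/

namespace CSP

open Finset Filter Topology

theorem tendsto_mul_pow_zero (a K : ℝ) {ρ : ℝ} (h₀ : 0 ≤ ρ) (h₁ : ρ < 1) :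
    Tendsto (fun n : ℕ => K * ((n * a + 1) * (2 * n + 1) * ρ ^ n)) atTop (𝓝 0) := by
  have h (k : ℕ) : Tendsto (fun n : ℕ => (n : ℝ) ^ k * ρ ^ n) atTop (𝓝 0) :=
    tendsto_pow_const_mul_const_pow_of_abs_lt_one k (by rwa [abs_of_nonneg h₀])
  have h' := ((((h 2).const_mul (2 * a)).add ((h 1).const_mul (a + 2))).add (h 0)).const_mul K
  simp only [mul_zero, add_zero] at h'
  refine h'.congr fun n => ?_
  ring

/-- Lets one set of S symbols name the elements of two sets of different sizes, the code and the
branching sequences. -/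
theorem exists_surjective_fin {T : Type} [Fintype T] [Nonempty T] {S : ℕ}
    (h : Fintype.card T ≤ S) : ∃ f : Fin S → T, Function.Surjective f := by
  obtain ⟨g⟩ : Nonempty (T ↪ Fin S) :=
    Function.Embedding.nonempty_of_card_le (by rwa [Fintype.card_fin])
  exact ⟨Function.invFun g, Function.invFun_surjective g.injective⟩

theorem stepDist_le {κ e : ℕ} (a a' : Fin (κ + 1) × Fin e) : stepDist a a' ≤ 2 := by
  rw [stepDist]
  split <;> [split; skip] <;> omega

theorem exists_perm_stepDist {κ e : ℕ} (a a' : Fin (κ + 1) × Fin e) :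
    ∃ f : Equiv.Perm (Fin (κ + 1) × Fin e), ∀ x, stepDist (f x) a' = stepDist x a := by
  refine ⟨(Equiv.swap a.1 a'.1).prodCongr (Equiv.swap a.2 a'.2), fun x => ?_⟩
  have h₁ : Equiv.swap a.1 a'.1 x.1 = a'.1 ↔ x.1 = a.1 := by
    rw [Equiv.swap_apply_eq_iff, Equiv.swap_apply_right]
  have h₂ : Equiv.swap a.2 a'.2 x.2 = a'.2 ↔ x.2 = a.2 := by
    rw [Equiv.swap_apply_eq_iff, Equiv.swap_apply_right]
  simp only [stepDist, Equiv.prodCongr_apply, Prod.map, h₁, h₂]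

theorem sum_pow_ne {n : ℕ} (r : ℝ) (a : Fin (n + 1)) :
    ∑ x, r ^ (if x = a then 0 else 1) = 1 + n * r := by
  rw [Fin.sum_univ_succAbove _ a]
  simp [Fin.succAbove_ne]

/-- There is one pair at distance 0, there are e pairs with another value for the same variable, and
κ(e + 1) pairs with another variable. -/
theorem sum_pow_stepDist {κ e : ℕ} (r : ℝ) (a : Fin (κ + 1) × Fin (e + 1)) :
    ∑ x, r ^ stepDist x a = 1 + e * r + κ * (e + 1) * r ^ 2 := by
  rw [Fintype.sum_prod_type, Fin.sum_univ_succAbove _ a.1]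
  have h : ∀ y, stepDist (a.1, y) a = if y = a.2 then 0 else 1 := by
    intro y
    simp [stepDist]
  have h' : ∀ (i : Fin κ) y, stepDist (a.1.succAbove i, y) a = 2 := by
    intro i y
    simp [stepDist, Fin.succAbove_ne]
  simp only [h, h', sum_pow_ne]
  simp
  ring

/-- For every `s > κ e` there are codes for the steps of the first phase that need at most `s ^ m`
codewords for decreasing the distance by `m`. -/
theorem exists_step_code (κ e : ℕ) [NeZero κ] [NeZero e] {s : ℝ} (hs : (κ * e : ℝ) < s) :
    ∃ (t c m : ℕ) (W : Finset (Fin t → Fin (κ + 1) × Fin e)), 0 < m ∧ c + m = t ∧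
      (∀ w' : Fin t → Fin (κ + 1) × Fin e, ∃ w ∈ W, ∑ i, stepDist (w i) (w' i) = c) ∧
      (#W : ℝ) ≤ s ^ m := by
  obtain ⟨e, rfl⟩ : ∃ e', e = e' + 1 := Nat.exists_eq_succ_of_ne_zero (NeZero.ne e)
  have hκ : (1 : ℝ) ≤ κ := by exact_mod_cast NeZero.one_le
  push_cast at hs
  have he : (0 : ℝ) ≤ e := e.cast_nonneg
  have hs₁ : 1 < s := lt_of_le_of_lt (by nlinarith) hs
  have hs₀ : 0 < s := by linarith
  -- With this weight the target s^(t - c) equals s^t * r^c. Up to a polynomial factor, the bound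
  -- for the code is (T/g)^t * r^c, so it only remains to see that T * r < g.
  set r : ℝ := 1 / s with hr
  have hr₀ : 0 < r := by positivity
  have hr₁ : r < 1 := by rw [hr, div_lt_one hs₀]; exact hs₁
  have hr₂ : κ * (e + 1) * r < 1 := by rw [hr, mul_one_div, div_lt_one hs₀]; exact hs
  set g : ℝ := 1 + e * r + κ * (e + 1) * r ^ 2 with hg
  have hg₀ : 0 < g := by positivity
  have hcard : (Fintype.card (Fin (κ + 1) × Fin (e + 1)) : ℝ) = (κ + 1) * (e + 1) := by simp
  set T : ℝ := (κ + 1) * (e + 1) with hT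
  -- The difference factorises, and positivity of the second factor is exactly the assumption on s.
  have hgT : T * r < g := by
    have : g - T * r = (1 - r) * (1 - κ * (e + 1) * r) := by rw [hg, hT]; ring
    nlinarith [mul_pos (sub_pos.2 hr₁) (sub_pos.2 hr₂)]
  set ρ : ℝ := T * r / g with hρ
  have hρ₀ : 0 ≤ ρ := by positivity
  have hρ₁ : ρ < 1 := (div_lt_one hg₀).2 hgT
  obtain ⟨t, ht⟩ := ((tendsto_mul_pow_zero (Real.log T) 1 hρ₀ hρ₁).eventually_lt_const
    zero_lt_one).exists
  obtain ⟨c, W, hW, hWc⟩ := exists_code (stepDist (κ := κ) (e := e + 1)) stepDist_le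
    exists_perm_stepDist hr₀ (sum_pow_stepDist r) t
  rw [hcard] at hWc
  have hW₁ : 1 ≤ #W := by
    obtain ⟨w, hw, -⟩ := hW fun _ => 0
    exact card_pos.2 ⟨w, hw⟩
  have hlt : (#W : ℝ) < s ^ t * r ^ c := by
    have hTρ : T ^ t = ρ ^ t * g ^ t * s ^ t := by
      rw [← mul_pow, ← mul_pow, hρ, hr]
      congr 1
      field_simp
    refine lt_of_mul_lt_mul_right (hWc.trans_lt ?_) (pow_pos hg₀ t).le
    rw [hTρ]
    have h := mul_lt_mul_of_pos_right ht (by positivity : 0 < s ^ t * r ^ c * g ^ t)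
    calc _ = 1 * ((t * Real.log T + 1) * (2 * t + 1) * ρ ^ t) * (s ^ t * r ^ c * g ^ t) := by ring
      _ < _ := by linarith
  have hrc : r ^ c = 1 / s ^ c := by rw [hr, div_pow, one_pow]
  -- The code is not empty, so s^(t - c) exceeds 1. This makes the gain m positive.
  have hct : c < t := by
    by_contra h
    rw [not_lt] at h
    have h₁ : s ^ t ≤ s ^ c := pow_le_pow_right₀ hs₁.le h
    have h₂ : s ^ t * r ^ c ≤ 1 := by
      rw [hrc, mul_one_div, div_le_one (by positivity)]
      exact h₁
    have h₃ : (1 : ℝ) ≤ #W := by exact_mod_cast hW₁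
    linarith
  refine ⟨t, c, t - c, W, by omega, by omega, hW, hlt.le.trans_eq ?_⟩
  rw [hrc, mul_one_div, pow_sub₀ _ hs₀.ne' hct.le]
  rfl

/-- Parameters for which the local search is correct and needs few letters. -/
theorem exists_localSearch (κ e : ℕ) [NeZero κ] [NeZero e] {ε : ℝ} (hε : 0 < ε) :
    ∃ (t R A b : ℕ) (_ : NeZero b) (init : Fin (A + 1) → Fin b → Fin (e + 1))
      (op : Fin (A + 1) → ℕ → Op e t κ), ((A + 1 : ℕ) : ℝ) ≤ ((e + 1) * κ / (κ + 1) + ε) ^ b ∧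
      ∀ (N₀ : ℕ) (L : List (List (Literal (e + 1) (N₀ * b)))),
        (∀ C ∈ L, C.Nodup ∧ C.length ≤ κ + 1) →
        ((∃ a : List (Fin (A + 1)), a.length = N₀ ∧
          (localSearch (R := R) init op).answer L a = true) ↔ ∃ α, Satisfies L α) := by
  have hκ : (1 : ℝ) ≤ κ := by exact_mod_cast NeZero.one_le
  have he : (1 : ℝ) ≤ e := by exact_mod_cast NeZero.one_le
  -- Above κe, so that step codes exist, but by so little that the final base stays below the target
  -- plus ε.
  set s : ℝ := κ * e + ε / 2 with hs
  have hs₀ : 0 < s := by positivity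
  obtain ⟨t, c, m, W, hm, hc, hW, hWc⟩ := exists_step_code κ e (s := s) (by linarith)
  set S : ℕ := max #W ((κ * e) ^ m) with hS
  have hSs : (S : ℝ) ≤ s ^ m := by
    rw [hS, Nat.cast_max, max_le_iff]
    refine ⟨hWc, ?_⟩
    push_cast
    exact pow_le_pow_left₀ (by positivity) (by linarith) m
  have hWne : W.Nonempty := by
    obtain ⟨w, hw, -⟩ := hW fun _ => (0, 0)
    exact ⟨w, hw⟩
  have : Nonempty W := hWne.to_subtype
  obtain ⟨cw, hcw⟩ := exists_surjective_fin (T := W) (S := S) (by simp [hS])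
  obtain ⟨br, hbr⟩ := exists_surjective_fin (T := Fin m → Fin κ × Fin e) (S := S) (by simp [hS])
  -- The weight r^c₀ in the size of the block code cancels the s^c₀ search choices, which makes the
  -- radius c₀ irrelevant.
  set r : ℝ := 1 / s with hr
  have hr₀ : 0 < r := by positivity
  set g : ℝ := 1 + e * r with hg
  have hg₀ : 0 < g := by positivity
  set B : ℝ := (e + 1) * κ / (κ + 1) + ε with hB
  have hB₀ : 0 < B := by positivity
  set ρ : ℝ := (e + 1) / g / B with hρ
  have hρ₀ : 0 ≤ ρ := by positivity
  -- The claim amounts to (e + 1) * s < B * (s + e). Both sides agree for s = κe and ε = 0, and ε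
  -- adds more to the right side than ε / 2 adds to the left.
  have hρ₁ : ρ < 1 := by
    rw [hρ, div_lt_one hB₀, hg, hr, div_lt_iff₀ (by positivity)]
    have h₁ : (e + 1 : ℝ) * κ / (κ + 1) * (κ + 1) = (e + 1) * κ := by field_simp
    set B' : ℝ := (e + 1) * κ / (κ + 1) with hB'
    have h₃ : B * (1 + e * (1 / s)) * s = B * (s + e) := by field_simp
    have h₄ : (e + 1) * s < B * (s + e) := by
      have h₅ : B' * (e * (κ + 1)) = (e + 1) * κ * e := by rw [← h₁]; ring
      have h₆ : 0 ≤ B' := by positivity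
      have h₇ : B * (s + e) = B' * (e * (κ + 1)) + B' * (ε / 2) + ε * (κ * e + ε / 2 + e) := by
        rw [hB, hs]; ring
      rw [h₇, h₅, hs]
      have h₈ : (e + 1) * (ε / 2) ≤ ε * e := by nlinarith
      have h₉ : 0 < ε * (κ * e + ε / 2) := by positivity
      nlinarith [mul_nonneg h₆ hε.le]
    rw [← h₃] at h₄
    exact lt_of_mul_lt_mul_right h₄ hs₀.le
  set K : ℕ := Fintype.card (Mark t κ → Fin (e + 1)) with hK
  -- The block is long enough for the factor ρ^b to absorb the polynomial, the K choices of fixed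
  -- values, and the s^m lost by rounding.
  obtain ⟨b, hb, hb₀⟩ := ((((tendsto_mul_pow_zero (Real.log (e + 1)) (K * s ^ m) hρ₀
    hρ₁).eventually_lt_const zero_lt_one).and (eventually_gt_atTop 0))).exists
  have : NeZero b := ⟨hb₀.ne'⟩
  obtain ⟨c₀, W₀, hW₀, hW₀c⟩ := exists_code (T := Fin (e + 1))
    (fun x y => if x = y then 0 else 1) (fun x y => by split <;> omega)
    (fun a a' => ⟨Equiv.swap a a', fun x => by
      have : Equiv.swap a a' x = a' ↔ x = a := by
        rw [Equiv.swap_apply_eq_iff, Equiv.swap_apply_right]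
      simp only [this]⟩) hr₀ (sum_pow_ne r) b
  -- Enough macro steps to cover the radius, exceeding it by at most m.
  set q : ℕ := c₀ / m + 1 with hq
  have hqm : c₀ ≤ q * m := by
    rw [hq, Nat.succ_mul]
    have := Nat.div_add_mod' c₀ m
    have := Nat.mod_lt c₀ hm
    omega
  have hqm' : q * m ≤ c₀ + m := by
    rw [hq, Nat.succ_mul]
    have := Nat.div_mul_le_self c₀ m
    omega
  set Λ := W₀ × (Mark t κ → Fin (e + 1)) × (Fin q → Fin S) with hΛ
  have hΛc : Fintype.card Λ = #W₀ * (K * S ^ q) := by simp [hΛ, hK]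
  have : Nonempty Λ := by
    obtain ⟨w, hw, -⟩ := hW₀ fun _ => 0
    exact ⟨⟨w, hw⟩, fun _ => 0, fun _ => (hbr fun _ => (0, 0)).choose⟩
  obtain ⟨A, hA⟩ : ∃ A, Fintype.card Λ = A + 1 :=
    Nat.exists_eq_succ_of_ne_zero Fintype.card_ne_zero
  have f : Fin (A + 1) ≃ Λ := (finCongr hA.symm).trans (Fintype.equivFin Λ).symm
  refine ⟨t, q * (m + 1), A, b, inferInstance, fun a => (f a).1.1,
    letterOp (fun i => (cw i).1) br (fun a => (f a).2.1) fun a => (f a).2.2, ?_,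
    fun N₀ L hL => exists_answer_iff (by omega) hL hc hW (fun w hw => ?_) hbr hW₀ hqm
      fun w hw β₀ σ₀ => ?_⟩
  · rw [← hA, hΛc]
    push_cast
    have h₁ : (S : ℝ) ^ q ≤ s ^ m * s ^ c₀ := by
      have hs₁ : 1 ≤ s := by nlinarith
      calc (S : ℝ) ^ q ≤ (s ^ m) ^ q := pow_le_pow_left₀ (by positivity) hSs q
        _ = s ^ (q * m) := by rw [← pow_mul, Nat.mul_comm]
        _ ≤ s ^ (m + c₀) := pow_le_pow_right₀ hs₁ (by omega)
        _ = _ := pow_add _ _ _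
    rw [Fintype.card_fin] at hW₀c
    push_cast at hW₀c
    have h₂ : r ^ c₀ * s ^ c₀ = 1 := by
      rw [← mul_pow, hr, one_div_mul_cancel hs₀.ne', one_pow]
    have h₃ : ((e : ℝ) + 1) ^ b = ρ ^ b * g ^ b * B ^ b := by
      rw [← mul_pow, ← mul_pow, hρ]
      congr 1
      field_simp
    refine le_of_mul_le_mul_right ?_ (pow_pos hg₀ b)
    calc (#W₀ : ℝ) * (K * (S : ℝ) ^ q) * g ^ b = (#W₀ * g ^ b) * (K * (S : ℝ) ^ q) := by ring
      _ ≤ ((b * Real.log (e + 1) + 1) * (2 * b + 1) * (e + 1) ^ b * r ^ c₀) *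
          (K * (s ^ m * s ^ c₀)) :=
        mul_le_mul hW₀c (by gcongr) (by positivity) (le_trans (by positivity) hW₀c)
      _ = (r ^ c₀ * s ^ c₀) * (K * s ^ m * ((b * Real.log (e + 1) + 1) * (2 * b + 1) * ρ ^ b)) *
          (B ^ b * g ^ b) := by rw [h₃]; ring
      _ ≤ 1 * (B ^ b * g ^ b) := by
        rw [h₂, one_mul]
        exact mul_le_mul_of_nonneg_right hb.le (by positivity)
      _ = _ := one_mul _
  · obtain ⟨i, hi⟩ := hcw ⟨w, hw⟩
    exact ⟨i, congrArg Subtype.val hi⟩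
  · exact ⟨f.symm (⟨w, hw⟩, β₀, σ₀), by simp⟩

end CSP

/-! ### Length of the input, padding of the variables, running time -/

namespace CSP

open Finset

/-- Constraints are distinct sets of at most k of the n * d literals. For fixed d and k there are
polynomially many, so the input length is bounded in terms of n. -/
theorem card_constraints_le {d k n : ℕ} (F : Formula d k n) :
    #F.constraints ≤ (k + 1) * (n * d + 1) ^ k := by
  have h : F.constraints ⊆ (range (k + 1)).biUnion fun j =>
      powersetCard j (univ : Finset (Literal d n)) := by
    intro C hC
    exact mem_biUnion.2 ⟨#C, mem_range.2 (Nat.lt_succ_of_le (F.card_le C hC)),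
      mem_powersetCard.2 ⟨subset_univ _, rfl⟩⟩
  refine (card_le_card h).trans ?_
  refine (card_biUnion_le_card_mul _ _ ((n * d + 1) ^ k) fun j hj => ?_).trans_eq
    (by rw [card_range])
  rw [card_powersetCard, card_univ, Fintype.card_prod, Fintype.card_fin, Fintype.card_fin]
  exact (Nat.choose_le_pow _ _).trans ((Nat.pow_le_pow_left (Nat.le_succ _) _).trans
    (Nat.pow_le_pow_right (Nat.succ_pos _) (Nat.lt_succ_iff.1 (mem_range.1 hj))))

theorem length_encodeConstraint_le {d k n : ℕ} {C : List (Literal d n)} (hC : C.length ≤ k) :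
    (encodeConstraint C).length ≤ k * (n + d) + 1 := by
  rw [encodeConstraint, List.length_append, List.length_singleton, Nat.add_le_add_iff_right,
    List.length_flatMap]
  refine (List.sum_le_card_nsmul _ (n + d) ?_).trans ?_
  · intro l hl
    obtain ⟨u, -, rfl⟩ := List.mem_map.1 hl
    simp only [encodeLiteral, encodeNat, List.length_append, List.length_replicate,
      List.length_singleton]
    omega
  · rw [List.length_map, smul_eq_mul]
    exact Nat.mul_le_mul_right _ hC

theorem Formula.ListedBy.mem {d k n : ℕ} {F : Formula d k n} {L : List (List (Literal d n))}
    (h : F.ListedBy L) {C : List (Literal d n)} (hC : C ∈ L) :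
    C.Nodup ∧ C.length ≤ k ∧ C.toFinset ∈ F.constraints := by
  have hmem : C.toFinset ∈ F.constraints := by
    rw [← h.2.2, List.mem_toFinset]
    exact List.mem_map_of_mem hC
  refine ⟨h.1 C hC, ?_, hmem⟩
  rw [← List.toFinset_card_of_nodup (h.1 C hC)]
  exact F.card_le _ hmem

theorem Formula.ListedBy.length_le {d k n : ℕ} {F : Formula d k n} {L : List (List (Literal d n))}
    (h : F.ListedBy L) :
    (L.flatMap encodeConstraint).length ≤ (k + 1) * (n * d + 1) ^ k * (k * (n + d) + 1) := by
  have hlen : L.length ≤ (k + 1) * (n * d + 1) ^ k := by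
    have := List.toFinset_card_of_nodup h.2.1
    rw [h.2.2, List.length_map] at this
    rw [← this]
    exact card_constraints_le F
  rw [List.length_flatMap]
  refine (List.sum_le_card_nsmul _ (k * (n + d) + 1) ?_).trans ?_
  · intro l hl
    obtain ⟨C, hC, rfl⟩ := List.mem_map.1 hl
    exact length_encodeConstraint_le (h.mem hC).2.1
  · rw [List.length_map, smul_eq_mul]
    exact Nat.mul_le_mul_right _ hlen

/-- Regard a list of constraints as a list of constraints over more variables. -/
def castList {d n N : ℕ} (h : n ≤ N) (L : List (List (Literal d n))) : List (List (Literal d N)) :=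
  L.map (List.map (Prod.map (Fin.castLE h) id))

theorem flatMap_castList {d n N : ℕ} (h : n ≤ N) (L : List (List (Literal d n))) :
    (castList h L).flatMap encodeConstraint = L.flatMap encodeConstraint := by
  rw [castList, List.flatMap_map]
  congr 1
  funext C
  rw [encodeConstraint, List.flatMap_map]
  rfl

/-- The variables that fill up the last block occur in no constraint, so their values are
immaterial. -/
theorem castList_satisfies {e κ n N : ℕ} (h : n ≤ N) {F : Formula (e + 1) κ n}
    {L : List (List (Literal (e + 1) n))} (hL : F.ListedBy L) :
    (∃ α, Satisfies (castList h L) α) ↔ F.Satisfiable := by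
  constructor
  · rintro ⟨α, hα⟩
    refine ⟨fun p => α (Fin.castLE h p), fun C hC => ?_⟩
    rw [← hL.2.2, List.mem_toFinset] at hC
    obtain ⟨C, hCL, rfl⟩ := List.mem_map.1 hC
    obtain ⟨u, hu, hne⟩ := hα _ (List.mem_map_of_mem hCL)
    obtain ⟨u, huC, rfl⟩ := List.mem_map.1 hu
    exact ⟨u, List.mem_toFinset.2 huC, hne⟩
  · rintro ⟨α, hα⟩
    refine ⟨fun p => if hp : (p : ℕ) < n then α ⟨p, hp⟩ else 0, fun C hC => ?_⟩
    obtain ⟨C, hCL, rfl⟩ := List.mem_map.1 hC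
    obtain ⟨u, hu, hne⟩ := hα _ (hL.mem hCL).2.2
    refine ⟨_, List.mem_map_of_mem (List.mem_toFinset.1 hu), ?_⟩
    simpa using hne

namespace Procedure

variable {Q X : Type} {A b : ℕ} (P : Procedure Q X A b)

theorem totalCost_mono (n : ℕ) : Monotone (P.totalCost n) := by
  intro w w' h
  simp only [totalCost, tryCost, scanCost]
  gcongr

/-- The cost of the procedure is exponential only in the number of advice words. -/
theorem isOStar_totalCost [NeZero b] {B : ℝ} (hB : 1 ≤ B) (hA : ((A + 1 : ℕ) : ℝ) ≤ B ^ b)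
    (W : Polynomial ℕ) : IsOStar (fun n => P.totalCost n (W.eval n)) fun n => B ^ n := by
  obtain ⟨G, hG⟩ := exists_nat_ge (B ^ b)
  have hS : ∃ s : Polynomial ℕ, ∀ n, s.eval n = scanCost (n + b) (W.eval n) :=
    ⟨(.C 6 * (.X + .C b) + .C 17) * (W + 1), fun n => by simp [scanCost]⟩
  obtain ⟨s, hs⟩ := hS
  refine ⟨.C G * ((.X + 1) * (.C b + .C P.rounds * (.C 2 * s) + .C 21) + .C 2 * s + .C 21 +
    .C 3 * W + .C 8 * .X + .C 20), fun n => ?_⟩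
  have h₁ : n / b + 1 ≤ n + 1 := Nat.succ_le_succ (Nat.div_le_self n b)
  have h₂ : (n / b + 1) * b ≤ n + b := by
    rw [Nat.succ_mul]
    exact Nat.add_le_add_right (Nat.div_mul_le_self n b) b
  set p : ℕ := (n + 1) * (b + P.rounds * (2 * s.eval n) + 21) + 2 * s.eval n + 21 +
    3 * W.eval n + 8 * n + 20 with hp
  have h₃ : P.totalCost n (W.eval n) ≤ (A + 1) ^ (n / b + 1) * p := by
    have hsc : scanCost ((n / b + 1) * b) (W.eval n) ≤ s.eval n := by
      rw [hs, scanCost, scanCost]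
      gcongr
    have ht : P.tryCost ((n / b + 1) * b) (n / b + 1) (W.eval n) ≤
        (n + 1) * (b + P.rounds * (2 * s.eval n) + 21) + 2 * s.eval n + 20 := by
      rw [tryCost]
      gcongr
    have hpos : 1 ≤ (A + 1) ^ (n / b + 1) := Nat.one_le_pow _ _ (Nat.succ_pos A)
    rw [totalCost, hp]
    nlinarith
  -- Rounding n up to whole blocks costs at most one further factor B^b, a constant.
  have h₄ : (((A + 1) ^ (n / b + 1) : ℕ) : ℝ) ≤ G * B ^ n := by
    rw [Nat.cast_pow]
    calc ((A + 1 : ℕ) : ℝ) ^ (n / b + 1) ≤ (B ^ b) ^ (n / b + 1) :=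
          pow_le_pow_left₀ (Nat.cast_nonneg _) hA _
      _ = B ^ ((n / b + 1) * b) := by rw [← pow_mul, Nat.mul_comm]
      _ ≤ B ^ (b + n) := pow_le_pow_right₀ hB (by omega)
      _ = B ^ b * B ^ n := pow_add _ _ _
      _ ≤ G * B ^ n := by gcongr
  calc ((P.totalCost n (W.eval n) : ℕ) : ℝ) ≤ (((A + 1) ^ (n / b + 1) * p : ℕ) : ℝ) := by
        exact_mod_cast h₃
    _ = (((A + 1) ^ (n / b + 1) : ℕ) : ℝ) * p := Nat.cast_mul _ _
    _ ≤ G * B ^ n * p := by gcongr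
    _ = ((G * p : ℕ) : ℝ) * B ^ n := by push_cast; ring
    _ = _ := by simp [hp]

end Procedure

end CSP

theorem corollary1 (d k : ℕ) (hd : 2 ≤ d) (hk : 2 ≤ k) (ε : ℝ) (hε : 0 < ε) :
    ∃ (M : Turing.TM2ComputableAux CSP.Symbol Bool) (t : ℕ → ℕ),
      CSP.SolvesInTime M d k t ∧
        CSP.IsOStar t (fun n => ((d : ℝ) * ((k : ℝ) - 1) / (k : ℝ) + ε) ^ n) := by
  -- Here e counts the values a variable can be changed to, and κ bounds the free variables of a
  -- constraint that contains a fixed one.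
  obtain ⟨e, rfl⟩ : ∃ e, d = e + 1 := ⟨d - 1, by omega⟩
  obtain ⟨κ, rfl⟩ : ∃ κ, k = κ + 1 := ⟨k - 1, by omega⟩
  have : NeZero e := ⟨by omega⟩
  have : NeZero κ := ⟨by omega⟩
  obtain ⟨t, R, A, b, _, init, op, hA, hP⟩ := CSP.exists_localSearch κ e hε
  set P := CSP.localSearch (R := R) init op
  have hbase : ((e + 1 : ℕ) : ℝ) * (((κ + 1 : ℕ) : ℝ) - 1) / ((κ + 1 : ℕ) : ℝ) + ε =
      (e + 1) * κ / (κ + 1) + ε := by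
    push_cast
    ring
  have hB : (1 : ℝ) ≤ (e + 1) * κ / (κ + 1) + ε := by
    have hκ : (1 : ℝ) ≤ κ := by exact_mod_cast NeZero.one_le
    have he : (1 : ℝ) ≤ e := by exact_mod_cast NeZero.one_le
    have : (1 : ℝ) ≤ (e + 1) * κ / (κ + 1) := by
      rw [le_div_iff₀ (by positivity)]
      nlinarith
    linarith
  set W : Polynomial ℕ := .C (κ + 2) * (.X * .C (e + 1) + 1) ^ (κ + 1) *
    (.C (κ + 1) * (.X + .C (e + 1)) + 1) with hW
  have hWn : ∀ n : ℕ, W.eval n =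
      (κ + 1 + 1) * (n * (e + 1) + 1) ^ (κ + 1) * ((κ + 1) * (n + (e + 1)) + 1) := by
    intro n
    simp [hW]
  refine ⟨P.toMachine (e + 1), fun n => P.totalCost n (W.eval n), fun n F L hF => ?_, ?_⟩
  · have hn : n ≤ (n / b + 1) * b := by
      rw [Nat.succ_mul]
      have := Nat.div_add_mod' n b
      have := Nat.mod_lt n (NeZero.pos b)
      omega
    have hL : ∀ C ∈ CSP.castList hn L, C.Nodup ∧ C.length ≤ κ + 1 := by
      intro C hC
      obtain ⟨C, hCL, rfl⟩ := List.mem_map.1 hC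
      rw [List.length_map]
      exact ⟨(hF.mem hCL).1.map ((Fin.castLE_injective hn).prodMap Function.injective_id),
        (hF.mem hCL).2.1⟩
    obtain ⟨h⟩ := P.toMachine_outputs n (CSP.castList hn L)
    rw [CSP.flatMap_castList] at h
    have hdec := (hP _ _ hL).trans (CSP.castList_satisfies hn hF)
    refine ⟨⟨⟨h.steps, ?_⟩, h.steps_le_m.trans ?_⟩⟩
    · have := h.evals_in_steps
      simp only [hdec] at this
      exact this
    · refine P.totalCost_mono n ?_
      rw [hWn]
      exact hF.length_le
  · rw [hbase]
    exact P.isOStar_totalCost hB hA W
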